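/- Let $U=U'_q(D_4^{(3)})$ be the $\mathbb{Q}(q)$-algebra with generators $e_i,f_i,t_i^{\pm1}$ ($i=0,1,2$) and the usual Drinfeld–Jimbo relations for the Cartan matrix $(\langle h_i,\alpha_j\rangle)=\begin{pmatrix}2&-1&0\\-1&2&-3\\0&-1&2\end{pmatrix}$, with $q_0=q_1=q$, $q_2=q^3$, $[m]=(q^m-q^{-m})/(q-q^{-1})$, and with coproduct $\Delta(e_i)=e_i\otimes t_i^{-1}+1\otimes e_i$, $\Delta(f_i)=f_i\otimes 1+t_i\otimes f_i$, $\Delta(t_i)=t_i\otimes t_i$; let $U_q(G_2)\subset U$ be the subalgebra generated by $e_i,f_i,t_i^{\pm1}$, $i=1,2$, with fundamental weights $\bar\Lambda_1,\bar\Lambda_2$. Let $V^1$ be the $8$-dimensional $U$-module with basis $v_1,v_2,v_3,v_0,v_{\bar3},v_{\bar2},v_{\bar1},v_\phi$, where $t_iv=q_i^{\langle h_i,\lambda\rangle}v$ for $v$ of weight $\lambda$, the weights being $\Lambda_1-2\Lambda_0,\ \Lambda_2-\Lambda_1-\Lambda_0,\ 2\Lambda_1-\Lambda_2-\Lambda_0,\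 0,\ \Lambda_0+\Lambda_2-2\Lambda_1,\ \Lambda_0+\Lambda_1-\Lambda_2,\ 2\Lambda_0-\Lambda_1,\ 0$, and (unlisted actions being $0$) $$\begin{aligned} &e_0v_1=v_\phi+\tfrac1{[2]}v_0,\ e_0v_2=v_{\bar3},\ e_0v_3=v_{\bar2},\ e_0v_0=v_{\bar1},\ e_0v_\phi=\tfrac{[3]}{[2]}v_{\bar1},\\ &f_0v_{\bar1}=v_\phi+\tfrac1{[2]}v_0,\ f_0v_{\bar2}=v_3,\ f_0v_{\bar3}=v_2,\ f_0v_0=v_1,\ f_0v_\phi=\tfrac{[3]}{[2]}v_1,\\ &e_1v_2=v_1,\ e_1v_0=[2]v_3,\ e_1v_{\bar3}=v_0,\ e_1v_{\bar1}=v_{\bar2},\quad f_1v_{\bar2}=v_{\bar1},\ f_1v_0=[2]v_{\bar3},\ f_1v_3=v_0,\ f_1v_1=v_2,\\ &e_2v_3=v_2,\ e_2v_{\bar2}=v_{\bar3},\quad f_2v_{\bar3}=v_{\bar2},\ f_2v_2=v_3 . \end{aligned}$$ For a parameter $x$ let $V^1_x$ be $V^1$, with scalars extended, on which $e_i,f_i,t_i$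 act as $x^{\delta_{i0}}e_i,\ x^{-\delta_{i0}}f_i,\ t_i$. Let $x,y$ be independent indeterminates and $z=x/y$; scalars are extended to $\mathbb{Q}(q)(x,y)$. An $R$-matrix for $V^1\otimes V^1$ is a nonzero $U$-linear map $V^1_x\otimes V^1_y\to V^1_y\otimes V^1_x$ lying in $\mathbb{Q}(q)[z,z^{-1}]\otimes\mathrm{End}(V^1\otimes V^1)$. **(a)** As a $U_q(G_2)$-module, $V^1\otimes V^1$ is the direct sum of the irreducible submodules generated by the highest weight vectors (of weights $2\bar\Lambda_1$, $\bar\Lambda_2$, $\bar\Lambda_1$ three times, $0$ twice) $$\begin{aligned} &u_{2\Lambda_1}=v_1\otimes v_1,\quad u_{\Lambda_2}=v_1\otimes v_2-q\,v_2\otimes v_1,\quad u^{(1)}_{\Lambda_1}=v_1\otimes v_\phi,\quad u^{(2)}_{\Lambda_1}=v_\phi\otimes v_1,\\ &u^{(3)}_{\Lambda_1}=v_1\otimes v_0-q^6v_0\otimes v_1-q^2[2]v_2\otimes v_3+q^5[2]v_3\otimes v_2,\quad u_0^{(1)}=v_\phi\otimes v_\phi,\\ &u_0^{(2)}=v_1\otimes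 v_{\bar1}+q^{10}v_{\bar1}\otimes v_1-q\,v_2\otimes v_{\bar2}-q^9v_{\bar2}\otimes v_2+q^4v_3\otimes v_{\bar3}+q^6v_{\bar3}\otimes v_3-\tfrac{q^4}{[2]}v_0\otimes v_0 . \end{aligned}$$ Let $P_{2\Lambda_1},P_{\Lambda_2},P^{(i)}_{\Lambda_1},P^{(i)}_0$ be the projections onto these summands along the sum of the others. There are $U_q(G_2)$-isomorphisms $\iota^{(j,i)}_{\Lambda_1}$ and $\iota^{(j,i)}_0$ between the respective summands with $u^{(i)}_{\Lambda_1}\mapsto u^{(j)}_{\Lambda_1}$ and $u^{(i)}_0\mapsto u^{(j)}_0$. **(b)** The operator $$\begin{aligned}R(x,y)=\ &(1-q^2z)(1-q^6z)(1+q^4z+q^8z^2)P_{2\Lambda_1}+(z-q^2)(1-q^6z)(1+q^4z+q^8z^2)P_{\Lambda_2}\\&+\sum_{i,j=1}^3a^{\Lambda_1}_{ij}\,\iota^{(j,i)}_{\Lambda_1}P^{(i)}_{\Lambda_1}+\sum_{i,j=1}^2a^0_{ij}\,\iota^{(j,i)}_0P^{(i)}_0\end{aligned}$$ is an $R$-matrix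 for $V^1\otimes V^1$, where $$\begin{aligned} a^{\Lambda_1}_{11}&=a^{\Lambda_1}_{22}=\frac{(1-q^6)z(1-q^{12}z^2)}{1+q^2},\\ a^{\Lambda_1}_{12}&=a^{\Lambda_1}_{21}=\frac{q^2(1-z)(1-q^6z)\bigl((1+q^2)(1+q^6z^2)+(q^2+q^6)z\bigr)}{1+q^2},\\ a^{\Lambda_1}_{13}&=a^{\Lambda_1}_{23}=\frac{q(1-q^6)z(1-z)(1-q^6z)}{(1+q^2)^2},\qquad a^{\Lambda_1}_{31}=a^{\Lambda_1}_{32}=(1+q^2)^2(1+q^8)a^{\Lambda_1}_{13},\\ a^{\Lambda_1}_{33}&=\frac{(1-q^6z)\bigl(q^2(1+q^2)(z^3-q^6)+(1-q^2)(1-q^6)z(z-q^4)\bigr)}{1+q^2},\\ a^0_{11}&=\frac{(1+q^2)(q^2+q^{14}z^4)-(1+q^8)z(q^2+q^8z^2)+(1-q^4)(1-q^6)(1+q^8)z^2}{1+q^2},\\ a^0_{12}&=\frac{q(1-q^6)^2z(1-z^2)}{(1+q^2)(1-q^4)},\quad a^0_{21}=q(1-q^{14})(1-q^4+q^8)z(1-z^2),\quad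 a^0_{22}=z^4\bigl(a^0_{11}|_{z\to1/z}\bigr). \end{aligned}$$ Every $U$-linear map $V^1_x\otimes V^1_y\to V^1_y\otimes V^1_x$ over $\mathbb{Q}(q)(x,y)$ is a scalar multiple $c\,R(x,y)$, and $c\in\mathbb{Q}(q)(z)$ if the map has coefficients in $\mathbb{Q}(q)(z)$ (in particular if it is an $R$-matrix). **(c)** With $a^{2\Lambda_1}=(1-q^2z)(1-q^6z)(1+q^4z+q^8z^2)$, $$\det(a^{\Lambda_1}_{ij})=\frac{(z-q^2)^2(z^2+q^4z+q^8)}{(1-q^2z)^2(1+q^4z+q^8z^2)}(a^{2\Lambda_1})^3,\qquad \det(a^0_{ij})=\frac{(z-q^2)(z-q^6)(z^2+q^4z+q^8)}{(1-q^2z)(1-q^6z)(1+q^4z+q^8z^2)}(a^{2\Lambda_1})^2 .$$ -/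

import Mathlib

open scoped TensorProduct

namespace D43

/-! ### The quantum affine algebra -/

/-- The ground field `ℚ(q)`. -/
abbrev K : Type := RatFunc ℚ

/-- The quantum parameter. -/
noncomputable def q : K := RatFunc.X

/-- The generalized Cartan matrix `⟨h_i, α_j⟩` of type `D_4^{(3)}`. -/
def cartan : Fin 3 → Fin 3 → ℤ :=
  ![![2, -1, 0], ![-1, 2, -3], ![0, -1, 2]]

/-- `q_0 = q_1 = q`, `q_2 = q^3`. -/
noncomputable def qi (i : Fin 3) : K := if i = 2 then q ^ 3 else q

section

variable {k B : Type*} [Field k] [Ring B] [Algebra k B]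

/-- The `s`-integer `(s^m - s^{-m}) / (s - s^{-1})`. -/
def sInt (s : k) (m : ℕ) : k := (s ^ m - s⁻¹ ^ m) / (s - s⁻¹)

/-- The `s`-factorial. -/
def sFact (s : k) (n : ℕ) : k := ∏ m ∈ Finset.range n, sInt s (m + 1)

/-- The divided power `x^n / [n]_s!`. -/
def divPow (s : k) (n : ℕ) (x : B) : B := (sFact s n)⁻¹ • x ^ n

/-- The quantum Serre expression `∑_{n=0}^l (-1)^n x^{(n)} y x^{(l-n)}`. -/
def serre (s : k) (l : ℕ) (x y : B) : B :=
  ∑ n ∈ Finset.range (l + 1), ((-1 : k) ^ n) • (divPow s n x * y * divPow s (l - n) x)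

theorem map_serre {C : Type*} [Ring C] [Algebra k C] (φ : B →ₐ[k] C)
    (s : k) (l : ℕ) (x y : B) : φ (serre s l x y) = serre s l (φ x) (φ y) := by
  simp [serre, divPow]

theorem serre_one (s : k) (h : s - s⁻¹ ≠ 0) (x y : B) : serre s 1 x y = y * x - x * y := by
  have e1 : sInt s 1 = 1 := by simp [sInt, h]
  simp [serre, divPow, sFact, Finset.sum_range_succ, e1, sub_eq_add_neg]

theorem serre_two (s : k) (h0 : s ≠ 0) (h : s - s⁻¹ ≠ 0) (h2 : s + s⁻¹ ≠ 0) (x y : B) :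
    serre s 2 x y = (s + s⁻¹)⁻¹ • (y * (x * x) - (s + s⁻¹) • (x * (y * x)) + x * (x * y)) := by
  have e1 : sInt s 1 = 1 := by simp [sInt, h]
  have e2 : sInt s 2 = s + s⁻¹ := by
    rw [sInt, div_eq_iff h]; field_simp; ring
  simp only [serre, divPow, sFact, Finset.sum_range_succ, Finset.prod_range_succ, e1, e2,
    Finset.range_zero, Finset.sum_empty, Finset.prod_empty, zero_add, one_mul]
  simp only [pow_succ, pow_zero, one_mul, mul_one, inv_one, one_smul, smul_mul_assoc,
    mul_smul_comm, mul_assoc, mul_neg, neg_neg, Nat.reduceSub,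
    Finset.range_zero, Finset.prod_empty]
  have h3 : s ^ 2 + 1 ≠ 0 := fun h3 => h2 (by field_simp; rw [h3, mul_zero])
  match_scalars <;> field_simp

theorem serre_four (s : k) (h0 : s ≠ 0) (h : s - s⁻¹ ≠ 0) (n2 : s ^ 2 + 1 ≠ 0)
    (n3 : s ^ 4 + s ^ 2 + 1 ≠ 0) (n4 : s ^ 4 + 1 ≠ 0) (x y : B) :
    serre s 4 x y = (sFact s 4)⁻¹ • (y * (x * (x * (x * x)))
      - (s ^ 3 + s + s⁻¹ + (s ^ 3)⁻¹) • (x * (y * (x * (x * x))))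
      + (s ^ 4 + s ^ 2 + 2 + (s ^ 2)⁻¹ + (s ^ 4)⁻¹) • (x * (x * (y * (x * x))))
      - (s ^ 3 + s + s⁻¹ + (s ^ 3)⁻¹) • (x * (x * (x * (y * x)))) + x * (x * (x * (x * y)))) := by
  have e1 : sInt s 1 = 1 := by simp [sInt, h]
  have e2 : sInt s 2 = (s ^ 2 + 1) / s := by
    rw [sInt, div_eq_iff h]; field_simp; ring
  have e3 : sInt s 3 = (s ^ 4 + s ^ 2 + 1) / s ^ 2 := by
    rw [sInt, div_eq_iff h]; field_simp; ring
  have e4 : sInt s 4 = (s ^ 2 + 1) * (s ^ 4 + 1) / s ^ 3 := by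
    rw [sInt, div_eq_iff h]; field_simp; ring
  simp only [serre, divPow, sFact, Finset.sum_range_succ, Finset.prod_range_succ, Nat.reduceSub,
    Nat.reduceAdd, Finset.range_zero, Finset.sum_empty, Finset.prod_empty, zero_add, e1, e2, e3, e4]
  simp only [pow_succ, pow_zero, one_mul, mul_one, inv_one, one_smul, smul_mul_assoc,
    mul_smul_comm, mul_assoc, mul_neg, neg_neg]
  have n3' : s ^ 2 * (s ^ 2 + 1) + 1 ≠ 0 := by convert n3 using 2; ring
  match_scalars <;> field_simp <;> ring

theorem serre_add_two (p u : k) (hp : p ≠ 0) (hu : u = p + p⁻¹) (a b c d : B)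
   (hab : a * b = p^2 • (b * a)) (had : a * d = p⁻¹ • (d * a)) (hcb : c * b = p⁻¹ • (b * c))
   (h1 : c * (a * a) - u • (a * (c * a)) + a * (a * c) = 0)
   (h2 : d * (b * b) - u • (b * (d * b)) + b * (b * d) = 0) :
   (c+d) * ((a+b) * (a+b)) - u • ((a+b) * ((c+d) * (a+b))) + (a+b) * ((a+b) * (c+d)) = 0 := by
  have hab' : ∀ x, a * (b * x) = p^2 • (b * (a * x)) := fun x => by rw [← mul_assoc, hab]; simp [mul_assoc]
  have had' : ∀ x, a * (d * x) = p⁻¹ • (d * (a * x)) := fun x => by rw [← mul_assoc, had]; simp [mul_assoc]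
  have hcb' : ∀ x, c * (b * x) = p⁻¹ • (b * (c * x)) := fun x => by rw [← mul_assoc, hcb]; simp [mul_assoc]
  rw [← add_zero (0:B)]
  nth_rw 1 [← h1]
  rw [← h2]
  simp only [mul_add, add_mul, hab, had, hcb, hab', had', hcb', mul_smul_comm, smul_smul]
  match_scalars <;> subst hu <;> field_simp <;> ring

theorem serre_add_four (p u w : k) (hp : p ≠ 0)
   (hu : u = p^3 + p + p⁻¹ + (p^3)⁻¹) (hw : w = p^4+p^2+2+(p^2)⁻¹+(p^4)⁻¹) (a b c d : B)
   (hab : a * b = p^2 • (b * a)) (had : a * d = (p^3)⁻¹ • (d * a)) (hcb : c * b = (p^3)⁻¹ • (b * c))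
   (h1 : c * (a * (a * (a * a))) - u • (a * (c * (a * (a * a)))) + w • (a * (a * (c * (a * a))))
      - u • (a * (a * (a * (c * a)))) + a * (a * (a * (a * c))) = 0)
   (h2 : d * (b * (b * (b * b))) - u • (b * (d * (b * (b * b)))) + w • (b * (b * (d * (b * b))))
      - u • (b * (b * (b * (d * b)))) + b * (b * (b * (b * d))) = 0) :
   (c+d) * ((a+b) * ((a+b) * ((a+b) * (a+b)))) - u • ((a+b) * ((c+d) * ((a+b) * ((a+b) * (a+b)))))
    + w • ((a+b) * ((a+b) * ((c+d) * ((a+b) * (a+b)))))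
      - u • ((a+b) * ((a+b) * ((a+b) * ((c+d) * (a+b))))) + (a+b) * ((a+b) * ((a+b) * ((a+b) * (c+d)))) = 0 := by
  have hab' : ∀ x, a * (b * x) = p^2 • (b * (a * x)) := fun x => by rw [← mul_assoc, hab]; simp [mul_assoc]
  have had' : ∀ x, a * (d * x) = (p^3)⁻¹ • (d * (a * x)) := fun x => by rw [← mul_assoc, had]; simp [mul_assoc]
  have hcb' : ∀ x, c * (b * x) = (p^3)⁻¹ • (b * (c * x)) := fun x => by rw [← mul_assoc, hcb]; simp [mul_assoc]
  rw [← add_zero (0:B)]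
  nth_rw 1 [← h1]
  rw [← h2]
  simp only [mul_add, add_mul, hab, had, hcb, hab', had', hcb', mul_smul_comm, smul_smul]
  match_scalars <;> subst hu hw <;> field_simp <;> ring

end

/-- Generators `e_i`, `f_i`, `t_i`, `t_i^{-1}`, for `i = 0, 1, 2`. -/
inductive Gen : Type
  | e (i : Fin 3)
  | f (i : Fin 3)
  | t (i : Fin 3)
  | tinv (i : Fin 3)

/-- A family `g` of elements of an algebra, indexed by the generators, satisfies the
defining relations of `U'_q(D_4^{(3)})`. -/
structure Relations {B : Type*} [Ring B] [Algebra K B] (g : Gen → B) : Prop where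
  t_comm : ∀ i j, g (.t i) * g (.t j) = g (.t j) * g (.t i)
  t_tinv : ∀ i, g (.t i) * g (.tinv i) = 1
  tinv_t : ∀ i, g (.tinv i) * g (.t i) = 1
  t_e : ∀ i j, g (.t i) * g (.e j) * g (.tinv i) = (qi i ^ cartan i j) • g (.e j)
  t_f : ∀ i j, g (.t i) * g (.f j) * g (.tinv i) = (qi i ^ (-cartan i j)) • g (.f j)
  e_f : ∀ i j, g (.e i) * g (.f j) - g (.f j) * g (.e i) =
    if i = j then (qi i - (qi i)⁻¹)⁻¹ • (g (.t i) - g (.tinv i)) else 0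
  serre_e : ∀ i j, i ≠ j → serre (qi i) (1 - cartan i j).toNat (g (.e i)) (g (.e j)) = 0
  serre_f : ∀ i j, i ≠ j → serre (qi i) (1 - cartan i j).toNat (g (.f i)) (g (.f j)) = 0

open FreeAlgebra in
/-- The defining relations, as a relation on the free algebra on the generators. -/
inductive Rel : FreeAlgebra K Gen → FreeAlgebra K Gen → Prop
  | t_comm (i j) : Rel (ι K (.t i) * ι K (.t j)) (ι K (.t j) * ι K (.t i))
  | t_tinv (i) : Rel (ι K (.t i) * ι K (.tinv i)) 1
  | tinv_t (i) : Rel (ι K (.tinv i) * ι K (.t i)) 1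
  | t_e (i j) : Rel (ι K (.t i) * ι K (.e j) * ι K (.tinv i)) ((qi i ^ cartan i j) • ι K (.e j))
  | t_f (i j) : Rel (ι K (.t i) * ι K (.f j) * ι K (.tinv i)) ((qi i ^ (-cartan i j)) • ι K (.f j))
  | e_f (i j) : Rel (ι K (.e i) * ι K (.f j) - ι K (.f j) * ι K (.e i))
      (if i = j then (qi i - (qi i)⁻¹)⁻¹ • (ι K (.t i) - ι K (.tinv i)) else 0)
  | serre_e (i j) (h : i ≠ j) :
      Rel (serre (qi i) (1 - cartan i j).toNat (ι K (.e i)) (ι K (.e j))) 0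
  | serre_f (i j) (h : i ≠ j) :
      Rel (serre (qi i) (1 - cartan i j).toNat (ι K (.f i)) (ι K (.f j))) 0

/-- The quantum affine algebra `U'_q(D_4^{(3)})` over `ℚ(q)`. -/
abbrev U : Type := RingQuot Rel

/-- The generators of `U'_q(D_4^{(3)})`. -/
noncomputable def gen (g : Gen) : U := RingQuot.mkAlgHom K Rel (FreeAlgebra.ι K g)

theorem gen_relations : Relations gen where
  t_comm i j := by
    simpa [gen] using RingQuot.mkAlgHom_rel K (Rel.t_comm i j)
  t_tinv i := by
    simpa [gen] using RingQuot.mkAlgHom_rel K (Rel.t_tinv i)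
  tinv_t i := by
    simpa [gen] using RingQuot.mkAlgHom_rel K (Rel.tinv_t i)
  t_e i j := by
    simpa [gen] using RingQuot.mkAlgHom_rel K (Rel.t_e i j)
  t_f i j := by
    simpa [gen] using RingQuot.mkAlgHom_rel K (Rel.t_f i j)
  e_f i j := by
    have := RingQuot.mkAlgHom_rel K (Rel.e_f i j)
    split_ifs at this ⊢ with h <;> simpa [gen] using this
  serre_e i j h := by
    simpa [gen, map_serre] using RingQuot.mkAlgHom_rel K (Rel.serre_e i j h)
  serre_f i j h := by
    simpa [gen, map_serre] using RingQuot.mkAlgHom_rel K (Rel.serre_f i j h)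

/-- The algebra homomorphism out of `U'_q(D_4^{(3)})` given by a family satisfying the defining
relations. -/
noncomputable def liftU {B : Type*} [Ring B] [Algebra K B] (g : Gen → B) (hg : Relations g) :
    U →ₐ[K] B :=
  RingQuot.liftAlgHom K ⟨FreeAlgebra.lift K g, by
    intro x y h
    induction h with
    | t_comm i j => simpa using hg.t_comm i j
    | t_tinv i => simpa using hg.t_tinv i
    | tinv_t i => simpa using hg.tinv_t i
    | t_e i j => simpa using hg.t_e i j
    | t_f i j => simpa using hg.t_f i j
    | e_f i j =>
      have := hg.e_f i j
      split_ifs at this ⊢ with h <;> simpa using this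
    | serre_e i j h => simpa [map_serre] using hg.serre_e i j h
    | serre_f i j h => simpa [map_serre] using hg.serre_f i j h⟩

@[simp] theorem liftU_gen {B : Type*} [Ring B] [Algebra K B] (g : Gen → B) (hg : Relations g)
    (k : Gen) : liftU g hg (gen k) = g k := by
  simp [liftU, gen]

/-! ### The coproduct -/

theorem q_ne_zero : q ≠ 0 := RatFunc.X_ne_zero

theorem q_pow_ne_one (n : ℕ) (hn : n ≠ 0) : q ^ n ≠ 1 := by
  intro h
  have h2 : algebraMap (Polynomial ℚ) K (Polynomial.X ^ n) = algebraMap (Polynomial ℚ) K 1 := by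
    simpa [q] using h
  have h3 := congrArg Polynomial.natDegree (RatFunc.algebraMap_injective ℚ h2)
  simp at h3
  exact hn h3

theorem sub_inv_ne_zero (n : ℕ) (hn : n ≠ 0) : q ^ n - (q ^ n)⁻¹ ≠ 0 := by
  have h0 := pow_ne_zero n q_ne_zero
  intro h
  apply q_pow_ne_one (2 * n) (by omega)
  rw [sub_eq_zero] at h
  rw [two_mul, pow_add]
  nth_rw 1 [h]
  exact inv_mul_cancel₀ h0

theorem qi_ne_zero (i : Fin 3) : qi i ≠ 0 := by
  unfold qi
  split_ifs <;> simp [q_ne_zero]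

theorem liftU_ext {B : Type*} [Ring B] [Algebra K B] {φ ψ : U →ₐ[K] B}
    (h : ∀ k, φ (gen k) = ψ (gen k)) : φ = ψ := by
  apply RingQuot.ringQuot_ext'
  apply FreeAlgebra.hom_ext
  funext k
  exact h k

/-- The Cartan matrix is symmetrized by the exponents of the `q_i`. -/
theorem qi_symm (i j : Fin 3) : qi i ^ cartan i j = qi j ^ cartan j i := by
  have h3 : (q ^ 3) ^ (-1 : ℤ) = q ^ (-3 : ℤ) := by
    rw [← zpow_natCast, ← zpow_mul]; norm_num
  fin_cases i <;> fin_cases j <;> simp [qi, cartan]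

/-- If `e`-type elements `a + b`, `c + d` satisfy the appropriate `q`-commutation relations, the
quantum Serre relation passes to the sum. -/
theorem serre_add {B : Type*} [Ring B] [Algebra K B] (i j : Fin 3) (hij : i ≠ j) (ε : ℤ)
    (hε : ε = 1 ∨ ε = -1) (a b c d : B)
    (hab : a * b = (qi i ^ (ε * 2)) • (b * a))
    (had : a * d = (qi i ^ (ε * cartan i j)) • (d * a))
    (hcb : c * b = (qi i ^ (ε * cartan i j)) • (b * c))
    (h1 : serre (qi i) (1 - cartan i j).toNat a c = 0)
    (h2 : serre (qi i) (1 - cartan i j).toNat b d = 0) :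
    serre (qi i) (1 - cartan i j).toNat (a + b) (c + d) = 0 := by
  have key : ∀ s : K, s ≠ 0 → s - s⁻¹ ≠ 0 → s + s⁻¹ ≠ 0 →
      (a * b = (s ^ (ε * 2)) • (b * a)) → (a * d = (s ^ (ε * -1)) • (d * a)) →
      (c * b = (s ^ (ε * -1)) • (b * c)) → serre s 2 a c = 0 → serre s 2 b d = 0 →
      serre s 2 (a + b) (c + d) = 0 := by
    intro s h0 hs hs' hab had hcb h1 h2
    rw [serre_two s h0 hs hs', smul_eq_zero_iff_right (inv_ne_zero hs')] at h1 h2 ⊢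
    rcases hε with rfl | rfl
    · exact serre_add_two s _ h0 rfl a b c d (by simpa using hab) (by simpa using had)
        (by simpa using hcb) h1 h2
    · exact serre_add_two s⁻¹ _ (inv_ne_zero h0) (by rw [inv_inv, add_comm]) a b c d
        (by simpa [zpow_neg] using hab) (by simpa using had) (by simpa using hcb) h1 h2
  have key1 : ∀ s : K, s - s⁻¹ ≠ 0 → (a * d = d * a) → (c * b = b * c) →
      serre s 1 a c = 0 → serre s 1 b d = 0 → serre s 1 (a + b) (c + d) = 0 := by
    intro s hs had hcb h1 h2
    rw [serre_one s hs, sub_eq_zero] at h1 h2 ⊢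
    simp only [mul_add, add_mul, h1, h2, had, hcb]
    abel
  have hq := q_ne_zero
  have hn := sub_inv_ne_zero 1 one_ne_zero
  rw [pow_one] at hn
  have hn3 := sub_inv_ne_zero 3 (by norm_num)
  have n2 : q ^ 2 + 1 ≠ 0 := fun h3 => q_pow_ne_one 4 (by norm_num) (by
    linear_combination (q ^ 2 - 1) * h3)
  have n4 : q ^ 4 + 1 ≠ 0 := fun h3 => q_pow_ne_one 8 (by norm_num) (by
    linear_combination (q ^ 4 - 1) * h3)
  have n3 : q ^ 4 + q ^ 2 + 1 ≠ 0 := fun h3 => q_pow_ne_one 6 (by norm_num) (by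
    linear_combination (q ^ 2 - 1) * h3)
  have n6 : q ^ 6 + 1 ≠ 0 := fun h3 => q_pow_ne_one 12 (by norm_num) (by
    linear_combination (q ^ 6 - 1) * h3)
  have hp : q + q⁻¹ ≠ 0 := fun h3 => n2 (by field_simp at h3; simpa using h3)
  have hp3 : q ^ 3 + (q ^ 3)⁻¹ ≠ 0 := fun h3 => n6 (by field_simp at h3; simpa using h3)
  have hf : (sFact q 4)⁻¹ ≠ 0 := by
    have h2 := sub_inv_ne_zero 2 (by norm_num)
    have h4 := sub_inv_ne_zero 4 (by norm_num)
    simp [sFact, sInt, Finset.prod_range_succ, hn, hn3, h2, h4]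
  have c4 : i = 1 → j = 2 → serre (qi i) (1 - cartan i j).toNat (a + b) (c + d) = 0 := by
    rintro rfl rfl
    have e1 : qi 1 = q := by simp [qi]
    have e2 : cartan 1 2 = -3 := rfl
    have e3 : (1 - cartan 1 2).toNat = 4 := rfl
    rw [e1] at hab had hcb h1 h2 ⊢
    rw [e2] at had hcb
    rw [e3, serre_four q hq hn n2 n3 n4, smul_eq_zero_iff_right hf] at h1 h2 ⊢
    rcases hε with rfl | rfl
    · refine serre_add_four q _ _ hq rfl rfl a b c d (by simpa using hab) ?_ ?_ h1 h2
      · rw [had]; norm_cast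
      · rw [hcb]; norm_cast
    · refine serre_add_four q⁻¹ _ _ (inv_ne_zero hq) (by simp; ring) (by simp; ring) a b c d
        ?_ ?_ ?_ h1 h2
      · rw [hab]; simp [zpow_neg]
      · rw [had, inv_pow, inv_inv]; norm_cast
      · rw [hcb, inv_pow, inv_inv]; norm_cast
  fin_cases i <;> fin_cases j
  · exact absurd rfl hij
  · exact key q hq hn hp hab had hcb h1 h2
  · exact key1 q hn (by simpa [cartan] using had) (by simpa [cartan] using hcb) h1 h2
  · exact key q hq hn hp hab had hcb h1 h2
  · exact absurd rfl hij
  · exact c4 rfl rfl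
  · exact key1 (q ^ 3) hn3 (by simpa [cartan] using had) (by simpa [cartan] using hcb) h1 h2
  · exact key (q ^ 3) (pow_ne_zero 3 hq) hn3 hp3 hab had hcb h1 h2
  · exact absurd rfl hij

open TensorProduct in
/-- The values of the (lower) coproduct on the generators. -/
noncomputable def comulGen : Gen → U ⊗[K] U
  | .e i => gen (.e i) ⊗ₜ gen (.tinv i) + 1 ⊗ₜ gen (.e i)
  | .f i => gen (.f i) ⊗ₜ 1 + gen (.t i) ⊗ₜ gen (.f i)
  | .t i => gen (.t i) ⊗ₜ gen (.t i)
  | .tinv i => gen (.tinv i) ⊗ₜ gen (.tinv i)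

theorem tinv_e (i j : Fin 3) : gen (.tinv i) * gen (.e j) =
    (qi i ^ (-cartan i j)) • (gen (.e j) * gen (.tinv i)) := by
  have h := congrArg (fun x => gen (.tinv i) * x) (gen_relations.t_e i j)
  have hq := zpow_ne_zero (cartan i j) (qi_ne_zero i)
  simp only [← mul_assoc, gen_relations.tinv_t, one_mul, mul_smul_comm] at h
  rw [h, smul_smul, zpow_neg, inv_mul_cancel₀ hq, one_smul]

theorem tinv_f (i j : Fin 3) : gen (.tinv i) * gen (.f j) =
    (qi i ^ (cartan i j)) • (gen (.f j) * gen (.tinv i)) := by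
  have h := congrArg (fun x => gen (.tinv i) * x) (gen_relations.t_f i j)
  have hq := zpow_ne_zero (-cartan i j) (qi_ne_zero i)
  simp only [← mul_assoc, gen_relations.tinv_t, one_mul, mul_smul_comm] at h
  rw [h, smul_smul, ← zpow_add₀ (qi_ne_zero i), add_neg_cancel, zpow_zero, one_smul]

theorem t_e (i j : Fin 3) : gen (.t i) * gen (.e j) =
    (qi i ^ (cartan i j)) • (gen (.e j) * gen (.t i)) := by
  have h := congrArg (fun x => x * gen (.t i)) (gen_relations.t_e i j)
  simpa only [mul_assoc, gen_relations.tinv_t, mul_one, smul_mul_assoc] using h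

theorem t_f (i j : Fin 3) : gen (.t i) * gen (.f j) =
    (qi i ^ (-cartan i j)) • (gen (.f j) * gen (.t i)) := by
  have h := congrArg (fun x => x * gen (.t i)) (gen_relations.t_f i j)
  simpa only [mul_assoc, gen_relations.tinv_t, mul_one, smul_mul_assoc] using h

theorem tinv_comm (i j : Fin 3) :
    gen (.tinv i) * gen (.tinv j) = gen (.tinv j) * gen (.tinv i) := by
  have a := gen_relations.tinv_t
  have b := gen_relations.t_tinv
  have c := gen_relations.t_comm i j
  calc gen (.tinv i) * gen (.tinv j)
      = gen (.tinv i) * gen (.tinv j) * ((gen (.t i) * gen (.t j)) *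
          (gen (.tinv j) * gen (.tinv i))) := by
        rw [mul_assoc (gen (.t i)), ← mul_assoc (gen (.t j)), b, one_mul, b, mul_one]
    _ = gen (.tinv j) * gen (.tinv i) := by
        rw [c, ← mul_assoc, mul_assoc (gen (.tinv i)), ← mul_assoc (gen (.tinv j)), a, one_mul, a,
          one_mul]

theorem serre_tmul_left {A C : Type*} [Ring A] [Algebra K A] [Ring C] [Algebra K C] (s : K) (l : ℕ)
    (x y : A) (u v : C) (huv : u * v = v * u) :
    serre s l (x ⊗ₜ[K] u) (y ⊗ₜ[K] v) = serre s l x y ⊗ₜ[K] (v * u ^ l) := by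
  have hc : ∀ n, u ^ n * v = v * u ^ n := fun n => (Commute.pow_left huv n)
  simp only [serre, divPow, TensorProduct.sum_tmul]
  refine Finset.sum_congr rfl fun n hn => ?_
  have hn' : n + (l - n) = l := by have := Finset.mem_range.1 hn; omega
  simp only [Algebra.TensorProduct.tmul_pow, Algebra.TensorProduct.tmul_mul_tmul,
    TensorProduct.smul_tmul', smul_mul_assoc, mul_smul_comm, hc, mul_assoc, ← pow_add, hn']

theorem serre_tmul_right {A C : Type*} [Ring A] [Algebra K A] [Ring C] [Algebra K C] (s : K) (l : ℕ)
    (x y : C) (u v : A) (huv : u * v = v * u) :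
    serre s l (u ⊗ₜ[K] x) (v ⊗ₜ[K] y) = (v * u ^ l) ⊗ₜ[K] serre s l x y := by
  have hc : ∀ n, u ^ n * v = v * u ^ n := fun n => (Commute.pow_left huv n)
  simp only [serre, divPow, TensorProduct.tmul_sum]
  refine Finset.sum_congr rfl fun n hn => ?_
  have hn' : n + (l - n) = l := by have := Finset.mem_range.1 hn; omega
  simp only [Algebra.TensorProduct.tmul_pow, Algebra.TensorProduct.tmul_mul_tmul,
    TensorProduct.smul_tmul', TensorProduct.tmul_smul, smul_mul_assoc, mul_smul_comm, hc, mul_assoc, ← pow_add, hn']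

theorem comulGen_relations : Relations comulGen where
  t_comm i j := by
    simp only [comulGen, Algebra.TensorProduct.tmul_mul_tmul, gen_relations.t_comm i j]
  t_tinv i := by
    simp [comulGen, gen_relations.t_tinv, Algebra.TensorProduct.one_def]
  tinv_t i := by
    simp [comulGen, gen_relations.tinv_t, Algebra.TensorProduct.one_def]
  t_e i j := by
    have h : gen (.t i) * gen (.tinv j) * gen (.tinv i) = gen (.tinv j) := by
      rw [mul_assoc, tinv_comm, ← mul_assoc, gen_relations.t_tinv, one_mul]
    simp only [comulGen, mul_add, add_mul, Algebra.TensorProduct.tmul_mul_tmul, mul_one,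
      gen_relations.t_e, gen_relations.t_tinv, h, smul_add, TensorProduct.smul_tmul',
      TensorProduct.tmul_smul]
  t_f i j := by
    have h : gen (.t i) * gen (.t j) * gen (.tinv i) = gen (.t j) := by
      rw [gen_relations.t_comm, mul_assoc, gen_relations.t_tinv, mul_one]
    simp only [comulGen, mul_add, add_mul, Algebra.TensorProduct.tmul_mul_tmul, mul_one,
      gen_relations.t_f, gen_relations.t_tinv, h, smul_add, TensorProduct.smul_tmul',
      TensorProduct.tmul_smul]
  e_f i j := by
    have h : (gen (.t j) * gen (.e i)) ⊗ₜ[K] (gen (.f j) * gen (.tinv i)) =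
        (gen (.e i) * gen (.t j)) ⊗ₜ[K] (gen (.tinv i) * gen (.f j)) := by
      rw [t_e, tinv_f, TensorProduct.tmul_smul, TensorProduct.smul_tmul', qi_symm]
    have h2 := gen_relations.e_f i j
    have h3 : comulGen (.e i) * comulGen (.f j) - comulGen (.f j) * comulGen (.e i) =
        (gen (.e i) * gen (.f j) - gen (.f j) * gen (.e i)) ⊗ₜ[K] gen (.tinv i) +
        gen (.t j) ⊗ₜ[K] (gen (.e i) * gen (.f j) - gen (.f j) * gen (.e i)) := by
      simp only [comulGen, mul_add, add_mul, Algebra.TensorProduct.tmul_mul_tmul, mul_one, one_mul,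
        h, TensorProduct.sub_tmul, TensorProduct.tmul_sub]
      abel
    rw [h3, h2]
    split_ifs with hij
    · subst hij
      simp only [comulGen, TensorProduct.tmul_smul, ← TensorProduct.smul_tmul', ← smul_add,
        TensorProduct.sub_tmul, TensorProduct.tmul_sub]
      congr 1
      abel
    · simp
  serre_e i j hij := by
    refine serre_add i j hij (-1) (Or.inr rfl) _ _ _ _ ?_ ?_ ?_ ?_ ?_
    · simp only [Algebra.TensorProduct.tmul_mul_tmul, one_mul, mul_one, tinv_e,
        TensorProduct.tmul_smul]
      rcases (by fin_cases i <;> rfl : cartan i i = 2) with h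
      rw [h]; rfl
    · simp only [Algebra.TensorProduct.tmul_mul_tmul, one_mul, mul_one, tinv_e,
        TensorProduct.tmul_smul, neg_one_mul]
    · simp only [Algebra.TensorProduct.tmul_mul_tmul, one_mul, mul_one, tinv_e,
        TensorProduct.tmul_smul, neg_one_mul, zpow_neg, qi_symm i j]
    · rw [serre_tmul_left _ _ _ _ _ _ (tinv_comm i j), gen_relations.serre_e i j hij,
        TensorProduct.zero_tmul]
    · rw [serre_tmul_right _ _ _ _ _ _ rfl, gen_relations.serre_e i j hij, TensorProduct.tmul_zero]
  serre_f i j hij := by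
    rw [comulGen, comulGen]
    refine serre_add i j hij 1 (Or.inl rfl) _ _ _ _ ?_ ?_ ?_ ?_ ?_
    · have h : gen (.f i) * gen (.t i) = (qi i ^ cartan i i) • (gen (.t i) * gen (.f i)) := by
        rw [t_f, smul_smul, ← zpow_add₀ (qi_ne_zero i), add_neg_cancel, zpow_zero, one_smul]
      simp only [Algebra.TensorProduct.tmul_mul_tmul, one_mul, mul_one, h,
        TensorProduct.smul_tmul']
      rcases (by fin_cases i <;> rfl : cartan i i = 2) with h
      rw [h]
    · have h : gen (.f i) * gen (.t j) = (qi j ^ cartan j i) • (gen (.t j) * gen (.f i)) := by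
        rw [t_f, smul_smul, ← zpow_add₀ (qi_ne_zero j), add_neg_cancel, zpow_zero, one_smul]
      simp only [Algebra.TensorProduct.tmul_mul_tmul, one_mul, mul_one, h,
        TensorProduct.smul_tmul', qi_symm i j]
    · have h : gen (.f j) * gen (.t i) = (qi i ^ cartan i j) • (gen (.t i) * gen (.f j)) := by
        rw [t_f, smul_smul, ← zpow_add₀ (qi_ne_zero i), add_neg_cancel, zpow_zero, one_smul]
      simp only [Algebra.TensorProduct.tmul_mul_tmul, one_mul, mul_one, h,
        TensorProduct.smul_tmul']
    · rw [serre_tmul_left _ _ _ _ _ _ rfl, gen_relations.serre_f i j hij, TensorProduct.zero_tmul]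
    · rw [serre_tmul_right _ _ _ _ _ _ (gen_relations.t_comm i j),
        gen_relations.serre_f i j hij, TensorProduct.tmul_zero]

/-- The lower coproduct `Δ(e_i) = e_i ⊗ t_i^{-1} + 1 ⊗ e_i`, `Δ(f_i) = f_i ⊗ 1 + t_i ⊗ f_i`,
`Δ(t_i) = t_i ⊗ t_i`. -/
noncomputable def comul : U →ₐ[K] U ⊗[K] U := liftU comulGen comulGen_relations

/-! ### The fundamental representation and its evaluation modules -/

/-- Labels of the basis `v_1, v_2, v_3, v_0, v_{\bar 3}, v_{\bar 2}, v_{\bar 1}, v_φ` of `V^1`. -/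
inductive Idx : Type
  | b1 | b2 | b3 | b0 | c3 | c2 | c1 | phi
  deriving DecidableEq

instance : Fintype Idx where
  elems := {.b1, .b2, .b3, .b0, .c3, .c2, .c1, .phi}
  complete j := by cases j <;> decide

section

variable {F : Type*} [Field F] [Algebra K F]

/-- The standard basis vectors. -/
def v (j : Idx) : Idx → F := Pi.single j 1

/-- `wt j i = ⟨h_i, wt v_j⟩`. -/
def wt : Idx → Fin 3 → ℤ
  | .b1 => ![-2, 1, 0]
  | .b2 => ![-1, -1, 1]
  | .b3 => ![-1, 2, -1]
  | .b0 => ![0, 0, 0]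
  | .c3 => ![1, -2, 1]
  | .c2 => ![1, 1, -1]
  | .c1 => ![2, -1, 0]
  | .phi => ![0, 0, 0]

/-- `eVec i j = e_i v_j` in `V^1`. -/
noncomputable def eVec : Fin 3 → Idx → (Idx → F)
  | 0, .b1 => v .phi + (sInt q 2)⁻¹ • v .b0
  | 0, .b2 => v .c3
  | 0, .b3 => v .c2
  | 0, .b0 => v .c1
  | 0, .phi => (sInt q 3 / sInt q 2) • v .c1
  | 1, .b2 => v .b1
  | 1, .b0 => sInt q 2 • v .b3
  | 1, .c3 => v .b0
  | 1, .c1 => v .c2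
  | 2, .b3 => v .b2
  | 2, .c2 => v .c3
  | _, _ => 0

/-- `fVec i j = f_i v_j` in `V^1`. -/
noncomputable def fVec : Fin 3 → Idx → (Idx → F)
  | 0, .c1 => v .phi + (sInt q 2)⁻¹ • v .b0
  | 0, .c2 => v .b3
  | 0, .c3 => v .b2
  | 0, .b0 => v .b1
  | 0, .phi => (sInt q 3 / sInt q 2) • v .b1
  | 1, .c2 => v .c1
  | 1, .b0 => sInt q 2 • v .c3
  | 1, .b3 => v .b0
  | 1, .b1 => v .b2
  | 2, .c3 => v .c2
  | 2, .b2 => v .b3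
  | _, _ => 0

/-- The action of the generators on the evaluation module `V^1_x` (with scalars extended to `F`):
`e_i`, `f_i`, `t_i` act as `x^{δ_{i0}} e_i`, `x^{-δ_{i0}} f_i`, `t_i` do on `V^1`. -/
noncomputable def evalGen (x : Fˣ) : Gen → Module.End F (Idx → F)
  | .e i => (Pi.basisFun F Idx).constr F fun j => (if i = 0 then (x : F) else 1) • eVec i j
  | .f i => (Pi.basisFun F Idx).constr F fun j => (if i = 0 then (x : F)⁻¹ else 1) • fVec i j
  | .t i => (Pi.basisFun F Idx).constr F fun j => (qi i ^ wt j i) • v j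
  | .tinv i => (Pi.basisFun F Idx).constr F fun j => (qi i ^ (-wt j i)) • v j

theorem evalGen_e (x : Fˣ) (i : Fin 3) (j : Idx) :
    evalGen x (.e i) (v j) = (if i = 0 then (x : F) else 1) • eVec i j := by
  rw [evalGen, v, ← Pi.basisFun_apply, Module.Basis.constr_basis]

theorem evalGen_f (x : Fˣ) (i : Fin 3) (j : Idx) :
    evalGen x (.f i) (v j) = (if i = 0 then (x : F)⁻¹ else 1) • fVec i j := by
  rw [evalGen, v, ← Pi.basisFun_apply, Module.Basis.constr_basis]

theorem evalGen_t (x : Fˣ) (i : Fin 3) (j : Idx) :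
    evalGen x (.t i) (v j) = (qi i ^ wt j i) • v j := by
  have h := (Pi.basisFun F Idx).constr_basis F (fun j => (qi i ^ wt j i) • (v j : Idx → F)) j
  rwa [Pi.basisFun_apply] at h

theorem evalGen_tinv (x : Fˣ) (i : Fin 3) (j : Idx) :
    evalGen x (.tinv i) (v j) = (qi i ^ (-wt j i)) • v j := by
  have h := (Pi.basisFun F Idx).constr_basis F (fun j => (qi i ^ (-wt j i)) • (v j : Idx → F)) j
  rwa [Pi.basisFun_apply] at h

/-- The image of `q` in `F`. -/
noncomputable def qF (F : Type*) [Field F] [Algebra K F] : F := algebraMap K F q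

theorem map_q : algebraMap K F q = qF F := rfl

theorem qF_pow_ne_one (n : ℕ) (hn : n ≠ 0) : qF F ^ n ≠ 1 := by
  rw [qF, ← map_pow, ← map_one (algebraMap K F)]
  exact fun h => q_pow_ne_one n hn ((algebraMap K F).injective h)

theorem qF_ne_zero : qF F ≠ 0 := by
  rw [qF, ← map_zero (algebraMap K F)]
  exact fun h => q_ne_zero ((algebraMap K F).injective h)

theorem map_two : algebraMap K F (sInt q 2) = (qF F ^ 2 + 1) / qF F := by
  have h := sub_inv_ne_zero 1 one_ne_zero
  have hq := q_ne_zero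
  rw [pow_one] at h
  have : sInt q 2 = (q ^ 2 + 1) / q := by rw [sInt, div_eq_iff h]; field_simp; ring
  rw [this]; simp [map_q]

theorem map_three : algebraMap K F (sInt q 3) = (qF F ^ 4 + qF F ^ 2 + 1) / qF F ^ 2 := by
  have h := sub_inv_ne_zero 1 one_ne_zero
  have hq := q_ne_zero
  rw [pow_one] at h
  have : sInt q 3 = (q ^ 4 + q ^ 2 + 1) / q ^ 2 := by rw [sInt, div_eq_iff h]; field_simp; ring
  rw [this]; simp [map_q]

theorem end_ext {F : Type*} [Field F] {φ ψ : Module.End F (Idx → F)} (h : ∀ j, φ (v j) = ψ (v j)) : φ = ψ :=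
  (Pi.basisFun F Idx).ext fun j => by simpa [v] using h j

set_option maxHeartbeats 2000000 in
theorem evalGen_e_f (x : Fˣ) (i j : Fin 3) :
    evalGen x (.e i) * evalGen x (.f j) - evalGen x (.f j) * evalGen x (.e i) =
      if i = j then (qi i - (qi i)⁻¹)⁻¹ • (evalGen x (.t i) - evalGen x (.tinv i)) else 0 := by
  have hq := qF_ne_zero (F := F)
  have hx := x.ne_zero
  have n1 : qF F ^ 2 - 1 ≠ 0 := sub_ne_zero.2 (qF_pow_ne_one 2 (by norm_num))
  have n6 : qF F ^ 6 - 1 ≠ 0 := sub_ne_zero.2 (qF_pow_ne_one 6 (by norm_num))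
  have n2 : qF F ^ 2 + 1 ≠ 0 := fun h3 => qF_pow_ne_one (F := F) 4 (by norm_num) (by
    linear_combination (qF F ^ 2 - 1) * h3)
  refine end_ext fun k => ?_
  fin_cases i <;> fin_cases j <;> cases k <;>
    simp [eVec, fVec, wt, qi, evalGen_e, evalGen_f, evalGen_t, evalGen_tinv,
      LinearMap.map_smul_of_tower, smul_sub] <;>
    simp only [← algebraMap_smul F (_ : K) (_ : Idx → F), map_pow, map_inv₀, map_div₀, map_q,
      map_two, map_three, map_sub] <;>
    match_scalars <;> field_simp <;> ring

set_option maxHeartbeats 2000000 in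
theorem evalGen_serre_e (x : Fˣ) (i j : Fin 3) (hij : i ≠ j) :
    serre (qi i) (1 - cartan i j).toNat (evalGen x (.e i)) (evalGen x (.e j)) = 0 := by
  have hQ := qF_ne_zero (F := F)
  have hx := x.ne_zero
  have m2 : qF F ^ 2 + 1 ≠ 0 := fun h3 => qF_pow_ne_one (F := F) 4 (by norm_num) (by
    linear_combination (qF F ^ 2 - 1) * h3)
  have hq := q_ne_zero
  have hn := sub_inv_ne_zero 1 one_ne_zero
  rw [pow_one] at hn
  have hn3 := sub_inv_ne_zero 3 (by norm_num)
  have n2 : q ^ 2 + 1 ≠ 0 := fun h3 => q_pow_ne_one 4 (by norm_num) (by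
    linear_combination (q ^ 2 - 1) * h3)
  have n4 : q ^ 4 + 1 ≠ 0 := fun h3 => q_pow_ne_one 8 (by norm_num) (by
    linear_combination (q ^ 4 - 1) * h3)
  have n3 : q ^ 4 + q ^ 2 + 1 ≠ 0 := fun h3 => q_pow_ne_one 6 (by norm_num) (by
    linear_combination (q ^ 2 - 1) * h3)
  have n6 : q ^ 6 + 1 ≠ 0 := fun h3 => q_pow_ne_one 12 (by norm_num) (by
    linear_combination (q ^ 6 - 1) * h3)
  have hp : q + q⁻¹ ≠ 0 := fun h3 => n2 (by field_simp at h3; simpa using h3)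
  have hp3 : q ^ 3 + (q ^ 3)⁻¹ ≠ 0 := fun h3 => n6 (by field_simp at h3; simpa using h3)
  have hq3 := pow_ne_zero 3 hq
  fin_cases i <;> fin_cases j
  · exact absurd rfl hij
  · change serre q 2 (evalGen x (.e 0)) (evalGen x (.e 1)) = 0
    rw [serre_two q hq hn hp]
    refine end_ext fun k => ?_
    cases k <;> simp [eVec, evalGen_e, LinearMap.map_smul_of_tower, smul_sub] <;>
    simp only [← algebraMap_smul F (_ : K) (_ : Idx → F), map_pow, map_inv₀, map_div₀, map_q,
      map_two, map_three, map_add] <;>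
    match_scalars <;> field_simp <;> ring
  · change serre q 1 (evalGen x (.e 0)) (evalGen x (.e 2)) = 0
    rw [serre_one q hn]
    refine end_ext fun k => ?_
    cases k <;> simp [eVec, evalGen_e, LinearMap.map_smul_of_tower]
  · change serre q 2 (evalGen x (.e 1)) (evalGen x (.e 0)) = 0
    rw [serre_two q hq hn hp]
    refine end_ext fun k => ?_
    cases k <;> simp [eVec, evalGen_e, LinearMap.map_smul_of_tower, smul_sub] <;>
    simp only [← algebraMap_smul F (_ : K) (_ : Idx → F), map_pow, map_inv₀, map_div₀, map_q,
      map_two, map_three, map_add] <;>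
    match_scalars <;> field_simp <;> ring
  · exact absurd rfl hij
  · change serre q 4 (evalGen x (.e 1)) (evalGen x (.e 2)) = 0
    rw [serre_four q hq hn n2 n3 n4]
    refine end_ext fun k => ?_
    cases k <;> simp [eVec, evalGen_e, LinearMap.map_smul_of_tower, smul_sub]
  · change serre (q ^ 3) 1 (evalGen x (.e 2)) (evalGen x (.e 0)) = 0
    rw [serre_one (q ^ 3) hn3]
    refine end_ext fun k => ?_
    cases k <;> simp [eVec, evalGen_e, LinearMap.map_smul_of_tower]
  · change serre (q ^ 3) 2 (evalGen x (.e 2)) (evalGen x (.e 1)) = 0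
    rw [serre_two (q ^ 3) hq3 hn3 hp3]
    refine end_ext fun k => ?_
    cases k <;> simp [eVec, evalGen_e, LinearMap.map_smul_of_tower]
  · exact absurd rfl hij

set_option maxHeartbeats 2000000 in
theorem evalGen_serre_f (x : Fˣ) (i j : Fin 3) (hij : i ≠ j) :
    serre (qi i) (1 - cartan i j).toNat (evalGen x (.f i)) (evalGen x (.f j)) = 0 := by
  have hQ := qF_ne_zero (F := F)
  have hx := x.ne_zero
  have m2 : qF F ^ 2 + 1 ≠ 0 := fun h3 => qF_pow_ne_one (F := F) 4 (by norm_num) (by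
    linear_combination (qF F ^ 2 - 1) * h3)
  have hq := q_ne_zero
  have hn := sub_inv_ne_zero 1 one_ne_zero
  rw [pow_one] at hn
  have hn3 := sub_inv_ne_zero 3 (by norm_num)
  have n2 : q ^ 2 + 1 ≠ 0 := fun h3 => q_pow_ne_one 4 (by norm_num) (by
    linear_combination (q ^ 2 - 1) * h3)
  have n4 : q ^ 4 + 1 ≠ 0 := fun h3 => q_pow_ne_one 8 (by norm_num) (by
    linear_combination (q ^ 4 - 1) * h3)
  have n3 : q ^ 4 + q ^ 2 + 1 ≠ 0 := fun h3 => q_pow_ne_one 6 (by norm_num) (by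
    linear_combination (q ^ 2 - 1) * h3)
  have n6 : q ^ 6 + 1 ≠ 0 := fun h3 => q_pow_ne_one 12 (by norm_num) (by
    linear_combination (q ^ 6 - 1) * h3)
  have hp : q + q⁻¹ ≠ 0 := fun h3 => n2 (by field_simp at h3; simpa using h3)
  have hp3 : q ^ 3 + (q ^ 3)⁻¹ ≠ 0 := fun h3 => n6 (by field_simp at h3; simpa using h3)
  have hq3 := pow_ne_zero 3 hq
  fin_cases i <;> fin_cases j
  · exact absurd rfl hij
  · change serre q 2 (evalGen x (.f 0)) (evalGen x (.f 1)) = 0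
    rw [serre_two q hq hn hp]
    refine end_ext fun k => ?_
    cases k <;> simp [fVec, evalGen_f, LinearMap.map_smul_of_tower, smul_sub] <;>
    simp only [← algebraMap_smul F (_ : K) (_ : Idx → F), map_pow, map_inv₀, map_div₀, map_q,
      map_two, map_three, map_add] <;>
    match_scalars <;> field_simp <;> ring
  · change serre q 1 (evalGen x (.f 0)) (evalGen x (.f 2)) = 0
    rw [serre_one q hn]
    refine end_ext fun k => ?_
    cases k <;> simp [fVec, evalGen_f, LinearMap.map_smul_of_tower]
  · change serre q 2 (evalGen x (.f 1)) (evalGen x (.f 0)) = 0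
    rw [serre_two q hq hn hp]
    refine end_ext fun k => ?_
    cases k <;> simp [fVec, evalGen_f, LinearMap.map_smul_of_tower, smul_sub] <;>
    simp only [← algebraMap_smul F (_ : K) (_ : Idx → F), map_pow, map_inv₀, map_div₀, map_q,
      map_two, map_three, map_add] <;>
    match_scalars <;> field_simp <;> ring
  · exact absurd rfl hij
  · change serre q 4 (evalGen x (.f 1)) (evalGen x (.f 2)) = 0
    rw [serre_four q hq hn n2 n3 n4]
    refine end_ext fun k => ?_
    cases k <;> simp [fVec, evalGen_f, LinearMap.map_smul_of_tower, smul_sub]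
  · change serre (q ^ 3) 1 (evalGen x (.f 2)) (evalGen x (.f 0)) = 0
    rw [serre_one (q ^ 3) hn3]
    refine end_ext fun k => ?_
    cases k <;> simp [fVec, evalGen_f, LinearMap.map_smul_of_tower]
  · change serre (q ^ 3) 2 (evalGen x (.f 2)) (evalGen x (.f 1)) = 0
    rw [serre_two (q ^ 3) hq3 hn3 hp3]
    refine end_ext fun k => ?_
    cases k <;> simp [fVec, evalGen_f, LinearMap.map_smul_of_tower]
  · exact absurd rfl hij

set_option maxHeartbeats 1000000 in
theorem evalGen_relations (x : Fˣ) : Relations (evalGen x) where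
  t_comm i j := by
    refine end_ext fun k => ?_
    simp only [Module.End.mul_apply, evalGen_t, LinearMap.map_smul_of_tower]
    exact smul_comm _ _ _
  t_tinv i := by
    refine end_ext fun k => ?_
    simp only [Module.End.mul_apply, evalGen_t, evalGen_tinv, LinearMap.map_smul_of_tower, smul_smul]
    rw [← zpow_add₀ (qi_ne_zero i)]
    simp
  tinv_t i := by
    refine end_ext fun k => ?_
    simp only [Module.End.mul_apply, evalGen_t, evalGen_tinv, LinearMap.map_smul_of_tower, smul_smul]
    rw [← zpow_add₀ (qi_ne_zero i)]
    simp
  t_e i j := by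
    have hq := qF_ne_zero (F := F)
    refine end_ext fun k => ?_
    simp only [Module.End.mul_apply, evalGen_e, evalGen_tinv,
      LinearMap.map_smul_of_tower, map_smul, LinearMap.smul_apply]
    fin_cases i <;> fin_cases j <;> cases k <;>
      simp [eVec, wt, cartan, qi, evalGen_t, LinearMap.map_smul_of_tower] <;>
      simp only [← algebraMap_smul F (_ : K) (_ : Idx → F), map_pow, map_inv₀, map_div₀, map_q,
        map_two, map_three] <;>
      match_scalars <;> field_simp
  t_f i j := by
    have hq := qF_ne_zero (F := F)
    refine end_ext fun k => ?_
    simp only [Module.End.mul_apply, evalGen_f, evalGen_tinv,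
      LinearMap.map_smul_of_tower, map_smul, LinearMap.smul_apply]
    fin_cases i <;> fin_cases j <;> cases k <;>
      simp [fVec, wt, cartan, qi, evalGen_t, LinearMap.map_smul_of_tower] <;>
      simp only [← algebraMap_smul F (_ : K) (_ : Idx → F), map_pow, map_inv₀, map_div₀, map_q,
        map_two, map_three] <;>
      match_scalars <;> field_simp
  e_f := evalGen_e_f x
  serre_e := evalGen_serre_e x
  serre_f := evalGen_serre_f x

/-- The module `V^1_x` of `U'_q(D_4^{(3)})`, with scalars extended to a field `F ∋ x`; for `F = K`
and `x = 1` this is `V^1` itself. -/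
noncomputable def evalRep (x : Fˣ) : U →ₐ[K] Module.End F (Idx → F) :=
  liftU (evalGen x) (evalGen_relations x)

/-! ### Tensor products -/

variable (F) in
/-- The space `V^1 ⊗ V^1`, with scalars extended to `F`. -/
abbrev W : Type _ := (Idx → F) ⊗[F] (Idx → F)

/-- The action of `U'_q(D_4^{(3)})` on the left factor of `V^1_x ⊗ V^1_y`. -/
noncomputable def leftRep (x : Fˣ) : U →ₐ[K] Module.End F (W F) :=
  ((Module.End.rTensorAlgHom F (Idx → F) (Idx → F)).restrictScalars K).comp (evalRep x)

/-- The action of `U'_q(D_4^{(3)})` on the right factor of `V^1_x ⊗ V^1_y`. -/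
noncomputable def rightRep (y : Fˣ) : U →ₐ[K] Module.End F (W F) :=
  ((Module.End.lTensorAlgHom F (Idx → F) (Idx → F)).restrictScalars K).comp (evalRep y)

theorem leftRep_commute (x y : Fˣ) (g h : U) : Commute (leftRep x g) (rightRep y h) :=
  (LinearMap.rTensor_comp_lTensor _ (evalRep x g) (evalRep y h)).trans
    (LinearMap.lTensor_comp_rTensor _ (evalRep x g) (evalRep y h)).symm

/-- The action of `U'_q(D_4^{(3)}) ⊗ U'_q(D_4^{(3)})` on `V^1_x ⊗ V^1_y`. -/
noncomputable def pairRep (x y : Fˣ) : U ⊗[K] U →ₐ[K] Module.End F (W F) :=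
  Algebra.TensorProduct.lift (leftRep x) (rightRep y) (leftRep_commute x y)

theorem pairRep_tmul (x y : Fˣ) (g h : U) (a b : Idx → F) :
    pairRep x y (g ⊗ₜ h) (a ⊗ₜ b) = (evalRep x g a) ⊗ₜ (evalRep y h b) := by
  rw [pairRep, Algebra.TensorProduct.lift_tmul]
  rfl

/-- The action of `U'_q(D_4^{(3)})` on `V^1_x ⊗ V^1_y` through the coproduct. -/
noncomputable def tensorRep (x y : Fˣ) : U →ₐ[K] Module.End F (W F) :=
  (pairRep x y).comp comul

theorem tensorRep_e (x y : Fˣ) (i : Fin 3) (a b : Idx → F) :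
    tensorRep x y (gen (.e i)) (a ⊗ₜ b) =
      (evalGen x (.e i) a) ⊗ₜ (evalGen y (.tinv i) b) + a ⊗ₜ (evalGen y (.e i) b) := by
  simp [tensorRep, comul, comulGen, pairRep_tmul, evalRep]

theorem tensorRep_f (x y : Fˣ) (i : Fin 3) (a b : Idx → F) :
    tensorRep x y (gen (.f i)) (a ⊗ₜ b) =
      (evalGen x (.f i) a) ⊗ₜ b + (evalGen x (.t i) a) ⊗ₜ (evalGen y (.f i) b) := by
  simp [tensorRep, comul, comulGen, pairRep_tmul, evalRep]

theorem tensorRep_t (x y : Fˣ) (i : Fin 3) (a b : Idx → F) :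
    tensorRep x y (gen (.t i)) (a ⊗ₜ b) = (evalGen x (.t i) a) ⊗ₜ (evalGen y (.t i) b) := by
  simp [tensorRep, comul, comulGen, pairRep_tmul, evalRep]

theorem tensorRep_tinv (x y : Fˣ) (i : Fin 3) (a b : Idx → F) :
    tensorRep x y (gen (.tinv i)) (a ⊗ₜ b) =
      (evalGen x (.tinv i) a) ⊗ₜ (evalGen y (.tinv i) b) := by
  simp [tensorRep, comul, comulGen, pairRep_tmul, evalRep]

/-! ### The decomposition under `U_q(G_2)` -/

/-- The subalgebra `U_q(G_2)` generated by `e_i, f_i, t_i^{±1}`, `i = 1, 2`. -/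
noncomputable def UG2 : Subalgebra K U :=
  Algebra.adjoin K {g | ∃ i : Fin 3, i ≠ 0 ∧
    (g = gen (.e i) ∨ g = gen (.f i) ∨ g = gen (.t i) ∨ g = gen (.tinv i))}

/-- Labels of the listed irreducible components of `V^1 ⊗ V^1`: one of highest weight
`2\barΛ_1`, one of highest weight `\barΛ_2`, three of highest weight `\barΛ_1`, two trivial. -/
inductive Comp : Type
  | twoLam1
  | lam2
  | lam1 (i : Fin 3)
  | triv (i : Fin 2)
  deriving DecidableEq

/-- The highest weights, as `i ↦ ⟨h_i, λ⟩` (only `i = 1, 2` matter for `U_q(G_2)`). -/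
def Comp.weight : Comp → Fin 3 → ℤ
  | .twoLam1 => ![-4, 2, 0]
  | .lam2 => ![-3, 0, 1]
  | .lam1 _ => ![-2, 1, 0]
  | .triv _ => ![0, 0, 0]

variable (F) in
/-- The highest weight vectors `u_{2Λ_1}`, `u_{Λ_2}`, `u_{Λ_1}^{(i)}`, `u_0^{(i)}`. -/
noncomputable def hwVec : Comp → W F
  | .twoLam1 => v .b1 ⊗ₜ v .b1
  | .lam2 => v .b1 ⊗ₜ v .b2 - qF F • v .b2 ⊗ₜ v .b1
  | .lam1 0 => v .b1 ⊗ₜ v .phi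
  | .lam1 1 => v .phi ⊗ₜ v .b1
  | .lam1 2 => v .b1 ⊗ₜ v .b0 - qF F ^ 6 • v .b0 ⊗ₜ v .b1
      - (qF F ^ 2 * sInt (qF F) 2) • v .b2 ⊗ₜ v .b3 + (qF F ^ 5 * sInt (qF F) 2) • v .b3 ⊗ₜ v .b2
  | .triv 0 => v .phi ⊗ₜ v .phi
  | .triv 1 => v .b1 ⊗ₜ v .c1 + qF F ^ 10 • v .c1 ⊗ₜ v .b1
      - qF F • v .b2 ⊗ₜ v .c2 - qF F ^ 9 • v .c2 ⊗ₜ v .b2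
      + qF F ^ 4 • v .b3 ⊗ₜ v .c3 + qF F ^ 6 • v .c3 ⊗ₜ v .b3
      - (qF F ^ 4 / sInt (qF F) 2) • v .b0 ⊗ₜ v .b0

variable (F) in
/-- The `U_q(G_2)`-submodule generated by a highest weight vector. -/
noncomputable def component (k : Comp) : Submodule F (W F) :=
  Submodule.span F {w | ∃ g ∈ UG2, w = tensorRep 1 1 g (hwVec F k)}

theorem hwVec_mem (k : Comp) : hwVec F k ∈ component F k :=
  Submodule.subset_span ⟨1, one_mem _, by simp⟩

theorem component_stable (k : Comp) (g : U) (hg : g ∈ UG2) (w : W F) (hw : w ∈ component F k) :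
    tensorRep 1 1 g w ∈ component F k := by
  induction hw using Submodule.span_induction with
  | mem w hw =>
    obtain ⟨h, hh, rfl⟩ := hw
    exact Submodule.subset_span ⟨g * h, mul_mem hg hh, by simp⟩
  | zero => simp
  | add a b _ _ ha hb => rw [map_add]; exact add_mem ha hb
  | smul c a _ ha => rw [map_smul]; exact Submodule.smul_mem _ _ ha

/-- `M` is an irreducible `U_q(G_2)`-submodule of `V^1 ⊗ V^1` and `u` is a highest weight vector
of `M` of weight `lam`. -/
structure IsIrredHighestWeight (M : Submodule F (W F)) (u : W F) (lam : Fin 3 → ℤ) : Prop where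
  mem : u ∈ M
  ne_zero : u ≠ 0
  e_eq_zero : ∀ i : Fin 3, i ≠ 0 → tensorRep 1 1 (gen (.e i)) u = 0
  t_eq : ∀ i : Fin 3, i ≠ 0 → tensorRep 1 1 (gen (.t i)) u = (algebraMap K F (qi i) ^ lam i) • u
  stable : ∀ g ∈ UG2, ∀ w ∈ M, tensorRep 1 1 g w ∈ M
  irreducible : ∀ N : Submodule F (W F), N ≤ M →
    (∀ g ∈ UG2, ∀ w ∈ N, tensorRep 1 1 g w ∈ N) → N = ⊥ ∨ N = M

/-- `P` is the projection onto the component `k` along all the other components. -/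
def IsComponentProj (k : Comp) (P : W F →ₗ[F] component F k) : Prop :=
  ∀ j, ∀ w ∈ component F j, (P w : W F) = if j = k then w else 0

/-- `f` is a `U_q(G_2)`-linear isomorphism sending the highest weight vector labelled `j`
to the one labelled `k`. -/
structure IsComponentIso (j k : Comp) (f : component F j ≃ₗ[F] component F k) : Prop where
  linear : ∀ (g : U) (hg : g ∈ UG2) (w : component F j),
    f ⟨tensorRep 1 1 g w, component_stable j g hg _ w.2⟩ =
      ⟨tensorRep 1 1 g (f w), component_stable k g hg _ (f w).2⟩
  map_hwVec : f ⟨hwVec F j, hwVec_mem j⟩ = ⟨hwVec F k, hwVec_mem k⟩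

/-! ### The `R`-matrix -/

/-- `R` is a `U'_q(D_4^{(3)})`-linear map `V^1_x ⊗ V^1_y → V^1_y ⊗ V^1_x`. -/
def IsIntertwiner (x y : Fˣ) (R : Module.End F (W F)) : Prop :=
  ∀ (g : U) (w : W F), R (tensorRep x y g w) = tensorRep y x g (R w)

/-- The matrix coefficients of `R` in the basis `v_a ⊗ v_b` all lie in `S`. -/
def HasCoeffsIn (S : Set F) (R : Module.End F (W F)) : Prop :=
  ∀ a b c d : Idx, ((Pi.basisFun F Idx).tensorProduct (Pi.basisFun F Idx)).repr
    (R (v a ⊗ₜ v b)) (c, d) ∈ S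

/-- `R` is an `R`-matrix for `V^1 ⊗ V^1`: a nonzero `U'_q(D_4^{(3)})`-linear map
`V^1_x ⊗ V^1_y → V^1_y ⊗ V^1_x` that belongs to `ℚ(q)[x/y, y/x] ⊗ End(V^1 ⊗ V^1)`. -/
structure IsRMatrix (x y : Fˣ) (R : Module.End F (W F)) : Prop where
  ne_zero : R ≠ 0
  intertwiner : IsIntertwiner x y R
  coeffs : HasCoeffsIn (Algebra.adjoin K {(x / y : F), (y / x : F)} : Set F) R

/-- The coefficient of the component of highest weight `2\barΛ_1`. -/
noncomputable def aTwo (z : F) : F :=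
  (1 - qF F ^ 2 * z) * (1 - qF F ^ 6 * z) * (1 + qF F ^ 4 * z + qF F ^ 8 * z ^ 2)

/-- The coefficient of the component of highest weight `\barΛ_2`. -/
noncomputable def aLam2 (z : F) : F :=
  (z - qF F ^ 2) * (1 - qF F ^ 6 * z) * (1 + qF F ^ 4 * z + qF F ^ 8 * z ^ 2)

/-- The coefficients `a^{Λ_1}_{ij}`. -/
noncomputable def aLam1 (z : F) : Matrix (Fin 3) (Fin 3) F :=
  let q := qF F
  let d := (1 - q ^ 6) * z * (1 - q ^ 12 * z ^ 2) / (1 + q ^ 2)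
  let o := q ^ 2 * (1 - z) * (1 - q ^ 6 * z) *
    ((1 + q ^ 2) * (1 + q ^ 6 * z ^ 2) + (q ^ 2 + q ^ 6) * z) / (1 + q ^ 2)
  let r := q * (1 - q ^ 6) * z * (1 - z) * (1 - q ^ 6 * z) / (1 + q ^ 2) ^ 2
  let s := (1 + q ^ 2) ^ 2 * (1 + q ^ 8) * r
  let c := (1 - q ^ 6 * z) *
    (q ^ 2 * (1 + q ^ 2) * (z ^ 3 - q ^ 6) + (1 - q ^ 2) * (1 - q ^ 6) * z * (z - q ^ 4)) /
      (1 + q ^ 2)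
  !![d, o, r;
     o, d, r;
     s, s, c]

/-- The coefficient `a^0_{11}`. -/
noncomputable def aZeroOne (z : F) : F :=
  let q := qF F
  ((1 + q ^ 2) * (q ^ 2 + q ^ 14 * z ^ 4) - (1 + q ^ 8) * z * (q ^ 2 + q ^ 8 * z ^ 2)
    + (1 - q ^ 4) * (1 - q ^ 6) * (1 + q ^ 8) * z ^ 2) / (1 + q ^ 2)

/-- The coefficients `a^0_{ij}`. -/
noncomputable def aZero (z : F) : Matrix (Fin 2) (Fin 2) F :=
  let q := qF F
  !![aZeroOne z, q * (1 - q ^ 6) ^ 2 * z * (1 - z ^ 2) / ((1 + q ^ 2) * (1 - q ^ 4));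
     q * (1 - q ^ 14) * (1 - q ^ 4 + q ^ 8) * z * (1 - z ^ 2), z ^ 4 * aZeroOne (1 / z)]

/-- The operator with the given spectral decomposition, where `ι₁ j i`, `ι₀ j i` map the `i`-th
copy to the `j`-th copy of the corresponding component. -/
noncomputable def spectralR (z : F) (P : ∀ k, W F →ₗ[F] component F k)
    (ι₁ : ∀ j i : Fin 3, component F (.lam1 i) ≃ₗ[F] component F (.lam1 j))
    (ι₀ : ∀ j i : Fin 2, component F (.triv i) ≃ₗ[F] component F (.triv j)) :
    Module.End F (W F) :=
  aTwo z • ((component F .twoLam1).subtype ∘ₗ P .twoLam1)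
  + aLam2 z • ((component F .lam2).subtype ∘ₗ P .lam2)
  + ∑ i, ∑ j, aLam1 z i j •
      ((component F (.lam1 j)).subtype ∘ₗ (ι₁ j i).toLinearMap ∘ₗ P (.lam1 i))
  + ∑ i, ∑ j, aZero z i j •
      ((component F (.triv j)).subtype ∘ₗ (ι₀ j i).toLinearMap ∘ₗ P (.triv i))

end

/-- The field `ℚ(q)(x, y)`. -/
abbrev Kxy : Type := FractionRing (MvPolynomial (Fin 2) K)

/-- The spectral parameter `x`. -/
noncomputable def xPar : Kxyˣ :=
  Units.mk0 (algebraMap (MvPolynomial (Fin 2) K) Kxy (MvPolynomial.X 0)) (by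
    simp [MvPolynomial.X_ne_zero])

/-- The spectral parameter `y`. -/
noncomputable def yPar : Kxyˣ :=
  Units.mk0 (algebraMap (MvPolynomial (Fin 2) K) Kxy (MvPolynomial.X 1)) (by
    simp [MvPolynomial.X_ne_zero])

/-- The ratio `z = x / y`. -/
noncomputable def zPar : Kxy := xPar / yPar

end D43

/-!
The four claims are the decomposition of `V^1 ⊗ V^1` under `U_q(G_2)`, the intertwining property of
the spectral operator, its uniqueness, and the determinants. Everything is carried
out over an arbitrary field `F` containing `ℚ(q)`, for arbitrary units `x`, `y` of `F`; that `x`, `y`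
are independent enters only through `aTwo_zPar_ne_zero`, the nonvanishing of the leading
coefficient.

*Generation.* A linear map on `V^1 ⊗ V^1` that kills the images of `f_1`, `f_2` and the seven
vectors `u_k` is zero (`eq_zero_of_kills`): applying it to `f_i (v_a ⊗ v_b)` gives relations that
leave only the values on the `u_k`. As `f_1`, `f_2` are nilpotent, a subspace stable under them that
contains all `u_k` is everything (`v_mem_of_stable`, `eq_top_of_stable`). Nearly every identity below
is therefore checked on the seven vectors `u_k` only.

*Decomposition.* The standard basis of `V^1 ⊗ V^1` is orthogonal for a symmetric form `formW` for
which `e_i` is adjoint to `q_i⁻¹ t_i⁻¹ f_i`, with the spectral parameters inverted. A vector killed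
by `e_1`, `e_2` is orthogonal to the images of `f_1`, `f_2`, so it is zero as soon as it is
orthogonal to all `u_k`. The `u_k` are orthogonal to each other with nonzero norms. Hence the
components are mutually orthogonal and meet their orthogonal complements in `0`, since a common
subspace would contain a highest weight vector; the same argument gives irreducibility
(`component_isInternal`, `component_isIrredHighestWeight`). The components of highest weight `\barΛ_1`
and `0` are images of `V^1` under explicit maps `copyMap`, which provides the isomorphisms between
them.

*Intertwining.* `IsSpectral` axiomatizes the operator by its `U_q(G_2)`-linearity and its values on
the `u_k`. The commutation with `e_0` is checked on each `u_k` by writing `e_0 u_k` as a sum of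
vectors of the components (`e0_two` to `e0_triv_one`), and extends to all vectors because `e_0`
commutes with `f_1` and `f_2` (`IsSpectral.apply_e0`). The coefficient matrices are symmetrized by
the norms of the `u_k`, so `R` is self-adjoint for `formW`, and taking adjoints turns the relation
for `e_0` with parameters `(y⁻¹, x⁻¹)` into the one for `f_0` with parameters `(x, y)`
(`IsSpectral.apply_f0`).

*Uniqueness.* If the coefficient of the component of highest weight `2\barΛ_1` does not vanish at
`x / y`, then `u_{2Λ_1}` generates `V^1_x ⊗ V^1_y` (`eq_top_of_top_mem`): by means of `e_0` it reaches
`u_{Λ_2}`, then three combinations of the `u_{Λ_1}^{(i)}` whose determinant is a nonzero multiple of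
`x y (y² + q⁴ x y + q⁸ x²)`, and finally the two trivial components. An intertwiner multiplies
`u_{2Λ_1}` by a scalar, for reasons of weight, and is determined by this scalar, which is also one of
its matrix coefficients.
-/

namespace D43

variable {F : Type*} [Field F] [Algebra K F]

/-! ### Scalars -/


section scalars

variable (F) in
/-- Divisors of `q ^ n - 1` are nonzero in `F`, since `q` is not a root of unity. -/
theorem qF_ne_zero_of_mul (n : ℕ) (hn : n ≠ 0) {a : F} (b : F) (h : a * b = qF F ^ n - 1) :
    a ≠ 0 := by
  rintro rfl
  exact qF_pow_ne_one (F := F) n hn (by linear_combination -h)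

variable (F) in
theorem n_two : qF F ^ 2 + 1 ≠ 0 := qF_ne_zero_of_mul F 4 (by norm_num) (qF F ^ 2 - 1) (by ring)

variable (F) in
theorem n_three : qF F ^ 4 + qF F ^ 2 + 1 ≠ 0 :=
  qF_ne_zero_of_mul F 6 (by norm_num) (qF F ^ 2 - 1) (by ring)

variable (F) in
/-- `n_three` in the form into which `field_simp` brings it. -/
theorem n_three' : qF F ^ 2 * (qF F ^ 2 + 1) + 1 ≠ 0 := by
  convert n_three F using 1; ring

variable (F) in
theorem n_eight : qF F ^ 8 + 1 ≠ 0 := qF_ne_zero_of_mul F 16 (by norm_num) (qF F ^ 8 - 1) (by ring)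

variable (F) in
theorem n_seven : qF F ^ 12 + qF F ^ 10 + qF F ^ 8 + qF F ^ 6 + qF F ^ 4 + qF F ^ 2 + 1 ≠ 0 :=
  qF_ne_zero_of_mul F 14 (by norm_num) (qF F ^ 2 - 1) (by ring)

variable (F) in
theorem n_twelve : qF F ^ 8 - qF F ^ 4 + 1 ≠ 0 :=
  qF_ne_zero_of_mul F 24 (by norm_num) ((qF F ^ 4 + 1) * (qF F ^ 12 - 1)) (by ring)

variable (F) in
/-- `n_seven` in the form into which `field_simp` brings it. -/
theorem n_seven' : qF F ^ 2 * (qF F ^ 2 * (qF F ^ 2 * (qF F ^ 2 * (qF F ^ 2 * (qF F ^ 2 + 1) + 1)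
    + 1) + 1) + 1) + 1 ≠ 0 := by
  convert n_seven F using 1; ring

variable (F) in
/-- `n_twelve` in the form into which `field_simp` brings it. -/
theorem n_twelve' : qF F ^ 4 * (qF F ^ 4 - 1) + 1 ≠ 0 := by
  convert n_twelve F using 1; ring

theorem sInt_qF_two : sInt (qF F) 2 = (qF F ^ 2 + 1) / qF F := by
  have h : qF F - (qF F)⁻¹ ≠ 0 := by
    have h2 := qF_pow_ne_one (F := F) 2 (by norm_num)
    have h0 := qF_ne_zero (F := F)
    intro h
    apply h2
    field_simp at h
    linear_combination h
  have hq := qF_ne_zero (F := F)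
  rw [sInt, div_eq_iff h]; field_simp; ring

theorem smul_sInt_two {X : Type*} [AddCommGroup X] [Module F X] [Module K X] [IsScalarTower K F X]
    (p : X) : sInt q 2 • p = ((qF F ^ 2 + 1) / qF F) • p := by
  rw [← algebraMap_smul F (sInt q 2) p, map_two]

end scalars

/-! ### The action on the standard bases -/

theorem wt_zero : wt .b1 0 = -2 ∧ wt .b2 0 = -1 ∧ wt .b3 0 = -1 ∧ wt .b0 0 = 0 ∧ wt .c3 0 = 1 ∧
    wt .c2 0 = 1 ∧ wt .c1 0 = 2 ∧ wt .phi 0 = 0 := by decide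

theorem wt_one : wt .b1 1 = 1 ∧ wt .b2 1 = -1 ∧ wt .b3 1 = 2 ∧ wt .b0 1 = 0 ∧ wt .c3 1 = -2 ∧
    wt .c2 1 = 1 ∧ wt .c1 1 = -1 ∧ wt .phi 1 = 0 := by decide

theorem wt_two : wt .b1 2 = 0 ∧ wt .b2 2 = 1 ∧ wt .b3 2 = -1 ∧ wt .b0 2 = 0 ∧ wt .c3 2 = 1 ∧
    wt .c2 2 = -1 ∧ wt .c1 2 = 0 ∧ wt .phi 2 = 0 := by decide

theorem fVec_zero : (fVec 0 .b1 : Idx → F) = 0 ∧ (fVec 0 .b2 : Idx → F) = 0 ∧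
    (fVec 0 .b3 : Idx → F) = 0 ∧ (fVec 0 .b0 : Idx → F) = v .b1 ∧ (fVec 0 .c3 : Idx → F) = v .b2 ∧
    (fVec 0 .c2 : Idx → F) = v .b3 ∧
    (fVec 0 .c1 : Idx → F) = v .phi + (qF F / (qF F ^ 2 + 1)) • v .b0 ∧
    (fVec 0 .phi : Idx → F) = ((qF F ^ 4 + qF F ^ 2 + 1) / (qF F * (qF F ^ 2 + 1))) • v .b1 := by
  have hq := qF_ne_zero (F := F)
  have h2 := n_two F
  refine ⟨rfl, rfl, rfl, rfl, rfl, rfl, ?_, ?_⟩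
  · rw [fVec, ← algebraMap_smul F (_ : K) (_ : Idx → F), map_inv₀, map_two, inv_div]
  · rw [fVec, ← algebraMap_smul F (_ : K) (_ : Idx → F), map_div₀, map_two, map_three]
    congr 1
    field_simp

theorem fVec_one : (fVec 1 .b1 : Idx → F) = v .b2 ∧ (fVec 1 .b2 : Idx → F) = 0 ∧
    (fVec 1 .b3 : Idx → F) = v .b0 ∧ (fVec 1 .b0 : Idx → F) = ((qF F ^ 2 + 1) / qF F) • v .c3 ∧
    (fVec 1 .c3 : Idx → F) = 0 ∧ (fVec 1 .c2 : Idx → F) = v .c1 ∧ (fVec 1 .c1 : Idx → F) = 0 ∧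
    (fVec 1 .phi : Idx → F) = 0 :=
  ⟨rfl, rfl, rfl, smul_sInt_two _, rfl, rfl, rfl, rfl⟩

theorem fVec_two : (fVec 2 .b1 : Idx → F) = 0 ∧ (fVec 2 .b2 : Idx → F) = v .b3 ∧
    (fVec 2 .b3 : Idx → F) = 0 ∧ (fVec 2 .b0 : Idx → F) = 0 ∧ (fVec 2 .c3 : Idx → F) = v .c2 ∧
    (fVec 2 .c2 : Idx → F) = 0 ∧ (fVec 2 .c1 : Idx → F) = 0 ∧ (fVec 2 .phi : Idx → F) = 0 :=
  ⟨rfl, rfl, rfl, rfl, rfl, rfl, rfl, rfl⟩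

theorem eVec_zero : (eVec 0 .b1 : Idx → F) = v .phi + (qF F / (qF F ^ 2 + 1)) • v .b0 ∧
    (eVec 0 .b2 : Idx → F) = v .c3 ∧ (eVec 0 .b3 : Idx → F) = v .c2 ∧
    (eVec 0 .b0 : Idx → F) = v .c1 ∧ (eVec 0 .c3 : Idx → F) = 0 ∧ (eVec 0 .c2 : Idx → F) = 0 ∧
    (eVec 0 .c1 : Idx → F) = 0 ∧
    (eVec 0 .phi : Idx → F) = ((qF F ^ 4 + qF F ^ 2 + 1) / (qF F * (qF F ^ 2 + 1))) • v .c1 := by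
  have hq := qF_ne_zero (F := F)
  have h2 := n_two F
  refine ⟨?_, rfl, rfl, rfl, rfl, rfl, rfl, ?_⟩
  · rw [eVec, ← algebraMap_smul F (_ : K) (_ : Idx → F), map_inv₀, map_two, inv_div]
  · rw [eVec, ← algebraMap_smul F (_ : K) (_ : Idx → F), map_div₀, map_two, map_three]
    congr 1
    field_simp

theorem eVec_one : (eVec 1 .b1 : Idx → F) = 0 ∧ (eVec 1 .b2 : Idx → F) = v .b1 ∧
    (eVec 1 .b3 : Idx → F) = 0 ∧ (eVec 1 .b0 : Idx → F) = ((qF F ^ 2 + 1) / qF F) • v .b3 ∧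
    (eVec 1 .c3 : Idx → F) = v .b0 ∧ (eVec 1 .c2 : Idx → F) = 0 ∧ (eVec 1 .c1 : Idx → F) = v .c2 ∧
    (eVec 1 .phi : Idx → F) = 0 :=
  ⟨rfl, rfl, rfl, smul_sInt_two _, rfl, rfl, rfl, rfl⟩

theorem eVec_two : (eVec 2 .b1 : Idx → F) = 0 ∧ (eVec 2 .b2 : Idx → F) = 0 ∧
    (eVec 2 .b3 : Idx → F) = v .b2 ∧ (eVec 2 .b0 : Idx → F) = 0 ∧ (eVec 2 .c3 : Idx → F) = 0 ∧
    (eVec 2 .c2 : Idx → F) = v .c3 ∧ (eVec 2 .c1 : Idx → F) = 0 ∧ (eVec 2 .phi : Idx → F) = 0 :=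
  ⟨rfl, rfl, rfl, rfl, rfl, rfl, rfl, rfl⟩

variable (F) in
/-- The image of `q_i` in `F`. -/
noncomputable def qiF (i : Fin 3) : F := algebraMap K F (qi i)

theorem qiF_ne_zero (i : Fin 3) : qiF F i ≠ 0 := by
  rw [qiF, ← map_zero (algebraMap K F)]
  exact fun h => qi_ne_zero i ((algebraMap K F).injective h)

theorem qiF_eval : qiF F 0 = qF F ∧ qiF F 1 = qF F ∧ qiF F 2 = qF F ^ 3 := by
  simp [qiF, qi, qF]

theorem qi_zpow_smul {X : Type*} [AddCommGroup X] [Module F X] [Module K X] [IsScalarTower K F X]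
    (i : Fin 3) (n : ℤ) (p : X) : qi i ^ n • p = qiF F i ^ n • p := by
  rw [← algebraMap_smul F (_ : K) p, map_zpow₀, qiF]

omit [Algebra K F] in
/-- Two linear maps on `V^1 ⊗ V^1` agree if they agree on the standard basis. -/
theorem W_ext {X : Type*} [AddCommGroup X] [Module F X] {φ ψ : W F →ₗ[F] X}
    (h : ∀ a b, φ (v a ⊗ₜ v b) = ψ (v a ⊗ₜ v b)) : φ = ψ := by
  refine ((Pi.basisFun F Idx).tensorProduct (Pi.basisFun F Idx)).ext fun ⟨a, b⟩ => ?_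
  simpa [v] using h a b

/-- The factor `x ^ {δ_{i0}}`. -/
def twist (x : Fˣ) (i : Fin 3) : F := if i = 0 then (x : F) else 1

omit [Algebra K F] in
theorem twist_eval (x : Fˣ) : twist x 0 = x ∧ twist x 1 = 1 ∧ twist x 2 = 1 := by
  simp [twist]

theorem tensorRep_e_v (x y : Fˣ) (i : Fin 3) (a b : Idx) :
    tensorRep x y (gen (.e i)) (v a ⊗ₜ v b) =
      (twist x i * qiF F i ^ (-wt b i)) • eVec i a ⊗ₜ v b + twist y i • v a ⊗ₜ eVec i b := by
  simp only [tensorRep_e, evalGen_e, evalGen_tinv, qi_zpow_smul (F := F), twist,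
    TensorProduct.tmul_smul, ← TensorProduct.smul_tmul', smul_smul, mul_comm]

theorem tensorRep_f_v (x y : Fˣ) (i : Fin 3) (a b : Idx) :
    tensorRep x y (gen (.f i)) (v a ⊗ₜ v b) = (twist x i)⁻¹ • fVec i a ⊗ₜ v b +
      ((twist y i)⁻¹ * qiF F i ^ wt a i) • v a ⊗ₜ fVec i b := by
  have h : ∀ x : Fˣ, (if i = 0 then (x : F)⁻¹ else 1) = (twist x i)⁻¹ := by
    intro x; unfold twist; split_ifs <;> simp
  simp only [tensorRep_f, evalGen_f, evalGen_t, qi_zpow_smul (F := F), h,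
    TensorProduct.tmul_smul, ← TensorProduct.smul_tmul', smul_smul]

theorem tensorRep_t_v (x y : Fˣ) (i : Fin 3) (a b : Idx) :
    tensorRep x y (gen (.t i)) (v a ⊗ₜ v b) = qiF F i ^ (wt a i + wt b i) • v a ⊗ₜ v b := by
  simp only [tensorRep_t, evalGen_t, qi_zpow_smul (F := F), TensorProduct.tmul_smul,
    ← TensorProduct.smul_tmul', smul_smul, zpow_add₀ (qiF_ne_zero (F := F) i), mul_comm]

theorem tensorRep_tinv_v (x y : Fˣ) (i : Fin 3) (a b : Idx) :
    tensorRep x y (gen (.tinv i)) (v a ⊗ₜ v b) = qiF F i ^ (-(wt a i + wt b i)) • v a ⊗ₜ v b := by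
  simp only [tensorRep_tinv, evalGen_tinv, qi_zpow_smul (F := F), TensorProduct.tmul_smul,
    ← TensorProduct.smul_tmul', smul_smul, neg_add, zpow_add₀ (qiF_ne_zero (F := F) i), mul_comm]

/-- The generators with index `i ≠ 0` do not see the spectral parameters. -/
theorem tensorRep_eq_one (x y : Fˣ) {g : U} (hg : g ∈ UG2) :
    tensorRep x y g = tensorRep 1 1 g := by
  refine AlgHom.adjoin_le_equalizer (tensorRep x y) (tensorRep 1 1) ?_ hg
  rintro g ⟨i, hi, rfl | rfl | rfl | rfl⟩ <;> refine W_ext fun a b => ?_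
  · rw [tensorRep_e_v, tensorRep_e_v]; simp [twist, hi]
  · rw [tensorRep_f_v, tensorRep_f_v]; simp [twist, hi]
  · rw [tensorRep_t_v, tensorRep_t_v]
  · rw [tensorRep_tinv_v, tensorRep_tinv_v]

theorem gen_mem_UG2 {i : Fin 3} (hi : i ≠ 0) : gen (.e i) ∈ UG2 ∧ gen (.f i) ∈ UG2 ∧
    gen (.t i) ∈ UG2 ∧ gen (.tinv i) ∈ UG2 :=
  ⟨Algebra.subset_adjoin ⟨i, hi, by tauto⟩, Algebra.subset_adjoin ⟨i, hi, by tauto⟩,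
    Algebra.subset_adjoin ⟨i, hi, by tauto⟩, Algebra.subset_adjoin ⟨i, hi, by tauto⟩⟩

variable (F) in
/-- The highest weight vectors, with all coefficients written as rational functions of `q`. -/
theorem hwVec_eval : hwVec F .twoLam1 = v .b1 ⊗ₜ v .b1 ∧
    hwVec F .lam2 = v .b1 ⊗ₜ v .b2 - qF F • v .b2 ⊗ₜ v .b1 ∧
    hwVec F (.lam1 0) = v .b1 ⊗ₜ v .phi ∧ hwVec F (.lam1 1) = v .phi ⊗ₜ v .b1 ∧
    hwVec F (.lam1 2) = v .b1 ⊗ₜ v .b0 - qF F ^ 6 • v .b0 ⊗ₜ v .b1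
      - (qF F * (qF F ^ 2 + 1)) • v .b2 ⊗ₜ v .b3
      + (qF F ^ 4 * (qF F ^ 2 + 1)) • v .b3 ⊗ₜ v .b2 ∧
    hwVec F (.triv 0) = v .phi ⊗ₜ v .phi ∧
    hwVec F (.triv 1) = v .b1 ⊗ₜ v .c1 + qF F ^ 10 • v .c1 ⊗ₜ v .b1
      - qF F • v .b2 ⊗ₜ v .c2 - qF F ^ 9 • v .c2 ⊗ₜ v .b2
      + qF F ^ 4 • v .b3 ⊗ₜ v .c3 + qF F ^ 6 • v .c3 ⊗ₜ v .b3
      - (qF F ^ 5 / (qF F ^ 2 + 1)) • v .b0 ⊗ₜ v .b0 := by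
  have hq := qF_ne_zero (F := F)
  have h2 := n_two F
  have e1 : qF F ^ 2 * ((qF F ^ 2 + 1) / qF F) = qF F * (qF F ^ 2 + 1) := by field_simp
  have e2 : qF F ^ 5 * ((qF F ^ 2 + 1) / qF F) = qF F ^ 4 * (qF F ^ 2 + 1) := by field_simp
  have e3 : qF F ^ 4 / ((qF F ^ 2 + 1) / qF F) = qF F ^ 5 / (qF F ^ 2 + 1) := by field_simp
  refine ⟨rfl, rfl, rfl, rfl, ?_, rfl, ?_⟩
  · change v .b1 ⊗ₜ v .b0 - qF F ^ 6 • v .b0 ⊗ₜ v .b1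
      - (qF F ^ 2 * sInt (qF F) 2) • v .b2 ⊗ₜ v .b3
      + (qF F ^ 5 * sInt (qF F) 2) • v .b3 ⊗ₜ v .b2 = _
    rw [sInt_qF_two, e1, e2]
  · change v .b1 ⊗ₜ v .c1 + qF F ^ 10 • v .c1 ⊗ₜ v .b1
      - qF F • v .b2 ⊗ₜ v .c2 - qF F ^ 9 • v .c2 ⊗ₜ v .b2
      + qF F ^ 4 • v .b3 ⊗ₜ v .c3 + qF F ^ 6 • v .c3 ⊗ₜ v .b3
      - (qF F ^ 4 / sInt (qF F) 2) • v .b0 ⊗ₜ v .b0 = _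
    rw [sInt_qF_two, e3]

theorem hwVec_e (k : Comp) {i : Fin 3} (hi : i ≠ 0) :
    tensorRep 1 1 (gen (.e i)) (hwVec F k) = 0 := by
  have hq := qF_ne_zero (F := F)
  have h2 := n_two F
  fin_cases i
  · exact absurd rfl hi
  all_goals
    rcases k with _ | _ | i | i
    · simp [hwVec_eval, tensorRep_e_v, eVec_one, eVec_two]
    · simp [hwVec_eval, tensorRep_e_v, eVec_one, eVec_two, twist_eval, qiF_eval, wt_one, smul_smul, hq]
    all_goals
      fin_cases i <;>
      simp [hwVec_eval, tensorRep_e_v, eVec_one, eVec_two, twist_eval, qiF_eval, wt_one, wt_two,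
        TensorProduct.tmul_smul, ← TensorProduct.smul_tmul', smul_smul] <;>
      match_scalars <;> field_simp <;> ring

theorem hwVec_t (x y : Fˣ) (k : Comp) (i : Fin 3) :
    tensorRep x y (gen (.t i)) (hwVec F k) = qiF F i ^ k.weight i • hwVec F k := by
  fin_cases i <;> rcases k with _ | _ | i | i
  all_goals try fin_cases i
  all_goals
    simp [hwVec_eval, tensorRep_t_v, wt_zero, wt_one, wt_two, Comp.weight, smul_smul, smul_sub,
      smul_add, mul_comm]

/-! ### Generation by the highest weight vectors -/

theorem tensorRep_f_K {i : Fin 3} (hi : i ≠ 0) (a b : Idx) :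
    tensorRep 1 1 (gen (.f i)) (v a ⊗ₜ v b : W F) =
      fVec i a ⊗ₜ v b + qi i ^ wt a i • v a ⊗ₜ fVec i b := by
  simp [tensorRep_f, evalGen_f, evalGen_t, hi, TensorProduct.smul_tmul']

theorem eq_zero_of_lin {Q : Type*} [AddCommGroup Q] [Module K Q] {c : K} {p : Q} (hc : c ≠ 0)
    (h : c • p = 0) : p = 0 := (smul_eq_zero.1 h).resolve_left hc

section

variable {k Q : Type*} [Field k] [AddCommGroup Q] [Module k Q]

theorem lam2_relation {s : k} {b12 b21 : Q} (h : b21 = -(s • b12))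
    (h' : b12 - s ^ 1 • b21 = 0) : (s ^ 2 + 1) • b12 = 0 := by
  rw [← h', h]; module

theorem lam1_relation {s t : k} {b10 b01 b23 b32 : Q} (ht : s * t = s ^ 2 + 1)
    (h1 : b23 = -(s • b10)) (h2 : b32 = -(s ^ 3 • b23)) (h3 : b01 = -(s ^ 2 • b32))
    (h' : b10 - s ^ 6 • b01 - (s ^ 2 * t) • b23 + (s ^ 5 * t) • b32 = 0) :
    ((s ^ 4 + s ^ 2 + 1) * (s ^ 8 + 1)) • b10 = 0 := by
  have e : (s ^ 4 + s ^ 2 + 1) * (s ^ 8 + 1) =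
      1 + s ^ 12 + s ^ 2 * (s * t) + s ^ 8 * (s * t) := by rw [ht]; ring
  rw [← h', h3, h2, h1, e]; module

theorem triv_relation {s t : k} {b11 b22 b33 b00 c33 c22 c11 : Q} (h0 : t ≠ 0)
    (h1 : b22 = -(s • b11)) (h2 : b33 = -(s ^ 3 • b22)) (h3 : b00 = -(s ^ 2 • t • b33))
    (h4 : t • c33 = -b00) (h5 : c22 = -(s ^ 3 • c33)) (h6 : c11 = -(s • c22))
    (h' : b11 + s ^ 10 • c11 - s ^ 1 • b22 - s ^ 9 • c22 + s ^ 4 • b33 + s ^ 6 • c33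
      - (s ^ 4 / t) • b00 = 0) :
    ((s ^ 12 + s ^ 10 + s ^ 8 + s ^ 6 + s ^ 4 + s ^ 2 + 1) * (s ^ 8 - s ^ 4 + 1)) • b11 = 0 := by
  have h4' : c33 = s ^ 6 • b11 := by
    rw [← sub_eq_zero]
    refine (smul_eq_zero.1 (?_ : t • (c33 - s ^ 6 • b11) = 0)).resolve_left h0
    rw [smul_sub, h4, h3, h2, h1]; module
  rw [← h', h6, h5, h4', h3, h2, h1]
  match_scalars
  field_simp
  ring

end

/-- A `K`-linear map that kills the image of `f_1` and `f_2` is determined by its values on the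
highest weight vectors: moving `f_i` from the left to the right factor, every value is expressed
through the values on the vectors `v_1 ⊗ v_b` and `v_φ ⊗ v_b`. -/
theorem eq_zero_of_kills {Q : Type*} [AddCommGroup Q] [Module K Q] (φ : W F →ₗ[K] Q)
    (hf : ∀ i : Fin 3, i ≠ 0 → ∀ a b, φ (tensorRep 1 1 (gen (.f i)) (v a ⊗ₜ v b)) = 0)
    (hu : ∀ k, φ (hwVec F k) = 0) (a b : Idx) : φ (v a ⊗ₜ v b) = 0 := by
  have hq := q_ne_zero
  have n2 : q ^ 2 + 1 ≠ 0 := n_two K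
  have hs : q * sInt q 2 = q ^ 2 + 1 := by
    have := map_two (F := K)
    change sInt q 2 = (q ^ 2 + 1) / q at this
    rw [this]; field_simp
  have hs0 : sInt q 2 ≠ 0 := by
    intro h; rw [h, mul_zero] at hs; exact n2 hs.symm
  have hm : algebraMap K F (sInt q 2) = sInt (qF F) 2 := by rw [map_two, sInt_qF_two]
  set s := sInt q 2 with hsdef
  have r : ∀ i : Fin 3, i ≠ 0 → ∀ a b, φ (fVec i a ⊗ₜ v b) =
      -(qi i ^ wt a i • φ (v a ⊗ₜ fVec i b)) := by
    intro i hi a b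
    have h := hf i hi a b
    rw [tensorRep_f_K hi, map_add, map_smul] at h
    exact eq_neg_of_add_eq_zero_left h
  have r1 := r 1 (by decide)
  have r2 := r 2 (by decide)
  have e1 : qi 1 = q := rfl
  have e2 : qi 2 = q ^ 3 := rfl
  have hsl : ∀ p t : Idx → F, φ ((s • p) ⊗ₜ t) = s • φ (p ⊗ₜ t) := fun p t => by
    rw [← TensorProduct.smul_tmul', map_smul]
  have hsr : ∀ p t : Idx → F, φ (p ⊗ₜ (s • t)) = s • φ (p ⊗ₜ t) := fun p t => by
    rw [TensorProduct.tmul_smul, map_smul]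
  -- the first row
  have row : ∀ b, φ (v .b1 ⊗ₜ v b) = 0 := by
    intro b
    cases b
    case b1 => exact hu .twoLam1
    case phi => exact hu (.lam1 0)
    case b3 =>
      have h := r2 .b1 .b2
      simpa [fVec, wt] using h
    case c2 =>
      have h := r2 .b1 .c3
      simpa [fVec, wt] using h
    case b2 =>
      have h := r1 .b1 .b1
      have h' := hu .lam2
      have hk : hwVec F .lam2 = v .b1 ⊗ₜ v .b2 - q ^ 1 • v .b2 ⊗ₜ v .b1 := by
        rw [pow_one, ← algebraMap_smul F q (_ : W F)]; rfl
      rw [hk, map_sub, map_smul] at h'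
      simp only [fVec, wt_one, e1, zpow_one] at h
      refine eq_zero_of_lin n2 ?_
      exact lam2_relation h h'
    case c3 =>
      have h := r1 .b2 .b3
      have h' := r1 .b1 .b0
      simp only [fVec, wt_one, e1, zpow_one, hsr, ← hsdef] at h'
      simp only [fVec, wt_one, e1, TensorProduct.zero_tmul, map_zero, h', smul_neg, neg_neg,
        smul_smul] at h
      refine eq_zero_of_lin ?_ h.symm
      exact mul_ne_zero (zpow_ne_zero _ hq) (mul_ne_zero hq hs0)
    case b0 =>
      have h1 := r1 .b1 .b3
      have h2 := r2 .b2 .b2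
      have h3 := r1 .b3 .b1
      have h' := hu (.lam1 2)
      have hk : hwVec F (.lam1 2) = v .b1 ⊗ₜ v .b0 - q ^ 6 • v .b0 ⊗ₜ v .b1
          - (q ^ 2 * s) • v .b2 ⊗ₜ v .b3 + (q ^ 5 * s) • v .b3 ⊗ₜ v .b2 := by
        simp only [← algebraMap_smul F (_ : K) (_ : W F), map_pow, map_mul, hm, map_q]
        rfl
      rw [hk] at h'
      simp only [map_sub, map_add, map_smul] at h'
      simp only [fVec, wt_one, wt_two, e1, e2, zpow_one] at h1 h2 h3
      exact eq_zero_of_lin (mul_ne_zero (n_three K) (n_eight K)) (lam1_relation hs h1 h2 h3 h')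
    case c1 =>
      have h1 := r1 .b1 .c2
      have h2 := r2 .b2 .c3
      have h3 := r1 .b3 .b0
      have h4 := r1 .b0 .b3
      have h5 := r2 .c3 .b2
      have h6 := r1 .c2 .b1
      have h' := hu (.triv 1)
      have hk : hwVec F (.triv 1) = v .b1 ⊗ₜ v .c1 + q ^ 10 • v .c1 ⊗ₜ v .b1
          - q ^ 1 • v .b2 ⊗ₜ v .c2 - q ^ 9 • v .c2 ⊗ₜ v .b2
          + q ^ 4 • v .b3 ⊗ₜ v .c3 + q ^ 6 • v .c3 ⊗ₜ v .b3
          - (q ^ 4 / s) • v .b0 ⊗ₜ v .b0 := by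
        simp only [← algebraMap_smul F (_ : K) (_ : W F), map_pow, map_div₀, hm, map_q, pow_one]
        rfl
      rw [hk] at h'
      simp only [map_sub, map_add, map_smul] at h'
      simp only [fVec, wt_one, wt_two, e1, e2, zpow_one, hsl, hsr, ← hsdef, zpow_zero,
        one_smul] at h1 h2 h3 h4 h5 h6
      exact eq_zero_of_lin (mul_ne_zero (n_seven K) (n_twelve K))
        (triv_relation hs0 h1 h2 h3 h4 h5 h6 h')
  -- every other row is obtained from the preceding one
  have row' : ∀ {a c : Idx} (i : Fin 3), i ≠ 0 → (fVec i a : Idx → F) = v c →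
      (∀ b, φ (v a ⊗ₜ v b) = 0) → ∀ b, φ (v c ⊗ₜ v b) = 0 := by
    intro a c i hi hac ha b
    have h := r i hi a b
    rw [hac] at h
    rw [h, neg_eq_zero]
    refine smul_eq_zero_of_right _ ?_
    fin_cases i
    · exact absurd rfl hi
    all_goals cases b <;> simp [fVec, ha]
  have row2 := row' (a := .b1) (c := .b2) 1 (by decide) rfl row
  have row3 := row' (a := .b2) (c := .b3) 2 (by decide) rfl row2
  have row4 := row' (a := .b3) (c := .b0) 1 (by decide) rfl row3
  have row5 : ∀ b, φ (v .c3 ⊗ₜ v b) = 0 := by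
    intro b
    have h := r1 .b0 b
    simp only [fVec, hsl, ← hsdef] at h
    refine eq_zero_of_lin hs0 (h.trans ?_)
    rw [neg_eq_zero]
    refine smul_eq_zero_of_right _ ?_
    cases b <;> simp [row4]
  have row6 := row' (a := .c3) (c := .c2) 2 (by decide) rfl row5
  have row7 := row' (a := .c2) (c := .c1) 1 (by decide) rfl row6
  have row8 : ∀ b, φ (v .phi ⊗ₜ v b) = 0 := by
    intro b
    have h : ∀ i : Fin 3, i ≠ 0 → ∀ b, φ (v .phi ⊗ₜ fVec i b) = 0 := by
      intro i hi b
      have h := r i hi .phi b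
      fin_cases i
      · exact absurd rfl hi
      all_goals
        simp only [fVec, TensorProduct.zero_tmul, map_zero, wt, Fin.mk_one, Fin.reduceFinMk] at h
        refine eq_zero_of_lin ?_ (neg_eq_zero.1 h.symm)
        exact zpow_ne_zero _ (qi_ne_zero _)
    cases b
    case b1 => exact hu (.lam1 1)
    case phi => exact hu (.triv 0)
    case b2 => exact h 1 (by decide) .b1
    case b3 => exact h 2 (by decide) .b2
    case b0 => exact h 1 (by decide) .b3
    case c2 => exact h 2 (by decide) .c3
    case c1 => exact h 1 (by decide) .c2
    case c3 =>
      have h := h 1 (by decide) .b0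
      simp only [fVec, hsr, ← hsdef] at h
      exact eq_zero_of_lin hs0 h
  cases a
  exacts [row b, row2 b, row3 b, row4 b, row5 b, row6 b, row7 b, row8 b]

/-- The principal grading on the basis of `V^1`. -/
def height : Idx → ℕ
  | .b1 => 6
  | .b2 => 5
  | .b3 => 4
  | .b0 => 3
  | .c3 => 2
  | .c2 => 1
  | .c1 => 0
  | .phi => 3

variable (F) in
/-- The `K`-span of the basis vectors of `V^1 ⊗ V^1` of height at most `12 - n`. -/
noncomputable def lowSpan (n : ℕ) : Submodule K (W F) :=
  Submodule.span K {w | ∃ a b, height a + height b + n ≤ 12 ∧ w = v a ⊗ₜ v b}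

theorem v_mem_lowSpan {n : ℕ} {a b : Idx} (h : height a + height b + n ≤ 12) :
    (v a ⊗ₜ v b : W F) ∈ lowSpan F n := Submodule.subset_span ⟨a, b, h, rfl⟩

theorem f_mem_lowSpan {i : Fin 3} (hi : i ≠ 0) {n : ℕ} {w : W F} (hw : w ∈ lowSpan F n) :
    tensorRep 1 1 (gen (.f i)) w ∈ lowSpan F (n + 1) := by
  induction hw using Submodule.span_induction with
  | zero => rw [map_zero]; exact zero_mem _
  | add a b _ _ ha hb => rw [map_add]; exact add_mem ha hb
  | smul c a _ ha => rw [LinearMap.map_smul_of_tower]; exact Submodule.smul_mem _ _ ha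
  | mem w hw =>
    obtain ⟨a, b, h, rfl⟩ := hw
    rw [tensorRep_f_K hi]
    refine add_mem ?_ (Submodule.smul_mem _ _ ?_)
    · fin_cases i
      · exact absurd rfl hi
      all_goals
        cases a <;> simp only [fVec, TensorProduct.zero_tmul, zero_mem, ← TensorProduct.smul_tmul',
          Fin.mk_one, Fin.reduceFinMk] <;>
        try refine Submodule.smul_mem _ _ ?_
        all_goals
          refine v_mem_lowSpan ?_
          simp only [height] at h ⊢
          omega
    · fin_cases i
      · exact absurd rfl hi
      all_goals
        cases b <;> simp only [fVec, TensorProduct.tmul_zero, zero_mem, TensorProduct.tmul_smul,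
          Fin.mk_one, Fin.reduceFinMk] <;>
        try refine Submodule.smul_mem _ _ ?_
        all_goals
          refine v_mem_lowSpan ?_
          simp only [height] at h ⊢
          omega

/-- A `K`-subspace that is stable under `f_1`, `f_2` and contains the highest weight vectors
contains the standard basis. By `eq_zero_of_kills` the span `T` of the basis lies in
`S + f_1 T + f_2 T`, and the `f_i` are nilpotent on `T`. -/
theorem v_mem_of_stable (S : Submodule K (W F))
    (hf : ∀ i : Fin 3, i ≠ 0 → ∀ w ∈ S, tensorRep 1 1 (gen (.f i)) w ∈ S)
    (hu : ∀ k, hwVec F k ∈ S) (a b : Idx) : v a ⊗ₜ v b ∈ S := by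
  have key : ∀ n, ∀ a b, (v a ⊗ₜ v b : W F) ∈ S ⊔ lowSpan F n := by
    intro n
    induction n with
    | zero =>
      intro a b
      refine Submodule.mem_sup_right (v_mem_lowSpan ?_)
      cases a <;> cases b <;> decide
    | succ n ih =>
      intro a b
      have h := eq_zero_of_kills (S ⊔ lowSpan F (n + 1)).mkQ ?_ ?_ a b
      · rwa [Submodule.mkQ_apply, Submodule.Quotient.mk_eq_zero] at h
      · intro i hi a b
        rw [Submodule.mkQ_apply, Submodule.Quotient.mk_eq_zero]
        obtain ⟨s, hs, t, ht, hst⟩ := Submodule.mem_sup.1 (ih a b)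
        rw [← hst, map_add]
        exact Submodule.add_mem_sup (hf i hi s hs) (f_mem_lowSpan hi ht)
      · intro k
        rw [Submodule.mkQ_apply, Submodule.Quotient.mk_eq_zero]
        exact Submodule.mem_sup_left (hu k)
  have h13 : lowSpan F 13 = ⊥ := by
    rw [lowSpan, Submodule.span_eq_bot]
    rintro w ⟨a, b, h, -⟩
    omega
  have := key 13 a b
  rwa [h13, sup_bot_eq] at this

omit [Algebra K F] in
theorem eq_top_of_v_mem {S : Submodule F (W F)} (h : ∀ a b, v a ⊗ₜ v b ∈ S) : S = ⊤ := by
  refine top_unique ?_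
  rw [← ((Pi.basisFun F Idx).tensorProduct (Pi.basisFun F Idx)).span_eq, Submodule.span_le]
  rintro _ ⟨⟨a, b⟩, rfl⟩
  simpa [v] using h a b

/-- A subspace that is stable under `f_1`, `f_2` and contains the highest weight vectors is
everything. -/
theorem eq_top_of_stable (S : Submodule F (W F))
    (hf : ∀ i : Fin 3, i ≠ 0 → ∀ w ∈ S, tensorRep 1 1 (gen (.f i)) w ∈ S)
    (hu : ∀ k, hwVec F k ∈ S) : S = ⊤ :=
  eq_top_of_v_mem fun a b => v_mem_of_stable (S.restrictScalars K) hf hu a b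

/-! ### The contravariant form -/

variable (F) in
/-- The squared norms of the vectors of the orthogonal basis of `V^1`. -/
noncomputable def nrm : Idx → F
  | .b0 => qF F ^ 2 + 1
  | .phi => (qF F ^ 4 + qF F ^ 2 + 1) / (qF F ^ 2 + 1)
  | _ => 1

theorem nrm_ne_zero (a : Idx) : nrm F a ≠ 0 := by
  have h2 := n_two F
  have h3 := n_three F
  cases a <;> simp [nrm, h2, h3]

variable (F) in
/-- The symmetric form on `V^1` for which the standard basis is orthogonal and `e_i` is adjoint to
`q_i^{-1} t_i^{-1} f_i`. -/
noncomputable def formV : LinearMap.BilinForm F (Idx → F) :=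
  Matrix.toBilin' (Matrix.diagonal (nrm F))

theorem formV_v (a b : Idx) : formV F (v a) (v b) = if a = b then nrm F a else 0 := by
  rw [formV, v, v, Matrix.toBilin'_single, Matrix.diagonal_apply]

variable (F) in
/-- The form on `V^1 ⊗ V^1` induced from the one on `V^1`. -/
noncomputable def formW : LinearMap.BilinForm F (W F) :=
  LinearMap.BilinForm.tmul (formV F) (formV F)

theorem formW_tmul (a b c d : Idx → F) :
    formW F (a ⊗ₜ b) (c ⊗ₜ d) = formV F a c * formV F b d := by
  rw [formW, LinearMap.BilinForm.tensorDistrib_tmul, smul_eq_mul, mul_comm]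

theorem formW_v (a b c d : Idx) : formW F (v a ⊗ₜ v b) (v c ⊗ₜ v d) =
    (if a = c then nrm F a else 0) * (if b = d then nrm F b else 0) := by
  rw [formW_tmul, formV_v, formV_v]

theorem formW_symm (w w' : W F) : formW F w w' = formW F w' w := by
  have h : formW F = LinearMap.flip (formW F) := by
    refine W_ext fun a b => W_ext fun c d => ?_
    rw [LinearMap.flip_apply, formW_v, formW_v]
    congr 1
    · by_cases h : a = c
      · subst h; rfl
      · rw [if_neg h, if_neg (Ne.symm h)]
    · by_cases h : b = d
      · subst h; rfl
      · rw [if_neg h, if_neg (Ne.symm h)]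
  exact LinearMap.congr_fun₂ h w w'

theorem formW_nondegenerate {w : W F} (h : ∀ a b, formW F w (v a ⊗ₜ v b) = 0) : w = 0 := by
  set B := (Pi.basisFun F Idx).tensorProduct (Pi.basisFun F Idx)
  refine B.ext_elem fun ⟨a, b⟩ => ?_
  have key : LinearMap.flip (formW F) (v a ⊗ₜ v b) = (nrm F a * nrm F b) • B.coord (a, b) := by
    refine W_ext fun c d => ?_
    have hB : B.repr (v c ⊗ₜ v d) (a, b) = (if c = a then 1 else 0) * (if d = b then 1 else 0) := by
      simp only [B, v, Module.Basis.tensorProduct_repr_tmul_apply, Pi.basisFun_repr, smul_eq_mul,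
        Pi.single_apply, mul_comm, eq_comm]
    rw [LinearMap.flip_apply, formW_v, LinearMap.smul_apply, Module.Basis.coord_apply, hB]
    by_cases h1 : c = a <;> by_cases h2 : d = b <;> simp [h1, h2]
  have h' := LinearMap.congr_fun key w
  rw [LinearMap.flip_apply, h, LinearMap.smul_apply, smul_eq_mul, Module.Basis.coord_apply] at h'
  rw [map_zero, Finsupp.zero_apply]
  exact (mul_eq_zero.1 h'.symm).resolve_left (mul_ne_zero (nrm_ne_zero a) (nrm_ne_zero b))

theorem formV_eVec (i : Fin 3) (a c : Idx) : formV F (eVec i a) (v c) =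
    (qiF F i)⁻¹ * qiF F i ^ (-wt a i) * formV F (v a) (fVec i c) := by
  have hq := qF_ne_zero (F := F)
  have h2 := n_two F
  have h3 := n_three F
  fin_cases i <;> cases a <;>
    simp only [Fin.zero_eta, Fin.mk_one, Fin.reduceFinMk, eVec_zero, eVec_one, eVec_two, map_zero,
      LinearMap.zero_apply, map_add, map_smul, LinearMap.add_apply, LinearMap.smul_apply] <;>
    cases c <;>
    simp [fVec_zero, fVec_one, fVec_two, formV_v, nrm, qiF_eval, wt_zero, wt_one, wt_two] <;>
    field_simp

/-- Adjointness for the form can be checked on the standard basis. -/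
theorem formW_adjoint {A A' : Module.End F (W F)}
    (h : ∀ a b c d, formW F (A (v a ⊗ₜ v b)) (v c ⊗ₜ v d) = formW F (v a ⊗ₜ v b) (A' (v c ⊗ₜ v d)))
    (w w' : W F) : formW F (A w) w' = formW F w (A' w') := by
  have key : LinearMap.flip (formW F ∘ₗ A) = LinearMap.flip (formW F) ∘ₗ A' :=
    W_ext fun c d => W_ext fun a b => h a b c d
  exact LinearMap.congr_fun₂ key w' w

theorem formW_t (x y x' y' : Fˣ) (i : Fin 3) (w w' : W F) :
    formW F (tensorRep x y (gen (.t i)) w) w' = formW F w (tensorRep x' y' (gen (.t i)) w') := by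
  refine formW_adjoint (fun a b c d => ?_) w w'
  rw [tensorRep_t_v, tensorRep_t_v, map_smul, map_smul, LinearMap.smul_apply, formW_v]
  by_cases h1 : a = c <;> by_cases h2 : b = d <;> simp [h1, h2]

theorem formW_tinv (x y x' y' : Fˣ) (i : Fin 3) (w w' : W F) :
    formW F (tensorRep x y (gen (.tinv i)) w) w' =
      formW F w (tensorRep x' y' (gen (.tinv i)) w') := by
  refine formW_adjoint (fun a b c d => ?_) w w'
  rw [tensorRep_tinv_v, tensorRep_tinv_v, map_smul, map_smul, LinearMap.smul_apply, formW_v]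
  by_cases h1 : a = c <;> by_cases h2 : b = d <;> simp [h1, h2]

theorem formW_e (x y : Fˣ) (i : Fin 3) (w w' : W F) :
    formW F (tensorRep x y (gen (.e i)) w) w' = (qiF F i)⁻¹ * formW F w
      (tensorRep x⁻¹ y⁻¹ (gen (.tinv i)) (tensorRep x⁻¹ y⁻¹ (gen (.f i)) w')) := by
  have hx : (twist x⁻¹ i)⁻¹ = twist x i := by unfold twist; split_ifs <;> simp
  have hy : (twist y⁻¹ i)⁻¹ = twist y i := by unfold twist; split_ifs <;> simp
  have hq := qiF_ne_zero (F := F) i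
  refine (formW_adjoint (A' := (qiF F i)⁻¹ • (tensorRep x⁻¹ y⁻¹ (gen (.tinv i)) *
    tensorRep x⁻¹ y⁻¹ (gen (.f i)))) (fun a b c d => ?_) w w').trans ?_
  · rw [LinearMap.smul_apply, Module.End.mul_apply, map_smul, ← formW_tinv x y, tensorRep_tinv_v]
    simp only [tensorRep_e_v, tensorRep_f_v, map_smul, map_add, LinearMap.add_apply,
      LinearMap.smul_apply, formW_tmul, smul_eq_mul, formV_eVec, hx, hy, neg_add, zpow_add₀ hq]
    by_cases h1 : a = c
    · subst h1
      have : qiF F i ^ (-wt a i) * qiF F i ^ wt a i = 1 := by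
        rw [← zpow_add₀ hq, neg_add_cancel, zpow_zero]
      linear_combination (-(qiF F i)⁻¹ * qiF F i ^ (-wt b i) * twist y i * formV F (v a) (v a) *
        formV F (v b) (fVec i d)) * this
    · rw [formV_v a c, if_neg h1]; ring
  · rw [LinearMap.smul_apply, Module.End.mul_apply, map_smul, smul_eq_mul]

theorem formW_f (x y : Fˣ) (i : Fin 3) (w w' : W F) :
    formW F (tensorRep x y (gen (.f i)) w) w' = qiF F i * formW F w
      (tensorRep x⁻¹ y⁻¹ (gen (.e i)) (tensorRep x⁻¹ y⁻¹ (gen (.t i)) w')) := by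
  have hq := qiF_ne_zero (F := F) i
  have h := formW_e x⁻¹ y⁻¹ i (tensorRep x⁻¹ y⁻¹ (gen (.t i)) w') w
  have h1 : ∀ w, tensorRep x y (gen (.t i)) (tensorRep x y (gen (.tinv i)) w) = w := by
    intro w
    rw [← Module.End.mul_apply, ← map_mul, gen_relations.t_tinv, map_one, Module.End.one_apply]
  rw [inv_inv, inv_inv, formW_t _ _ x y, h1] at h
  rw [formW_symm w, h, formW_symm w', mul_inv_cancel_left₀ hq]

/-! ### Stable subspaces and highest weight vectors -/

/-- A subspace of `V^1 ⊗ V^1` that is stable under `U_q(G_2)`. -/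
def IsStable (N : Submodule F (W F)) : Prop :=
  ∀ g ∈ UG2, ∀ w ∈ N, tensorRep 1 1 g w ∈ N

theorem isStable_of_gen {N : Submodule F (W F)}
    (he : ∀ i : Fin 3, i ≠ 0 → ∀ w ∈ N, tensorRep 1 1 (gen (.e i)) w ∈ N)
    (hf : ∀ i : Fin 3, i ≠ 0 → ∀ w ∈ N, tensorRep 1 1 (gen (.f i)) w ∈ N)
    (ht : ∀ i : Fin 3, i ≠ 0 → ∀ w ∈ N, tensorRep 1 1 (gen (.t i)) w ∈ N)
    (ht' : ∀ i : Fin 3, i ≠ 0 → ∀ w ∈ N, tensorRep 1 1 (gen (.tinv i)) w ∈ N) : IsStable N := by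
  intro g hg
  induction hg using Algebra.adjoin_induction with
  | mem g hg =>
    obtain ⟨i, hi, rfl | rfl | rfl | rfl⟩ := hg
    exacts [he i hi, hf i hi, ht i hi, ht' i hi]
  | algebraMap r =>
    intro w hw
    rw [AlgHom.commutes, Module.algebraMap_end_apply, ← algebraMap_smul F r w]
    exact N.smul_mem _ hw
  | add g h _ _ hg hh => intro w hw; rw [map_add]; exact N.add_mem (hg w hw) (hh w hw)
  | mul g h _ _ hg hh => intro w hw; rw [map_mul]; exact hg _ (hh w hw)

/-- The orthogonal complement for the contravariant form. -/
noncomputable def perp (N : Submodule F (W F)) : Submodule F (W F) where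
  carrier := {w | ∀ n ∈ N, formW F w n = 0}
  add_mem' ha hb n hn := by rw [map_add, LinearMap.add_apply, ha n hn, hb n hn, add_zero]
  zero_mem' n _ := by simp
  smul_mem' c a ha n hn := by rw [map_smul, LinearMap.smul_apply, ha n hn, smul_zero]

theorem IsStable.perp {N : Submodule F (W F)} (hN : IsStable N) : IsStable (perp N) := by
  refine isStable_of_gen ?_ ?_ ?_ ?_ <;> intro i hi w hw n hn <;>
    obtain ⟨m1, m2, m3, m4⟩ := gen_mem_UG2 hi
  · rw [formW_e, inv_one, hw _ (hN _ m4 _ (hN _ m2 _ hn)), mul_zero]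
  · rw [formW_f, inv_one, hw _ (hN _ m1 _ (hN _ m3 _ hn)), mul_zero]
  · rw [formW_t _ _ 1 1, hw _ (hN _ m3 _ hn)]
  · have h1 : n = tensorRep 1 1 (gen (.t i)) (tensorRep 1 1 (gen (.tinv i)) n) := by
      rw [← Module.End.mul_apply, ← map_mul, gen_relations.t_tinv, map_one, Module.End.one_apply]
    rw [h1, ← formW_t 1 1, ← Module.End.mul_apply, ← map_mul, gen_relations.t_tinv, map_one,
      Module.End.one_apply]
    exact hw _ (hN _ m4 _ hn)

/-- `e_1` and `e_2` kill `w`. -/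
def IsHighest (w : W F) : Prop := ∀ i : Fin 3, i ≠ 0 → tensorRep 1 1 (gen (.e i)) w = 0

theorem IsHighest.e_t {w : W F} (hw : IsHighest w) {i : Fin 3} (hi : i ≠ 0) :
    tensorRep 1 1 (gen (.e i)) (tensorRep 1 1 (gen (.t i)) w) = 0 := by
  have h := congrArg (fun g => tensorRep 1 1 g w) (t_e i i)
  simp only [map_mul, map_smul, Module.End.mul_apply, hw i hi, map_zero, LinearMap.smul_apply,
    qi_zpow_smul (F := F)] at h
  exact (smul_eq_zero.1 h.symm).resolve_left (zpow_ne_zero _ (qiF_ne_zero i))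

/-- Highest weight vectors are orthogonal to the images of `f_1` and `f_2`. -/
theorem IsHighest.formW_f {w : W F} (hw : IsHighest w) {i : Fin 3} (hi : i ≠ 0) (w' : W F) :
    formW F w (tensorRep 1 1 (gen (.f i)) w') = 0 := by
  rw [formW_symm, D43.formW_f, inv_one, hw.e_t hi, map_zero, mul_zero]

/-- A nonzero stable subspace contains a nonzero highest weight vector, since the `e_i` are
nilpotent. -/
theorem IsStable.exists_isHighest {N : Submodule F (W F)} (hN : IsStable N) (h0 : N ≠ ⊥) :
    ∃ w ∈ N, w ≠ 0 ∧ IsHighest w := by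
  obtain ⟨w, hw, hw0⟩ := N.ne_bot_iff.1 h0
  have key : ∀ n, ∀ w ∈ N, w ≠ 0 → (∀ p ∈ lowSpan F n, formW F w p = 0) →
      ∃ w ∈ N, w ≠ 0 ∧ IsHighest w := by
    intro n
    induction n with
    | zero =>
      intro w _ hw0 h
      refine absurd (formW_nondegenerate fun a b => h _ (v_mem_lowSpan ?_)) hw0
      cases a <;> cases b <;> decide
    | succ n ih =>
      intro w hw hw0 h
      by_cases hh : IsHighest w
      · exact ⟨w, hw, hw0, hh⟩
      · unfold IsHighest at hh
        push Not at hh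
        obtain ⟨i, hi, hh⟩ := hh
        refine ih _ (hN _ (gen_mem_UG2 hi).1 w hw) hh fun p hp => ?_
        induction hp using Submodule.span_induction with
        | zero => rw [map_zero]
        | add a b _ _ ha hb => rw [map_add, ha, hb, add_zero]
        | smul c a _ ha => rw [LinearMap.map_smul_of_tower, ha, smul_zero]
        | mem p hp =>
          obtain ⟨a, b, hab, rfl⟩ := hp
          have h2 := h _ (f_mem_lowSpan hi (v_mem_lowSpan hab))
          have h3 := D43.formW_f 1 1 i (v a ⊗ₜ v b) w
          rw [formW_symm, h2, inv_one] at h3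
          have h4 := congrArg (fun g => tensorRep 1 1 g w) (t_e i i)
          simp only [map_mul, map_smul, Module.End.mul_apply, LinearMap.smul_apply] at h4
          have h5 := (mul_eq_zero.1 h3.symm).resolve_left (qiF_ne_zero i)
          have h6 : formW F (v a ⊗ₜ v b)
              (tensorRep 1 1 (gen (.t i)) (tensorRep 1 1 (gen (.e i)) w)) = 0 := by
            rw [h4, LinearMap.map_smul_of_tower, h5, smul_zero]
          rw [← formW_t 1 1, tensorRep_t_v, map_smul, LinearMap.smul_apply, smul_eq_mul] at h6
          rw [formW_symm]
          exact (mul_eq_zero.1 h6).resolve_left (zpow_ne_zero _ (qiF_ne_zero i))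
  refine key 13 w hw hw0 fun p hp => ?_
  have h13 : lowSpan F 13 = ⊥ := by
    rw [lowSpan, Submodule.span_eq_bot]
    rintro w ⟨a, b, h, -⟩
    omega
  rw [h13, Submodule.mem_bot] at hp
  rw [hp, map_zero]

variable (F) in
theorem hwVec_isHighest (k : Comp) : IsHighest (hwVec F k) := fun _ hi => hwVec_e k hi

/-- A functional that kills the images of `f_1`, `f_2` and the highest weight vectors `u_k` is
zero. -/
theorem functional_eq_zero {φ : W F →ₗ[F] F}
    (hf : ∀ i : Fin 3, i ≠ 0 → ∀ w, φ (tensorRep 1 1 (gen (.f i)) w) = 0)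
    (hu : ∀ k, φ (hwVec F k) = 0) : φ = 0 :=
  W_ext fun a b => eq_zero_of_kills (φ.restrictScalars K) (fun i hi _ _ => hf i hi _) hu a b

theorem IsHighest.eq_zero {w : W F} (hw : IsHighest w) (h : ∀ k, formW F w (hwVec F k) = 0) :
    w = 0 :=
  formW_nondegenerate fun a b => by
    rw [functional_eq_zero (φ := formW F w) (fun i hi w' => hw.formW_f hi w') h,
      LinearMap.zero_apply]

variable (F) in
/-- The squared norms of the highest weight vectors `u_k`. -/
noncomputable def hwNrm : Comp → F
  | .twoLam1 => 1
  | .lam2 => qF F ^ 2 + 1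
  | .lam1 0 => (qF F ^ 4 + qF F ^ 2 + 1) / (qF F ^ 2 + 1)
  | .lam1 1 => (qF F ^ 4 + qF F ^ 2 + 1) / (qF F ^ 2 + 1)
  | .lam1 2 => (qF F ^ 2 + 1) * (qF F ^ 4 + qF F ^ 2 + 1) * (qF F ^ 8 + 1)
  | .triv 0 => ((qF F ^ 4 + qF F ^ 2 + 1) / (qF F ^ 2 + 1)) ^ 2
  | .triv 1 => (qF F ^ 12 + qF F ^ 10 + qF F ^ 8 + qF F ^ 6 + qF F ^ 4 + qF F ^ 2 + 1) *
      (qF F ^ 8 - qF F ^ 4 + 1)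

theorem hwNrm_ne_zero (k : Comp) : hwNrm F k ≠ 0 := by
  have h2 := n_two F
  have h3 := n_three F
  have h8 := n_eight F
  have h7 := n_seven F
  have h12 := n_twelve F
  rcases k with _ | _ | i | i
  · simp [hwNrm]
  · simp [hwNrm, h2]
  all_goals fin_cases i <;> simp [hwNrm, h2, h3, h8, h7, h12]

theorem formW_hwVec (j k : Comp) :
    formW F (hwVec F j) (hwVec F k) = if j = k then hwNrm F k else 0 := by
  have h2 := n_two F
  rcases j with _ | _ | i | i <;> rcases k with _ | _ | l | l
  all_goals try fin_cases i
  all_goals try fin_cases l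
  all_goals
    simp [hwVec_eval, formW_v, nrm, hwNrm]
  all_goals try field_simp
  all_goals try ring

/-! ### The decomposition into irreducible components -/

variable (F) in
/-- The vector `f_{i_1} ⋯ f_{i_r} u_k`. -/
noncomputable def fWord (k : Comp) : List (Fin 3) → W F
  | [] => hwVec F k
  | i :: l => tensorRep 1 1 (gen (.f i)) (fWord k l)

variable (F) in
/-- The span of the vectors `f_{i_1} ⋯ f_{i_r} u_k` with `i_1, …, i_r ∈ {1, 2}`. -/
noncomputable def wordSpan (k : Comp) : Submodule F (W F) :=
  Submodule.span F {w | ∃ l : List (Fin 3), (∀ i ∈ l, i ≠ 0) ∧ w = fWord F k l}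

theorem f_mem_wordSpan {k : Comp} {i : Fin 3} (hi : i ≠ 0) {w : W F} (hw : w ∈ wordSpan F k) :
    tensorRep 1 1 (gen (.f i)) w ∈ wordSpan F k := by
  induction hw using Submodule.span_induction with
  | zero => rw [map_zero]; exact zero_mem _
  | add a b _ _ ha hb => rw [map_add]; exact add_mem ha hb
  | smul c a _ ha => rw [map_smul]; exact Submodule.smul_mem _ _ ha
  | mem w hw =>
    obtain ⟨l, hl, rfl⟩ := hw
    exact Submodule.subset_span ⟨i :: l, by simpa [hi] using hl, rfl⟩

theorem fWord_weight (k : Comp) (l : List (Fin 3)) (i : Fin 3) :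
    (∃ c : F, tensorRep 1 1 (gen (.t i)) (fWord F k l) = c • fWord F k l) ∧
      ∃ c : F, tensorRep 1 1 (gen (.tinv i)) (fWord F k l) = c • fWord F k l := by
  induction l with
  | nil =>
    have hc := zpow_ne_zero (k.weight i) (qiF_ne_zero (F := F) i)
    refine ⟨⟨_, hwVec_t 1 1 k i⟩, (qiF F i ^ k.weight i)⁻¹, ?_⟩
    have h := congrArg (fun g => tensorRep 1 1 g (hwVec F k)) (gen_relations.tinv_t i)
    simp only [map_mul, map_one, Module.End.mul_apply, hwVec_t, map_smul,
      Module.End.one_apply] at h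
    rw [eq_inv_smul_iff₀ hc]
    exact h
  | cons j l ih =>
    obtain ⟨⟨c, hc⟩, ⟨d, hd⟩⟩ := ih
    constructor
    · refine ⟨qiF F i ^ (-cartan i j) * c, ?_⟩
      rw [fWord, ← Module.End.mul_apply, ← map_mul, t_f, map_smul, map_mul, LinearMap.smul_apply,
        Module.End.mul_apply, hc, map_smul, qi_zpow_smul (F := F), smul_smul]
    · refine ⟨qiF F i ^ (cartan i j) * d, ?_⟩
      rw [fWord, ← Module.End.mul_apply, ← map_mul, tinv_f, map_smul, map_mul,
        LinearMap.smul_apply, Module.End.mul_apply, hd, map_smul, qi_zpow_smul (F := F), smul_smul]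

theorem e_fWord_mem (k : Comp) (l : List (Fin 3)) (hl : ∀ i ∈ l, i ≠ 0) {i : Fin 3} (hi : i ≠ 0) :
    tensorRep 1 1 (gen (.e i)) (fWord F k l) ∈ wordSpan F k := by
  induction l with
  | nil => rw [fWord, hwVec_e k hi]; exact zero_mem _
  | cons j l ih =>
    have hl' : ∀ i ∈ l, i ≠ 0 := fun i hi => hl i (List.mem_cons_of_mem _ hi)
    have hw : fWord F k l ∈ wordSpan F k := Submodule.subset_span ⟨l, hl', rfl⟩
    have h := congrArg (fun g => tensorRep 1 1 g (fWord F k l)) (gen_relations.e_f i j)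
    simp only [map_sub, map_mul, LinearMap.sub_apply, Module.End.mul_apply] at h
    rw [fWord, sub_eq_iff_eq_add.1 h]
    refine add_mem ?_ (f_mem_wordSpan (hl j List.mem_cons_self) (ih hl'))
    obtain ⟨⟨c, hc⟩, ⟨d, hd⟩⟩ := fWord_weight (F := F) k l i
    split_ifs
    · rw [map_smul, map_sub, LinearMap.smul_apply, LinearMap.sub_apply, hc, hd,
        ← algebraMap_smul F (_ : K) (_ : W F)]
      exact Submodule.smul_mem _ _ (sub_mem (Submodule.smul_mem _ _ hw)
        (Submodule.smul_mem _ _ hw))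
    · rw [map_zero, LinearMap.zero_apply]; exact zero_mem _

theorem wordSpan_isStable (k : Comp) : IsStable (wordSpan F k) := by
  have key : ∀ g : U, (∀ l : List (Fin 3), (∀ i ∈ l, i ≠ 0) →
      tensorRep 1 1 g (fWord F k l) ∈ wordSpan F k) →
      ∀ w ∈ wordSpan F k, tensorRep 1 1 g w ∈ wordSpan F k := by
    intro g hg w hw
    induction hw using Submodule.span_induction with
    | zero => rw [map_zero]; exact zero_mem _
    | add a b _ _ ha hb => rw [map_add]; exact add_mem ha hb
    | smul c a _ ha => rw [map_smul]; exact Submodule.smul_mem _ _ ha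
    | mem w hw =>
      obtain ⟨l, hl, rfl⟩ := hw
      exact hg l hl
  refine isStable_of_gen (fun i hi => key _ fun l hl => e_fWord_mem k l hl hi)
    (fun i hi w hw => f_mem_wordSpan hi hw) (fun i hi => key _ fun l hl => ?_)
    (fun i hi => key _ fun l hl => ?_)
  · obtain ⟨c, hc⟩ := (fWord_weight (F := F) k l i).1
    rw [hc]
    exact Submodule.smul_mem _ _ (Submodule.subset_span ⟨l, hl, rfl⟩)
  · obtain ⟨c, hc⟩ := (fWord_weight (F := F) k l i).2
    rw [hc]
    exact Submodule.smul_mem _ _ (Submodule.subset_span ⟨l, hl, rfl⟩)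

theorem component_isStable (k : Comp) : IsStable (component F k) := component_stable k

theorem component_le_of_isStable {k : Comp} {S : Submodule F (W F)} (hS : IsStable S)
    (hu : hwVec F k ∈ S) : component F k ≤ S := by
  rw [component, Submodule.span_le]
  rintro _ ⟨g, hg, rfl⟩
  exact hS g hg _ hu

/-- Each component is generated by its highest weight vector under `f_1` and `f_2` alone. -/
theorem component_le {k : Comp} {S : Submodule F (W F)}
    (hf : ∀ i : Fin 3, i ≠ 0 → ∀ w ∈ S, tensorRep 1 1 (gen (.f i)) w ∈ S) (hu : hwVec F k ∈ S) :
    component F k ≤ S := by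
  have h : hwVec F k ∈ wordSpan F k := Submodule.subset_span ⟨[], by simp, rfl⟩
  refine (component_le_of_isStable (wordSpan_isStable k) h).trans ?_
  rw [wordSpan, Submodule.span_le]
  rintro _ ⟨l, hl, rfl⟩
  induction l with
  | nil => exact hu
  | cons i l ih =>
    exact hf i (hl i List.mem_cons_self) _ (ih fun i hi => hl i (List.mem_cons_of_mem _ hi))

theorem IsHighest.formW_component {h : W F} (hh : IsHighest h) {k : Comp}
    (hk : formW F h (hwVec F k) = 0) {w : W F} (hw : w ∈ component F k) : formW F h w = 0 := by
  have : component F k ≤ LinearMap.ker (formW F h) :=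
    component_le (fun i hi w _ => hh.formW_f hi w) hk
  exact this hw

theorem component_le_perp {j k : Comp} (hjk : j ≠ k) : component F j ≤ perp (component F k) :=
  component_le_of_isStable (component_isStable k).perp fun w hw =>
    (hwVec_isHighest F j).formW_component (by rw [formW_hwVec, if_neg hjk]) hw

theorem iSup_component : ⨆ k, component F k = ⊤ := by
  refine eq_top_of_stable _ (fun i hi w hw => ?_) fun k =>
    Submodule.mem_iSup_of_mem k (hwVec_mem k)
  induction hw using Submodule.iSup_induction' with
  | mem k w hw =>
    exact Submodule.mem_iSup_of_mem k (component_stable k _ (gen_mem_UG2 hi).2.1 w hw)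
  | zero => rw [map_zero]; exact zero_mem _
  | add a b _ _ ha hb => rw [map_add]; exact add_mem ha hb

theorem component_disjoint_perp (k : Comp) :
    component F k ⊓ perp (component F k) = ⊥ := by
  by_contra h
  have hs : IsStable (component F k ⊓ perp (component F k)) := fun g hg w hw =>
    ⟨component_isStable k g hg w hw.1, (component_isStable k).perp g hg w hw.2⟩
  obtain ⟨w, ⟨hw, hw'⟩, hw0, hh⟩ := hs.exists_isHighest h
  refine hw0 (hh.eq_zero fun j => ?_)
  by_cases hjk : k = j
  · subst hjk; exact hw' _ (hwVec_mem k)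
  · exact component_le_perp hjk hw _ (hwVec_mem j)

variable (F) in
theorem component_isInternal : DirectSum.IsInternal (component F) := by
  rw [DirectSum.isInternal_submodule_iff_iSupIndep_and_iSup_eq_top]
  refine ⟨fun k => ?_, iSup_component⟩
  rw [disjoint_iff, eq_bot_iff, ← component_disjoint_perp k]
  refine inf_le_inf_left _ (iSup₂_le fun j hj => component_le_perp hj)

theorem component_isIrredHighestWeight (k : Comp) :
    IsIrredHighestWeight (component F k) (hwVec F k) k.weight where
  mem := hwVec_mem k
  ne_zero h := hwNrm_ne_zero (F := F) k (by
    have := formW_hwVec (F := F) k k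
    rw [if_pos rfl, h, map_zero] at this
    exact this.symm)
  e_eq_zero i hi := hwVec_e k hi
  t_eq i _ := hwVec_t 1 1 k i
  stable := component_stable k
  irreducible N hN hs := by
    rw [or_iff_not_imp_left]
    intro h0
    obtain ⟨h, hhN, hh0, hh⟩ := IsStable.exists_isHighest hs h0
    set c := formW F h (hwVec F k) / hwNrm F k with hc
    have hu : h - c • hwVec F k = 0 := by
      refine IsHighest.eq_zero (fun i hi => ?_) fun j => ?_
      · rw [map_sub, map_smul, hh i hi, hwVec_e k hi, smul_zero, sub_zero]
      · rw [map_sub, map_smul, LinearMap.sub_apply, LinearMap.smul_apply, formW_hwVec]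
        by_cases hjk : k = j
        · subst hjk
          rw [if_pos rfl, smul_eq_mul, hc, div_mul_cancel₀ _ (hwNrm_ne_zero k), sub_self]
        · rw [if_neg hjk, smul_zero, sub_zero]
          exact component_le_perp hjk (hN hhN) _ (hwVec_mem j)
    rw [sub_eq_zero] at hu
    have hc0 : c ≠ 0 := by rintro h; rw [h, zero_smul] at hu; exact hh0 hu
    refine le_antisymm hN (component_le_of_isStable hs ?_)
    rw [hu] at hhN
    exact (N.smul_mem_iff hc0).1 hhN

/-! ### Isomorphisms between components, and projections -/

/-- The `U_q(G_2)`-linear map from `V^1` onto a component of highest weight `\barΛ_1` or `0` that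
sends `v_1`, respectively `v_φ`, to the highest weight vector, on the standard basis. (It is zero
for the remaining two components.) -/
noncomputable def copyVec : Comp → Idx → W F
  | .lam1 _, .phi => 0
  | .lam1 0, a => v a ⊗ₜ v .phi
  | .lam1 1, a => v .phi ⊗ₜ v a
  | .lam1 2, .b1 => v .b1 ⊗ₜ v .b0 - qF F ^ 6 • v .b0 ⊗ₜ v .b1
      - (qF F * (qF F ^ 2 + 1)) • v .b2 ⊗ₜ v .b3 + (qF F ^ 4 * (qF F ^ 2 + 1)) • v .b3 ⊗ₜ v .b2
  | .lam1 2, .b2 => (qF F ^ 2 + 1) • v .b1 ⊗ₜ v .c3 - (qF F ^ 5 * (qF F ^ 2 + 1)) • v .c3 ⊗ₜ v .b1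
      - qF F ^ 2 • v .b2 ⊗ₜ v .b0 + qF F ^ 4 • v .b0 ⊗ₜ v .b2
  | .lam1 2, .b3 => (qF F ^ 2 + 1) • v .b1 ⊗ₜ v .c2 - (qF F ^ 5 * (qF F ^ 2 + 1)) • v .c2 ⊗ₜ v .b1
      - qF F ^ 2 • v .b3 ⊗ₜ v .b0 + qF F ^ 4 • v .b0 ⊗ₜ v .b3
  | .lam1 2, .b0 => (qF F ^ 2 * (qF F ^ 2 - 1)) • v .b0 ⊗ₜ v .b0
      - (qF F ^ 3 * (qF F ^ 2 + 1)) • v .b3 ⊗ₜ v .c3 + (qF F ^ 3 * (qF F ^ 2 + 1)) • v .c3 ⊗ₜ v .b3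
      + (qF F ^ 2 + 1) • v .b2 ⊗ₜ v .c2 - (qF F ^ 6 * (qF F ^ 2 + 1)) • v .c2 ⊗ₜ v .b2
      + (qF F * (qF F ^ 2 + 1)) • v .b1 ⊗ₜ v .c1 - (qF F ^ 5 * (qF F ^ 2 + 1)) • v .c1 ⊗ₜ v .b1
  | .lam1 2, .c3 => qF F ^ 4 • v .c3 ⊗ₜ v .b0 - qF F ^ 2 • v .b0 ⊗ₜ v .c3
      + (qF F ^ 2 + 1) • v .b2 ⊗ₜ v .c1 - (qF F ^ 5 * (qF F ^ 2 + 1)) • v .c1 ⊗ₜ v .b2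
  | .lam1 2, .c2 => qF F ^ 4 • v .c2 ⊗ₜ v .b0 - qF F ^ 2 • v .b0 ⊗ₜ v .c2
      + (qF F ^ 2 + 1) • v .b3 ⊗ₜ v .c1 - (qF F ^ 5 * (qF F ^ 2 + 1)) • v .c1 ⊗ₜ v .b3
  | .lam1 2, .c1 => v .b0 ⊗ₜ v .c1 - qF F ^ 6 • v .c1 ⊗ₜ v .b0
      - (qF F * (qF F ^ 2 + 1)) • v .c3 ⊗ₜ v .c2 + (qF F ^ 4 * (qF F ^ 2 + 1)) • v .c2 ⊗ₜ v .c3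
  | .triv i, .phi => hwVec F (.triv i)
  | _, _ => 0

variable (F) in
/-- The linear map with values `copyVec` on the standard basis. -/
noncomputable def copyMap (k : Comp) : (Idx → F) →ₗ[F] W F :=
  (Pi.basisFun F Idx).constr F (copyVec k)

theorem copyMap_v (k : Comp) (a : Idx) : copyMap F k (v a) = copyVec k a := by
  rw [copyMap, v, ← Pi.basisFun_apply, Module.Basis.constr_basis]

/-- The vector of `V^1` sent to the highest weight vector by `copyMap`. -/
def copyTop : Comp → Idx
  | .lam1 _ => .b1
  | _ => .phi

/-- The components of highest weight `\barΛ_1` and `0`. -/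
def IsCopy : Comp → Prop
  | .lam1 _ => True
  | .triv _ => True
  | _ => False

theorem copyMap_top {k : Comp} (hk : IsCopy k) : copyMap F k (v (copyTop k)) = hwVec F k := by
  rw [copyMap_v]
  rcases k with _ | _ | i | i
  · exact hk.elim
  · exact hk.elim
  · fin_cases i
    · rfl
    · rfl
    · exact (hwVec_eval F).2.2.2.2.1.symm
  · rfl

theorem copyMap_triv (i : Fin 2) {a : Idx} (ha : a ≠ .phi) : copyMap F (.triv i) (v a) = 0 := by
  rw [copyMap_v]; cases a <;> first | rfl | exact absurd rfl ha

theorem triv_f (j : Fin 2) {i : Fin 3} (hi : i ≠ 0) :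
    tensorRep 1 1 (gen (.f i)) (hwVec F (.triv j)) = 0 := by
  have hq := qF_ne_zero (F := F)
  have h2 := n_two F
  fin_cases i
  · exact absurd rfl hi
  all_goals
    fin_cases j <;>
    simp [hwVec_eval, tensorRep_f_v, fVec_one, fVec_two, twist_eval, qiF_eval, wt_one, wt_two,
      TensorProduct.tmul_smul, ← TensorProduct.smul_tmul', smul_smul] <;>
    match_scalars <;> field_simp <;> ring

theorem copyMap_lam1_e (k : Fin 3) {i : Fin 3} (hi : i ≠ 0) (a : Idx) :
    tensorRep 1 1 (gen (.e i)) (copyVec (.lam1 k) a : W F) = copyMap F (.lam1 k) (eVec i a) := by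
  have hq := qF_ne_zero (F := F)
  have h2 := n_two F
  fin_cases i
  · exact absurd rfl hi
  all_goals
    fin_cases k <;> cases a <;>
    simp only [Fin.zero_eta, Fin.mk_one, Fin.reduceFinMk, copyVec, copyMap_v, tensorRep_e_v,
      eVec_one, eVec_two, twist_eval, qiF_eval, wt_one, wt_two, map_add, map_sub, map_smul,
      map_zero, smul_zero, one_smul, smul_smul, neg_zero, neg_neg, zpow_zero,
      TensorProduct.tmul_zero, TensorProduct.zero_tmul, TensorProduct.tmul_smul,
      ← TensorProduct.smul_tmul'] <;>
    match_scalars <;> field_simp <;> ring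

theorem copyMap_lam1_f (k : Fin 3) {i : Fin 3} (hi : i ≠ 0) (a : Idx) :
    tensorRep 1 1 (gen (.f i)) (copyVec (.lam1 k) a : W F) = copyMap F (.lam1 k) (fVec i a) := by
  have hq := qF_ne_zero (F := F)
  have h2 := n_two F
  fin_cases i
  · exact absurd rfl hi
  all_goals
    fin_cases k <;> cases a <;>
    simp only [Fin.zero_eta, Fin.mk_one, Fin.reduceFinMk, copyVec, copyMap_v, tensorRep_f_v,
      fVec_one, fVec_two, twist_eval, qiF_eval, wt_one, wt_two, map_add, map_sub, map_smul,
      map_zero, smul_zero, smul_smul, zpow_zero,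
      TensorProduct.tmul_zero, TensorProduct.zero_tmul, TensorProduct.tmul_smul,
      ← TensorProduct.smul_tmul'] <;>
    match_scalars <;> field_simp <;> ring

theorem copyMap_lam1_t (k : Fin 3) (i : Fin 3) (a : Idx) :
    tensorRep 1 1 (gen (.t i)) (copyVec (.lam1 k) a : W F) =
      qiF F i ^ wt a i • copyVec (.lam1 k) a := by
  -- the weights occurring in `copyVec (.lam1 2) a` add up to the weight of `v_a`
  have e : ∀ i, wt .phi i = 0 ∧ wt .b0 i = 0 ∧ wt .b2 i + wt .b3 i = wt .b1 i ∧
      wt .b1 i + wt .c3 i = wt .b2 i ∧ wt .b1 i + wt .c2 i = wt .b3 i ∧ wt .b3 i + wt .c3 i = 0 ∧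
      wt .b2 i + wt .c2 i = 0 ∧ wt .b1 i + wt .c1 i = 0 ∧ wt .b2 i + wt .c1 i = wt .c3 i ∧
      wt .b3 i + wt .c1 i = wt .c2 i ∧ wt .c3 i + wt .c2 i = wt .c1 i := by decide
  have e' : ∀ i, wt .b3 i + wt .b2 i = wt .b1 i ∧
      wt .c3 i + wt .b1 i = wt .b2 i ∧ wt .c2 i + wt .b1 i = wt .b3 i ∧ wt .c3 i + wt .b3 i = 0 ∧
      wt .c2 i + wt .b2 i = 0 ∧ wt .c1 i + wt .b1 i = 0 ∧ wt .c1 i + wt .b2 i = wt .c3 i ∧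
      wt .c1 i + wt .b3 i = wt .c2 i ∧ wt .c2 i + wt .c3 i = wt .c1 i := by decide
  fin_cases k <;> cases a <;>
    simp only [Fin.zero_eta, Fin.mk_one, Fin.reduceFinMk, copyVec, tensorRep_t_v, map_add, map_sub,
      map_smul, map_zero, smul_zero, e, e', add_zero, zero_add, smul_add, smul_sub,
      smul_comm (qiF F i ^ (_ : ℤ))]

/-- `copyMap` is `U_q(G_2)`-linear. -/
theorem copyMap_linear {k : Comp} (hk : IsCopy k) {g : U} (hg : g ∈ UG2) (p : Idx → F) :
    tensorRep 1 1 g (copyMap F k p) = copyMap F k (evalRep 1 g p) := by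
  have hV : ∀ {φ ψ : (Idx → F) →ₗ[F] W F}, (∀ a, φ (v a) = ψ (v a)) → φ = ψ := fun h =>
    (Pi.basisFun F Idx).ext fun a => by simpa [v] using h a
  have ht : ∀ i a, tensorRep 1 1 (gen (.t i)) (copyMap F k (v a)) =
      qiF F i ^ wt a i • copyMap F k (v a) := by
    intro i a
    rw [copyMap_v]
    rcases k with _ | _ | j | j
    · exact hk.elim
    · exact hk.elim
    · exact copyMap_lam1_t j i a
    · by_cases ha : a = .phi
      · subst ha
        have hw : ∀ i, wt .phi i = 0 := by decide
        have hw' : ∀ (j : Fin 2) (i : Fin 3), (Comp.triv j).weight i = 0 := by decide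
        rw [copyVec, hwVec_t, hw, hw']
      · rw [← copyMap_v, copyMap_triv j ha, map_zero, smul_zero]
  have hfe : ∀ i : Fin 3, i ≠ 0 → ∀ a,
      tensorRep 1 1 (gen (.e i)) (copyVec k a : W F) = copyMap F k (eVec i a) ∧
      tensorRep 1 1 (gen (.f i)) (copyVec k a : W F) = copyMap F k (fVec i a) := by
    intro i hi a
    rcases k with _ | _ | j | j
    · exact hk.elim
    · exact hk.elim
    · exact ⟨copyMap_lam1_e j hi a, copyMap_lam1_f j hi a⟩
    · have h0 : ∀ b, b ≠ .phi → copyMap F (.triv j) (v b) = 0 := fun b hb => copyMap_triv j hb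
      have he : copyMap F (.triv j) (eVec i a) = 0 := by
        fin_cases i
        · exact absurd rfl hi
        all_goals cases a <;> simp [eVec_one, eVec_two, h0]
      have hf : copyMap F (.triv j) (fVec i a) = 0 := by
        fin_cases i
        · exact absurd rfl hi
        all_goals cases a <;> simp [fVec_one, fVec_two, h0]
      rw [he, hf]
      by_cases ha : a = .phi
      · subst ha
        exact ⟨hwVec_e _ hi, triv_f j hi⟩
      · rw [← copyMap_v, copyMap_triv j ha, map_zero, map_zero]; exact ⟨rfl, rfl⟩
  induction hg using Algebra.adjoin_induction generalizing p with
  | mem g hg =>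
    obtain ⟨i, hi, hg⟩ := hg
    have key : tensorRep 1 1 g ∘ₗ copyMap F k = copyMap F k ∘ₗ evalRep 1 g := by
      refine hV fun a => ?_
      simp only [LinearMap.comp_apply]
      obtain rfl | rfl | rfl | rfl := hg
      · simp [evalRep, evalGen_e, hi, (hfe i hi a).1, copyMap_v]
      · simp [evalRep, evalGen_f, hi, (hfe i hi a).2, copyMap_v]
      · rw [ht, evalRep, liftU_gen, evalGen_t, qi_zpow_smul (F := F), map_smul]
      · have hc := zpow_ne_zero (wt a i) (qiF_ne_zero (F := F) i)
        have h := congrArg (fun g => tensorRep 1 1 g (copyMap F k (v a))) (gen_relations.tinv_t i)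
        simp only [map_mul, map_one, Module.End.mul_apply, ht, map_smul,
          Module.End.one_apply] at h
        rw [evalRep, liftU_gen, evalGen_tinv, qi_zpow_smul (F := F), map_smul, zpow_neg,
          eq_inv_smul_iff₀ hc]
        exact h
    exact LinearMap.congr_fun key p
  | algebraMap r =>
    rw [AlgHom.commutes, AlgHom.commutes, Module.algebraMap_end_apply,
      Module.algebraMap_end_apply, LinearMap.map_smul_of_tower]
  | add g h _ _ hg hh =>
    rw [map_add, map_add, LinearMap.add_apply, LinearMap.add_apply, hg, hh, map_add]
  | mul g h _ _ hg hh =>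
    rw [map_mul, map_mul, Module.End.mul_apply, Module.End.mul_apply, hh, hg]

/-- A subspace of `V^1` that is stable under `f_1`, `f_2` and contains `v_1` and `v_φ` contains the
standard basis. -/
theorem v_mem_of_fVec {S : Submodule F (Idx → F)} (h1 : v .b1 ∈ S) (h8 : v .phi ∈ S)
    (hf : ∀ i : Fin 3, i ≠ 0 → ∀ a, v a ∈ S → fVec i a ∈ S) (a : Idx) : v a ∈ S := by
  have step : ∀ {i : Fin 3}, i ≠ 0 → ∀ {a : Idx} {p : Idx → F}, fVec i a = p → v a ∈ S → p ∈ S :=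
    fun hi a _ hp ha => hp ▸ hf _ hi a ha
  have h2 := step (i := 1) (by decide) fVec_one.1 h1
  have h3 := step (i := 2) (by decide) fVec_two.2.1 h2
  have h4 := step (i := 1) (by decide) fVec_one.2.2.1 h3
  have h5 : v .c3 ∈ S :=
    (S.smul_mem_iff (div_ne_zero (n_two F) qF_ne_zero)).1
      (step (i := 1) (by decide) fVec_one.2.2.2.1 h4)
  have h6 := step (i := 2) (by decide) fVec_two.2.2.2.2.1 h5
  have h7 := step (i := 1) (by decide) fVec_one.2.2.2.2.2.1 h6
  cases a
  exacts [h1, h2, h3, h4, h5, h6, h7, h8]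

theorem copyMap_mem {k : Comp} (hk : IsCopy k) (a : Idx) :
    copyMap F k (v a) ∈ component F k := by
  have htop : copyMap F k (v (copyTop k)) ∈ component F k := by
    rw [copyMap_top hk]; exact hwVec_mem k
  rcases k with _ | _ | j | j
  · exact hk.elim
  · exact hk.elim
  · refine v_mem_of_fVec (S := (component F (.lam1 j)).comap (copyMap F (.lam1 j))) htop ?_
      (fun i hi a ha => ?_) a
    · rw [Submodule.mem_comap, copyMap_v, copyVec]; exact zero_mem _
    · rw [Submodule.mem_comap, ← copyMap_lam1_f j hi, ← copyMap_v]
      exact component_stable _ _ (gen_mem_UG2 hi).2.1 _ ha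
  · by_cases ha : a = .phi
    · subst ha; exact htop
    · rw [copyMap_triv j ha]; exact zero_mem _

theorem range_copyMap {k : Comp} (hk : IsCopy k) :
    LinearMap.range (copyMap F k) = component F k := by
  refine le_antisymm ?_ (component_le_of_isStable ?_ ⟨_, copyMap_top hk⟩)
  · rintro _ ⟨p, rfl⟩
    have h : (⊤ : Submodule F (Idx → F)) ≤ (component F k).comap (copyMap F k) := by
      rw [← (Pi.basisFun F Idx).span_eq, Submodule.span_le]
      rintro _ ⟨a, rfl⟩
      have := copyMap_mem (F := F) hk a
      simpa [v] using this
    exact h trivial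
  · rintro g hg _ ⟨p, rfl⟩
    exact ⟨_, (copyMap_linear hk hg p).symm⟩

/-- The functionals that read off the coordinates of a vector of `V^1` from its image under
`copyMap`. -/
theorem copyMap_coord (k : Fin 3) {a : Idx} (ha : a ≠ .phi) :
    ∃ w : W F, ∃ c : F, c ≠ 0 ∧ ∀ p : Idx → F, formW F w (copyMap F (.lam1 k) p) = c * p a := by
  have hq := qF_ne_zero (F := F)
  have h2 := n_two F
  have h1 : qF F ^ 2 - 1 ≠ 0 := sub_ne_zero.2 (qF_pow_ne_one 2 (by norm_num))
  set w : W F := ![v a ⊗ₜ v .phi, v .phi ⊗ₜ v a, v a ⊗ₜ v .b0] k with hw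
  refine ⟨w, formW F w (copyMap F (.lam1 k) (v a)), ?_, fun p => ?_⟩
  · have hp := nrm_ne_zero (F := F) .phi
    fin_cases k <;> cases a <;>
      first
      | exact absurd rfl ha
      | simp [hw, copyMap_v, copyVec, formW_v, nrm_ne_zero, hq, h1]
  · have key : formW F w ∘ₗ copyMap F (.lam1 k) =
        (formW F w (copyMap F (.lam1 k) (v a))) • LinearMap.proj a := by
      refine (Pi.basisFun F Idx).ext fun b => ?_
      rw [Pi.basisFun_apply]
      change formW F w (copyMap F (.lam1 k) (v b)) = _ * (v b : Idx → F) a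
      by_cases hab : a = b
      · subst hab; simp [v]
      · have : (v b : Idx → F) a = 0 := by simp [v, hab]
        rw [this, mul_zero]
        fin_cases k <;> cases a <;>
          first
          | exact absurd rfl ha
          | (cases b <;>
              first
              | exact absurd rfl hab
              | simp [hw, copyMap_v, copyVec, formW_v])
    exact LinearMap.congr_fun key p

theorem ker_copyMap_lam1 (k : Fin 3) (p : Idx → F) :
    copyMap F (.lam1 k) p = 0 ↔ ∀ a, a ≠ .phi → p a = 0 := by
  constructor
  · intro h a ha
    obtain ⟨w, c, hc, hw⟩ := copyMap_coord (F := F) k ha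
    have := hw p
    rw [h, map_zero] at this
    exact (mul_eq_zero.1 this.symm).resolve_left hc
  · intro h
    rw [← (Pi.basisFun F Idx).sum_repr p, map_sum]
    refine Finset.sum_eq_zero fun a _ => ?_
    rw [Pi.basisFun_repr, Pi.basisFun_apply, map_smul]
    by_cases ha : a = .phi
    · subst ha
      change p .phi • copyMap F (.lam1 k) (v .phi) = 0
      rw [copyMap_v, copyVec, smul_zero]
    · rw [h a ha, zero_smul]

theorem ker_copyMap_triv (k : Fin 2) (p : Idx → F) :
    copyMap F (.triv k) p = 0 ↔ p .phi = 0 := by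
  have key : copyMap F (.triv k) p = p .phi • hwVec F (.triv k) := by
    have : copyMap F (.triv k) =
        (LinearMap.toSpanSingleton F _ (hwVec F (.triv k))) ∘ₗ LinearMap.proj .phi := by
      refine (Pi.basisFun F Idx).ext fun b => ?_
      rw [Pi.basisFun_apply]
      change copyMap F (.triv k) (v b) = (v b : Idx → F) .phi • hwVec F (.triv k)
      rw [copyMap_v]
      cases b <;> simp [copyVec, v]
    rw [this]
    rfl
  rw [key, smul_eq_zero_iff_left (component_isIrredHighestWeight _).ne_zero]

/-- Two components that are images of the same quotient of `V^1` are isomorphic. -/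
theorem exists_componentIso {j k : Comp} (hj : IsCopy j) (hk : IsCopy k)
    (htop : copyTop j = copyTop k)
    (hker : LinearMap.ker (copyMap F j) = LinearMap.ker (copyMap F k)) :
    ∃ f : component F j ≃ₗ[F] component F k, IsComponentIso j k f := by
  let e : ∀ i : Comp, IsCopy i →
      ((Idx → F) ⧸ LinearMap.ker (copyMap F i)) ≃ₗ[F] component F i := fun i hi =>
    (copyMap F i).quotKerEquivRange.trans (LinearEquiv.ofEq _ _ (range_copyMap hi))
  have he : ∀ (i : Comp) (hi : IsCopy i) (p : Idx → F),
      (e i hi (Submodule.Quotient.mk p) : W F) = copyMap F i p := fun i hi p => rfl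
  let f := (e j hj).symm.trans ((Submodule.quotEquivOfEq _ _ hker).trans (e k hk))
  have hf : ∀ (w : component F j) (p : Idx → F), (w : W F) = copyMap F j p →
      (f w : W F) = copyMap F k p := by
    intro w p hw
    have h1 : w = e j hj (Submodule.Quotient.mk p) := Subtype.ext (hw.trans (he j hj p).symm)
    rw [h1]
    simp only [f, LinearEquiv.trans_apply, LinearEquiv.symm_apply_apply,
      Submodule.quotEquivOfEq_mk, he]
  refine ⟨f, fun g hg w => ?_, ?_⟩
  · obtain ⟨p, hp⟩ : (w : W F) ∈ LinearMap.range (copyMap F j) := by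
      rw [range_copyMap hj]; exact w.2
    refine Subtype.ext ?_
    rw [hf _ (evalRep 1 g p) ((congrArg _ hp.symm).trans (copyMap_linear hj hg p)),
      ← copyMap_linear hk hg, ← hf w p hp.symm]
  · refine Subtype.ext ?_
    rw [hf _ (v (copyTop j)) (copyMap_top hj).symm, htop, copyMap_top hk]

theorem exists_componentIso_lam1 (j i : Fin 3) :
    ∃ f : component F (.lam1 i) ≃ₗ[F] component F (.lam1 j),
      IsComponentIso (.lam1 i) (.lam1 j) f :=
  exists_componentIso trivial trivial rfl
    (by ext p; rw [LinearMap.mem_ker, LinearMap.mem_ker, ker_copyMap_lam1, ker_copyMap_lam1])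

theorem exists_componentIso_triv (j i : Fin 2) :
    ∃ f : component F (.triv i) ≃ₗ[F] component F (.triv j),
      IsComponentIso (.triv i) (.triv j) f :=
  exists_componentIso trivial trivial rfl
    (by ext p; rw [LinearMap.mem_ker, LinearMap.mem_ker, ker_copyMap_triv, ker_copyMap_triv])

theorem exists_componentProj (k : Comp) :
    ∃ P : W F →ₗ[F] component F k, IsComponentProj k P := by
  let e := LinearEquiv.ofBijective (DirectSum.coeLinearMap (component F)) (component_isInternal F)
  refine ⟨DirectSum.component F Comp (fun k => component F k) k ∘ₗ e.symm.toLinearMap,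
    fun j w hw => ?_⟩
  have h : e.symm w = DirectSum.lof F Comp (fun k => component F k) j ⟨w, hw⟩ := by
    rw [LinearEquiv.symm_apply_eq]
    exact (DirectSum.coeLinearMap_lof (component F) j ⟨w, hw⟩).symm
  rw [LinearMap.comp_apply, LinearEquiv.coe_coe, h]
  split_ifs with hjk
  · subst hjk
    rw [DirectSum.component.lof_self]
  · rw [DirectSum.component.of, dif_neg hjk]
    rfl

/-! ### The action of `e_0` on the highest weight vectors -/

variable (F) in
/-- The vector of weight `\barΛ_1` in the component of highest weight `2\barΛ_1` that occurs in
`e_0 u_{2Λ_1}`. -/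
noncomputable def vecTwoA : W F :=
  let q := qF F
  ((q ^ 2 + 1) * (q ^ 4 - q ^ 2 + 1)) • (v .b0 ⊗ₜ v .b1 + q ^ 2 • v .b1 ⊗ₜ v .b0)
    + ((q ^ 2 - 1) * (q ^ 2 + 1)) • (q ^ 4 • v .b3 ⊗ₜ v .b2 - q • v .b2 ⊗ₜ v .b3)

variable (F) in
/-- The vector of weight `\barΛ_2 - \barΛ_1` in the component of highest weight `2\barΛ_1` that
occurs in `e_0 u_{Λ_2}`. -/
noncomputable def vecTwoB : W F :=
  let q := qF F
  (q ^ 2 + 1) • (v .b0 ⊗ₜ v .b2 + q ^ 6 • v .b2 ⊗ₜ v .b0)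
    - (q * (q ^ 2 + 1) ^ 2) • (v .c3 ⊗ₜ v .b1 + q ^ 3 • v .b1 ⊗ₜ v .c3)

variable (F) in
/-- The vector of weight `0` in the component of highest weight `2\barΛ_1` that occurs in
`e_0 u_{Λ_1}^{(i)}`. -/
noncomputable def vecTwoC : W F :=
  let q := qF F
  ((q ^ 2 + 1) * (q ^ 12 + 2 * q ^ 8 - q ^ 6 + 2 * q ^ 4 + 1)) •
      (v .c1 ⊗ₜ v .b1 + q ^ 4 • v .b1 ⊗ₜ v .c1)
    + (q ^ 10 + q ^ 6 + q ^ 2 + 1) • (q ^ 5 • v .c2 ⊗ₜ v .b2 - q ^ 2 • v .c3 ⊗ₜ v .b3)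
    + (q ^ 10 + q ^ 8 + q ^ 4 + 1) • (q ^ 3 • v .b2 ⊗ₜ v .c2 - q ^ 6 • v .b3 ⊗ₜ v .c3)
    + (q * (q ^ 2 + 1) * (q ^ 4 - q ^ 2 + 1) * (q ^ 8 - q ^ 6 + q ^ 4 - q ^ 2 + 1)) •
      v .b0 ⊗ₜ v .b0

variable (F) in
/-- The vector of weight `\barΛ_1` in the component of highest weight `\barΛ_2` that occurs in
`e_0 u_{2Λ_1}`. -/
noncomputable def vecLamA : W F :=
  let q := qF F
  v .b2 ⊗ₜ v .b3 - q ^ 3 • v .b3 ⊗ₜ v .b2 + q • v .b1 ⊗ₜ v .b0 - q • v .b0 ⊗ₜ v .b1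

variable (F) in
/-- The vector of weight `0` in the component of highest weight `\barΛ_2` that occurs in
`e_0 u_{Λ_1}^{(i)}`. -/
noncomputable def vecLamC : W F :=
  let q := qF F
  (q * (q ^ 4 + q ^ 2 - 1)) • (v .b2 ⊗ₜ v .c2 - q ^ 3 • v .b3 ⊗ₜ v .c3)
    + (q ^ 4 - q ^ 2 - 1) • (q ^ 3 • v .c2 ⊗ₜ v .b2 - v .c3 ⊗ₜ v .b3)
    + ((q ^ 2 - 1) * (q ^ 2 + 1) * (q ^ 4 - q ^ 2 + 1) / q) • v .b0 ⊗ₜ v .b0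
    + ((q ^ 2 + 1) * (q ^ 4 - q ^ 2 + 1)) • (v .c1 ⊗ₜ v .b1 - q ^ 2 • v .b1 ⊗ₜ v .c1)

theorem f_mem_component {k : Comp} {i : Fin 3} (hi : i ≠ 0) {w : W F} (hw : w ∈ component F k) :
    tensorRep 1 1 (gen (.f i)) w ∈ component F k :=
  component_stable k _ (gen_mem_UG2 hi).2.1 w hw

theorem vecTwoA_mem : vecTwoA F ∈ component F .twoLam1 := by
  have hq := qF_ne_zero (F := F)
  have h2 := n_two F
  have a := f_mem_component (F := F) (i := 1) (by decide) (hwVec_mem .twoLam1)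
  have a2 := f_mem_component (F := F) (i := 2) (by decide) a
  have a12 := f_mem_component (F := F) (i := 1) (by decide) a2
  have a1 := f_mem_component (F := F) (i := 1) (by decide) a
  have a21 := f_mem_component (F := F) (i := 2) (by decide) a1
  convert sub_mem (Submodule.smul_mem _ ((qF F ^ 2 + 1) * (qF F ^ 4 - qF F ^ 2 + 1)) a12)
    (Submodule.smul_mem _ (qF F ^ 3) a21) using 1
  simp [vecTwoA, hwVec_eval, tensorRep_f_v, fVec_one, fVec_two, twist_eval, qiF_eval, wt_one,
    wt_two, smul_smul]
  match_scalars <;> field_simp <;> ring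

theorem vecTwoB_mem : vecTwoB F ∈ component F .twoLam1 := by
  have hq := qF_ne_zero (F := F)
  have h2 := n_two F
  have a := f_mem_component (F := F) (i := 1) (by decide) (hwVec_mem .twoLam1)
  have a2 := f_mem_component (F := F) (i := 2) (by decide) a
  have a12 := f_mem_component (F := F) (i := 1) (by decide) a2
  have a112 := f_mem_component (F := F) (i := 1) (by decide) a12
  have a1 := f_mem_component (F := F) (i := 1) (by decide) a
  have a21 := f_mem_component (F := F) (i := 2) (by decide) a1
  have a121 := f_mem_component (F := F) (i := 1) (by decide) a21
  convert sub_mem (Submodule.smul_mem _ (qF F * (qF F ^ 4 + qF F ^ 2 + 1)) a121)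
    (Submodule.smul_mem _ (qF F ^ 2 * (qF F ^ 2 + 1)) a112) using 1
  simp [vecTwoB, hwVec_eval, tensorRep_f_v, fVec_one, fVec_two, twist_eval, qiF_eval, wt_one,
    wt_two, TensorProduct.tmul_smul, ← TensorProduct.smul_tmul', smul_smul]
  match_scalars <;> field_simp <;> ring

theorem vecTwoC_mem : vecTwoC F ∈ component F .twoLam1 := by
  have hq := qF_ne_zero (F := F)
  have h2 := n_two F
  have a := f_mem_component (F := F) (i := 1) (by decide) (hwVec_mem .twoLam1)
  have a2 := f_mem_component (F := F) (i := 2) (by decide) a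
  have a12 := f_mem_component (F := F) (i := 1) (by decide) a2
  have a112 := f_mem_component (F := F) (i := 1) (by decide) a12
  have a2112 := f_mem_component (F := F) (i := 2) (by decide) a112
  have a12112 := f_mem_component (F := F) (i := 1) (by decide) a2112
  have a1 := f_mem_component (F := F) (i := 1) (by decide) a
  have a21 := f_mem_component (F := F) (i := 2) (by decide) a1
  have a121 := f_mem_component (F := F) (i := 1) (by decide) a21
  have a1121 := f_mem_component (F := F) (i := 1) (by decide) a121
  have a21121 := f_mem_component (F := F) (i := 2) (by decide) a1121
  have a2121 := f_mem_component (F := F) (i := 2) (by decide) a121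
  have a12121 := f_mem_component (F := F) (i := 1) (by decide) a2121
  convert sub_mem (sub_mem
    (Submodule.smul_mem _ (qF F * (qF F ^ 12 + 2 * qF F ^ 8 - qF F ^ 6 + 2 * qF F ^ 4 + 1)) a12112)
    (Submodule.smul_mem _ (qF F ^ 3 * (qF F ^ 4 + qF F ^ 2 + 1) * (qF F ^ 8 + 1) /
      (qF F ^ 2 + 1) ^ 2) a21121))
    (Submodule.smul_mem _ (qF F ^ 2 * (qF F ^ 4 + qF F ^ 2 + 1) *
      (qF F ^ 8 + qF F ^ 6 - qF F ^ 4 + qF F ^ 2 + 1) / (qF F ^ 2 + 1)) a12121) using 1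
  simp [vecTwoC, hwVec_eval, tensorRep_f_v, fVec_one, fVec_two, twist_eval, qiF_eval, wt_one,
    wt_two, TensorProduct.tmul_smul, ← TensorProduct.smul_tmul', smul_smul]
  match_scalars <;> field_simp <;> ring

theorem vecLamA_mem : vecLamA F ∈ component F .lam2 := by
  have hq := qF_ne_zero (F := F)
  have h2 := n_two F
  have a := f_mem_component (F := F) (i := 2) (by decide) (hwVec_mem .lam2)
  have a1 := f_mem_component (F := F) (i := 1) (by decide) a
  convert a1 using 1
  simp [vecLamA, hwVec_eval, tensorRep_f_v, fVec_one, fVec_two, twist_eval, qiF_eval, wt_one,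
    wt_two, smul_smul]
  match_scalars <;> field_simp

theorem vecLamC_mem : vecLamC F ∈ component F .lam2 := by
  have hq := qF_ne_zero (F := F)
  have h2 := n_two F
  have a := f_mem_component (F := F) (i := 2) (by decide) (hwVec_mem .lam2)
  have a1 := f_mem_component (F := F) (i := 1) (by decide) a
  have a11 := f_mem_component (F := F) (i := 1) (by decide) a1
  have a111 := f_mem_component (F := F) (i := 1) (by decide) a11
  have a2111 := f_mem_component (F := F) (i := 2) (by decide) a111
  have a211 := f_mem_component (F := F) (i := 2) (by decide) a11
  have a1211 := f_mem_component (F := F) (i := 1) (by decide) a211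
  convert sub_mem (Submodule.smul_mem _ (qF F ^ 3 / (qF F ^ 2 + 1)) a2111)
    (Submodule.smul_mem _ (qF F ^ 4 - qF F ^ 2 + 1) a1211) using 1
  simp [vecLamC, hwVec_eval, tensorRep_f_v, fVec_one, fVec_two, twist_eval, qiF_eval, wt_one,
    wt_two, TensorProduct.tmul_smul, ← TensorProduct.smul_tmul', smul_smul]
  match_scalars <;> field_simp <;> ring

/-- The components of `e_0 u_{2Λ_1}`; the analogous statements for the other `u_k` follow. -/
theorem e0_two (x y : Fˣ) : tensorRep x y (gen (.e 0)) (hwVec F .twoLam1) =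
    (((x : F) + y) * qF F ^ 3 / ((qF F ^ 2 + 1) ^ 2 * (qF F ^ 8 + 1))) • vecTwoA F
      + (qF F ^ 2 * (y - qF F ^ 2 * x) /
          ((qF F ^ 2 + 1) * (qF F ^ 4 + qF F ^ 2 + 1))) • vecLamA F
      + (y : F) • hwVec F (.lam1 0) + (qF F ^ 2 * x) • hwVec F (.lam1 1)
      + (qF F * (y - qF F ^ 8 * x) / ((qF F ^ 2 + 1) * (qF F ^ 4 + qF F ^ 2 + 1) *
          (qF F ^ 8 + 1))) • hwVec F (.lam1 2) := by
  have hq := qF_ne_zero (F := F)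
  have h2 := n_two F
  have h3 := n_three' F
  have h8 := n_eight F
  simp [vecTwoA, vecLamA, hwVec_eval, tensorRep_e_v, eVec_zero, twist_eval, qiF_eval, wt_zero,
    TensorProduct.tmul_smul, ← TensorProduct.smul_tmul', smul_smul, TensorProduct.add_tmul,
    TensorProduct.tmul_add]
  match_scalars <;> field_simp <;> ring

theorem e0_lam2 (x y : Fˣ) : tensorRep x y (gen (.e 0)) (hwVec F .lam2) =
    (qF F ^ 2 * ((x : F) - qF F ^ 2 * y) / ((qF F ^ 2 + 1) ^ 2 * (qF F ^ 8 + 1))) • vecTwoB F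
      - (qF F * y) • copyMap F (.lam1 0) (v .b2) + (qF F * x) • copyMap F (.lam1 1) (v .b2)
      + ((qF F ^ 6 * x + y) / ((qF F ^ 2 + 1) * (qF F ^ 8 + 1))) •
        copyMap F (.lam1 2) (v .b2) := by
  have hq := qF_ne_zero (F := F)
  have h2 := n_two F
  have h3 := n_three' F
  have h8 := n_eight F
  simp [vecTwoB, copyMap_v, copyVec, hwVec_eval, tensorRep_e_v, eVec_zero, twist_eval, qiF_eval,
    wt_zero, TensorProduct.tmul_smul, ← TensorProduct.smul_tmul', smul_smul, TensorProduct.add_tmul,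
    TensorProduct.tmul_add]
  match_scalars <;> field_simp <;> ring

theorem e0_lam1_zero (x y : Fˣ) : tensorRep x y (gen (.e 0)) (hwVec F (.lam1 0)) =
    (y * (qF F ^ 3 * (qF F ^ 4 + qF F ^ 2 + 1)) / ((qF F ^ 2 + 1) ^ 2 *
        (qF F ^ 12 + qF F ^ 10 + qF F ^ 8 + qF F ^ 6 + qF F ^ 4 + qF F ^ 2 + 1) *
        (qF F ^ 8 + 1))) • vecTwoC F
      - (y * qF F ^ 3 / ((qF F ^ 2 + 1) ^ 2 * (qF F ^ 8 - qF F ^ 4 + 1))) • vecLamC F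
      + (x * qF F / (qF F ^ 2 + 1)) • copyMap F (.lam1 0) (v .b0)
      + (y / ((qF F ^ 2 + 1) ^ 2 * (qF F ^ 8 + 1))) • copyMap F (.lam1 2) (v .b0)
      + (x : F) • hwVec F (.triv 0)
      + (y * (qF F ^ 4 + qF F ^ 2 + 1) / (qF F * (qF F ^ 2 + 1) *
        (qF F ^ 12 + qF F ^ 10 + qF F ^ 8 + qF F ^ 6 + qF F ^ 4 + qF F ^ 2 + 1) *
        (qF F ^ 8 - qF F ^ 4 + 1))) • hwVec F (.triv 1) := by
  have hq := qF_ne_zero (F := F)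
  have h2 := n_two F
  have h7 := n_seven' F
  have h8 := n_eight F
  have h12 := n_twelve' F
  simp [vecTwoC, vecLamC, copyMap_v, copyVec, hwVec_eval, tensorRep_e_v, eVec_zero, twist_eval,
    qiF_eval, wt_zero, TensorProduct.tmul_smul, ← TensorProduct.smul_tmul', smul_smul,
    TensorProduct.add_tmul]
  match_scalars <;> field_simp <;> ring

theorem e0_lam1_one (x y : Fˣ) : tensorRep x y (gen (.e 0)) (hwVec F (.lam1 1)) =
    (x * (qF F * (qF F ^ 4 + qF F ^ 2 + 1)) / ((qF F ^ 2 + 1) ^ 2 *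
        (qF F ^ 12 + qF F ^ 10 + qF F ^ 8 + qF F ^ 6 + qF F ^ 4 + qF F ^ 2 + 1) *
        (qF F ^ 8 + 1))) • vecTwoC F
      + (x * qF F ^ 3 / ((qF F ^ 2 + 1) ^ 2 * (qF F ^ 8 - qF F ^ 4 + 1))) • vecLamC F
      + (y * qF F / (qF F ^ 2 + 1)) • copyMap F (.lam1 1) (v .b0)
      - (x * qF F ^ 6 / ((qF F ^ 2 + 1) ^ 2 * (qF F ^ 8 + 1))) • copyMap F (.lam1 2) (v .b0)
      + (y : F) • hwVec F (.triv 0)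
      + (x * qF F ^ 11 * (qF F ^ 4 + qF F ^ 2 + 1) / ((qF F ^ 2 + 1) *
        (qF F ^ 12 + qF F ^ 10 + qF F ^ 8 + qF F ^ 6 + qF F ^ 4 + qF F ^ 2 + 1) *
        (qF F ^ 8 - qF F ^ 4 + 1))) • hwVec F (.triv 1) := by
  have hq := qF_ne_zero (F := F)
  have h2 := n_two F
  have h7 := n_seven' F
  have h8 := n_eight F
  have h12 := n_twelve' F
  simp [vecTwoC, vecLamC, copyMap_v, copyVec, hwVec_eval, tensorRep_e_v, eVec_zero, twist_eval,
    qiF_eval, wt_zero, TensorProduct.tmul_smul, ← TensorProduct.smul_tmul', smul_smul,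
    TensorProduct.tmul_add]
  match_scalars <;> field_simp <;> ring

theorem e0_lam1_two (x y : Fˣ) : tensorRep x y (gen (.e 0)) (hwVec F (.lam1 2)) =
    ((qF F ^ 2 * (x - qF F ^ 8 * y)) / ((qF F ^ 2 + 1) *
        (qF F ^ 12 + qF F ^ 10 + qF F ^ 8 + qF F ^ 6 + qF F ^ 4 + qF F ^ 2 + 1) *
        (qF F ^ 8 + 1))) • vecTwoC F
      - (qF F ^ 2 * (x + qF F ^ 6 * y) / ((qF F ^ 2 + 1) * (qF F ^ 8 - qF F ^ 4 + 1))) • vecLamC F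
      - (qF F ^ 6 * y) • copyMap F (.lam1 0) (v .b0) + (x : F) • copyMap F (.lam1 1) (v .b0)
      - ((x + y) * qF F ^ 3 * (qF F ^ 4 - qF F ^ 2 + 1) / ((qF F ^ 2 + 1) * (qF F ^ 8 + 1))) •
        copyMap F (.lam1 2) (v .b0)
      + ((y - qF F ^ 6 * x) * (qF F ^ 4 + qF F ^ 2 + 1) * (qF F ^ 8 + 1) /
        ((qF F ^ 12 + qF F ^ 10 + qF F ^ 8 + qF F ^ 6 + qF F ^ 4 + qF F ^ 2 + 1) *
        (qF F ^ 8 - qF F ^ 4 + 1))) • hwVec F (.triv 1) := by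
  have hq := qF_ne_zero (F := F)
  have h2 := n_two F
  have h7 := n_seven' F
  have h8 := n_eight F
  have h12 := n_twelve' F
  simp [vecTwoC, vecLamC, copyMap_v, copyVec, hwVec_eval, tensorRep_e_v, eVec_zero, twist_eval,
    qiF_eval, wt_zero, TensorProduct.tmul_smul, ← TensorProduct.smul_tmul', smul_smul,
    TensorProduct.add_tmul, TensorProduct.tmul_add]
  match_scalars <;> field_simp <;> ring

theorem e0_triv_zero (x y : Fˣ) : tensorRep x y (gen (.e 0)) (hwVec F (.triv 0)) =
    ((qF F ^ 4 + qF F ^ 2 + 1) / (qF F * (qF F ^ 2 + 1))) •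
      ((x : F) • copyMap F (.lam1 0) (v .c1) + (y : F) • copyMap F (.lam1 1) (v .c1)) := by
  simp [copyMap_v, copyVec, hwVec_eval, tensorRep_e_v, eVec_zero, twist_eval,
    qiF_eval, wt_zero, TensorProduct.tmul_smul, ← TensorProduct.smul_tmul', smul_smul]
  match_scalars <;> ring

theorem e0_triv_one (x y : Fˣ) : tensorRep x y (gen (.e 0)) (hwVec F (.triv 1)) =
    (qF F ^ 10 * y) • copyMap F (.lam1 0) (v .c1) + (x / qF F ^ 2) • copyMap F (.lam1 1) (v .c1)
      + ((x - qF F ^ 6 * y) / (qF F * (qF F ^ 2 + 1))) • copyMap F (.lam1 2) (v .c1) := by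
  have hq := qF_ne_zero (F := F)
  have h2 := n_two F
  simp [copyMap_v, copyVec, hwVec_eval, tensorRep_e_v, eVec_zero, twist_eval,
    qiF_eval, wt_zero, TensorProduct.tmul_smul, ← TensorProduct.smul_tmul', smul_smul,
    TensorProduct.add_tmul, TensorProduct.tmul_add]
  match_scalars <;> field_simp <;> ring

/-! ### Operators with the given spectral decomposition -/

/-- A `U_q(G_2)`-linear operator that acts on the highest weight vectors by the coefficients of the
`R`-matrix. -/
structure IsSpectral (z : F) (R : Module.End F (W F)) : Prop where
  linear : ∀ g ∈ UG2, ∀ w, R (tensorRep 1 1 g w) = tensorRep 1 1 g (R w)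
  two : R (hwVec F .twoLam1) = aTwo z • hwVec F .twoLam1
  lam2 : R (hwVec F .lam2) = aLam2 z • hwVec F .lam2
  lam1 : ∀ i, R (hwVec F (.lam1 i)) = ∑ j, aLam1 z i j • hwVec F (.lam1 j)
  triv : ∀ i, R (hwVec F (.triv i)) = ∑ j, aZero z i j • hwVec F (.triv j)

namespace IsSpectral

variable {z : F} {R : Module.End F (W F)}

theorem apply_scalar (hR : IsSpectral z R) {k : Comp} {c : F}
    (hk : R (hwVec F k) = c • hwVec F k) {w : W F} (hw : w ∈ component F k) : R w = c • w := by
  have h : component F k ≤ LinearMap.ker (R - c • LinearMap.id) := by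
    refine component_le (fun i hi w hw => ?_) (by simp [hk])
    have hw' : R w = c • w := by simpa [sub_eq_zero] using hw
    simp [hR.linear _ (gen_mem_UG2 hi).2.1, hw']
  simpa [sub_eq_zero] using h hw

theorem apply_copy (hR : IsSpectral z R) (i : Fin 3) (a : Idx) :
    R (copyMap F (.lam1 i) (v a)) = aLam1 z i 0 • copyMap F (.lam1 0) (v a)
      + aLam1 z i 1 • copyMap F (.lam1 1) (v a) + aLam1 z i 2 • copyMap F (.lam1 2) (v a) := by
  have key : v a ∈ LinearMap.ker (R ∘ₗ copyMap F (.lam1 i) - (aLam1 z i 0 • copyMap F (.lam1 0)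
      + aLam1 z i 1 • copyMap F (.lam1 1) + aLam1 z i 2 • copyMap F (.lam1 2))) := by
    refine v_mem_of_fVec ?_ ?_ (fun j hj b hb => ?_) a
    · have h1 : ∀ i, copyMap F (.lam1 i) (v .b1) = hwVec F (.lam1 i) := fun i =>
        copyMap_top (k := .lam1 i) trivial
      simp only [LinearMap.mem_ker, LinearMap.sub_apply, LinearMap.comp_apply, LinearMap.add_apply,
        LinearMap.smul_apply, h1, hR.lam1, Fin.sum_univ_three, sub_self]
    · have h1 : ∀ i, copyMap F (.lam1 i) (v .phi) = 0 := fun i => by rw [copyMap_v, copyVec]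
      simp only [LinearMap.mem_ker, LinearMap.sub_apply, LinearMap.comp_apply, LinearMap.add_apply,
        LinearMap.smul_apply, h1, map_zero, smul_zero, add_zero, sub_self]
    · have hb' := congrArg (tensorRep 1 1 (gen (.f j))) (LinearMap.mem_ker.1 hb)
      simp only [LinearMap.sub_apply, LinearMap.comp_apply, LinearMap.add_apply,
        LinearMap.smul_apply, map_sub, map_add, map_smul, map_zero,
        ← hR.linear _ (gen_mem_UG2 hj).2.1] at hb'
      simp only [LinearMap.mem_ker, LinearMap.sub_apply, LinearMap.comp_apply, LinearMap.add_apply,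
        LinearMap.smul_apply, ← copyMap_lam1_f _ hj, ← copyMap_v]
      exact hb'
  simpa [sub_eq_zero] using key

end IsSpectral

/-! ### Intertwining -/

namespace IsSpectral

variable {z : F} {R : Module.End F (W F)}

set_option maxHeartbeats 1000000 in
/-- `R` commutes with `e_0` on the highest weight vectors. Both sides expand into vectors of the
components, on which `R` acts by its coefficients, and the comparison is one of rational
functions. -/
theorem e0_hwVec {x y : Fˣ} (hR : IsSpectral (x / y : F) R) (k : Comp) :
    R (tensorRep x y (gen (.e 0)) (hwVec F k)) = tensorRep y x (gen (.e 0)) (R (hwVec F k)) := by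
  have hq := qF_ne_zero (F := F)
  have h2 := n_two F
  have h2' : 1 + qF F ^ 2 ≠ 0 := by rw [add_comm]; exact h2
  have h3 := n_three' F
  have h4 : 1 - qF F ^ 4 ≠ 0 := sub_ne_zero.2 (Ne.symm (qF_pow_ne_one 4 (by norm_num)))
  have h7 := n_seven' F
  have h8 := n_eight F
  have h12 := n_twelve' F
  have hx := x.ne_zero
  have hy := y.ne_zero
  have eA := hR.apply_scalar hR.two vecTwoA_mem
  have eB := hR.apply_scalar hR.two vecTwoB_mem
  have eC := hR.apply_scalar hR.two vecTwoC_mem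
  have eLA := hR.apply_scalar hR.lam2 vecLamA_mem
  have eLC := hR.apply_scalar hR.lam2 vecLamC_mem
  rcases k with _ | _ | i | i
  · rw [hR.two, map_smul, e0_two, e0_two]
    simp only [map_add, map_smul, hR.lam1, eA, eLA, Fin.sum_univ_three]
    simp only [aTwo, aLam2, aLam1, Matrix.of_apply, Matrix.cons_val]
    match_scalars <;> field_simp <;> ring
  · rw [hR.lam2, map_smul, e0_lam2, e0_lam2]
    simp only [map_add, map_sub, map_smul, eB, hR.apply_copy]
    simp only [aTwo, aLam2, aLam1, Matrix.of_apply, Matrix.cons_val]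
    match_scalars <;> field_simp <;> ring
  · fin_cases i
    all_goals
      simp only [Fin.zero_eta, Fin.mk_one, Fin.reduceFinMk, hR.lam1, map_smul, map_add,
        Fin.sum_univ_three, Fin.sum_univ_two,
        e0_lam1_zero, e0_lam1_one, e0_lam1_two, map_sub, eC, eLC, hR.apply_copy, hR.triv]
      simp only [aTwo, aLam2, aLam1, aZero, aZeroOne, Matrix.of_apply, Matrix.cons_val]
      match_scalars <;> field_simp <;> ring
  · fin_cases i
    all_goals
      simp only [Fin.zero_eta, Fin.mk_one, hR.triv, map_smul, map_add,
        Fin.sum_univ_two, e0_triv_zero, e0_triv_one, hR.apply_copy]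
      simp only [aLam1, aZero, aZeroOne, Matrix.of_apply, Matrix.cons_val]
      match_scalars <;> field_simp <;> ring

end IsSpectral

/-- To commute with the generators is to be an intertwiner. -/
theorem isIntertwiner_of_gen {x y : Fˣ} {R : Module.End F (W F)}
    (h : ∀ g w, R (tensorRep x y (gen g) w) = tensorRep y x (gen g) (R w)) :
    IsIntertwiner x y R := by
  intro g
  obtain ⟨p, rfl⟩ := RingQuot.mkAlgHom_surjective K Rel g
  induction p using FreeAlgebra.induction with
  | grade0 r =>
    intro w
    rw [AlgHom.commutes, AlgHom.commutes, AlgHom.commutes, Module.algebraMap_end_apply,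
      Module.algebraMap_end_apply, ← algebraMap_smul F r w, map_smul, algebraMap_smul]
  | grade1 g => exact h g
  | mul a b ha hb =>
    intro w
    rw [map_mul, map_mul, map_mul, Module.End.mul_apply, Module.End.mul_apply, ha, hb]
  | add a b ha hb =>
    intro w
    rw [map_add, map_add, map_add, LinearMap.add_apply, LinearMap.add_apply, map_add, ha, hb]

/-- `e_0` commutes with `f_1` and `f_2`. -/
theorem e0_f (x y : Fˣ) {i : Fin 3} (hi : i ≠ 0) (w : W F) :
    tensorRep x y (gen (.e 0)) (tensorRep 1 1 (gen (.f i)) w) =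
      tensorRep 1 1 (gen (.f i)) (tensorRep x y (gen (.e 0)) w) := by
  have h := gen_relations.e_f 0 i
  rw [if_neg hi.symm, sub_eq_zero] at h
  rw [← tensorRep_eq_one x y (gen_mem_UG2 hi).2.1, ← Module.End.mul_apply, ← Module.End.mul_apply,
    ← map_mul, ← map_mul, h]

theorem t_f_apply (x y : Fˣ) (i j : Fin 3) (w : W F) :
    tensorRep x y (gen (.t i)) (tensorRep x y (gen (.f j)) w) =
      (qiF F i ^ (-cartan i j)) • tensorRep x y (gen (.f j)) (tensorRep x y (gen (.t i)) w) := by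
  have h := congrArg (fun g => tensorRep x y g (tensorRep x y (gen (.t i)) w))
    (gen_relations.t_f i j)
  simp only [map_mul, map_smul, Module.End.mul_apply, LinearMap.smul_apply,
    qi_zpow_smul (F := F)] at h
  rw [← h, ← Module.End.mul_apply (tensorRep x y (gen (.tinv i))), ← map_mul,
    gen_relations.tinv_t, map_one, Module.End.one_apply]

namespace IsSpectral

variable {z : F} {R : Module.End F (W F)}

theorem linear' (hR : IsSpectral z R) (x y : Fˣ) {g : U} (hg : g ∈ UG2) (w : W F) :
    R (tensorRep x y g w) = tensorRep y x g (R w) := by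
  rw [tensorRep_eq_one x y hg, tensorRep_eq_one y x hg, hR.linear g hg]

/-- Both sides commute with `f_1` and `f_2`, so agreement on the `u_k` suffices. -/
theorem apply_e0 {x y : Fˣ} (hR : IsSpectral (x / y : F) R) (w : W F) :
    R (tensorRep x y (gen (.e 0)) w) = tensorRep y x (gen (.e 0)) (R w) := by
  have h := eq_top_of_stable
    (LinearMap.ker (R ∘ₗ tensorRep x y (gen (.e 0)) - tensorRep y x (gen (.e 0)) ∘ₗ R))
    (fun i hi w hw => ?_) (fun k => ?_)
  · have hw := h.ge (Submodule.mem_top (x := w))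
    simpa [sub_eq_zero] using hw
  · simp only [LinearMap.mem_ker, LinearMap.sub_apply, LinearMap.comp_apply, sub_eq_zero] at hw ⊢
    have hg := (gen_mem_UG2 hi).2.1
    rw [e0_f x y hi, hR.linear _ hg, hw, hR.linear _ hg, e0_f y x hi]
  · simp only [LinearMap.mem_ker, LinearMap.sub_apply, LinearMap.comp_apply, sub_eq_zero]
    exact hR.e0_hwVec k

theorem apply_t (hR : IsSpectral z R) (x y : Fˣ) (i : Fin 3) (w : W F) :
    R (tensorRep x y (gen (.t i)) w) = tensorRep y x (gen (.t i)) (R w) := by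
  have h := eq_top_of_stable
    (LinearMap.ker (R ∘ₗ tensorRep x y (gen (.t i)) - tensorRep y x (gen (.t i)) ∘ₗ R))
    (fun j hj w hw => ?_) (fun k => ?_)
  · have hw := h.ge (Submodule.mem_top (x := w))
    simpa [sub_eq_zero] using hw
  · simp only [LinearMap.mem_ker, LinearMap.sub_apply, LinearMap.comp_apply, sub_eq_zero] at hw ⊢
    have hg := (gen_mem_UG2 hj).2.1
    rw [← tensorRep_eq_one x y hg, t_f_apply, map_smul, hR.linear' x y hg, hw,
      hR.linear' x y hg, t_f_apply]
  · simp only [LinearMap.mem_ker, LinearMap.sub_apply, LinearMap.comp_apply, sub_eq_zero]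
    rcases k with _ | _ | j | j <;>
      simp [hwVec_t, hR.two, hR.lam2, hR.lam1, hR.triv, Finset.smul_sum, Comp.weight,
        smul_comm (qiF F i ^ (_ : ℤ))]

theorem apply_tinv (hR : IsSpectral z R) (x y : Fˣ) (i : Fin 3) (w : W F) :
    R (tensorRep x y (gen (.tinv i)) w) = tensorRep y x (gen (.tinv i)) (R w) := by
  have h1 : ∀ (x y : Fˣ) (w : W F),
      tensorRep x y (gen (.t i)) (tensorRep x y (gen (.tinv i)) w) = w := by
    intro x y w
    rw [← Module.End.mul_apply, ← map_mul, gen_relations.t_tinv, map_one, Module.End.one_apply]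
  have h2 : ∀ (x y : Fˣ) (w : W F),
      tensorRep x y (gen (.tinv i)) (tensorRep x y (gen (.t i)) w) = w := by
    intro x y w
    rw [← Module.End.mul_apply, ← map_mul, gen_relations.tinv_t, map_one, Module.End.one_apply]
  rw [← h2 y x (R (tensorRep x y (gen (.tinv i)) w)), ← hR.apply_t, h1]

theorem adjoint_hwVec (hR : IsSpectral z R) (j k : Comp) :
    formW F (R (hwVec F j)) (hwVec F k) = formW F (hwVec F j) (R (hwVec F k)) := by
  have h2 := n_two F
  have h2' : 1 + qF F ^ 2 ≠ 0 := by rw [add_comm]; exact h2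
  have h4 : 1 - qF F ^ 4 ≠ 0 := sub_ne_zero.2 (Ne.symm (qF_pow_ne_one 4 (by norm_num)))
  rcases j with _ | _ | i | i <;> rcases k with _ | _ | l | l
  all_goals try fin_cases i
  all_goals try fin_cases l
  all_goals
    simp [hR.two, hR.lam2, hR.lam1, hR.triv, formW_hwVec, Fin.sum_univ_three, Fin.sum_univ_two,
      hwNrm, aLam1, aZero]
  all_goals try field_simp
  all_goals try ring

/-- `R` is symmetric with respect to the contravariant form. -/
theorem adjoint (hR : IsSpectral z R) (w w' : W F) : formW F (R w) w' = formW F w (R w') := by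
  have key : ∀ k, formW F (R (hwVec F k)) - formW F (hwVec F k) ∘ₗ R = 0 := by
    intro k
    refine functional_eq_zero (fun i hi w => ?_) (fun j => ?_)
    · have hk : IsHighest (R (hwVec F k)) := fun j hj => by
        rw [← hR.linear _ (gen_mem_UG2 hj).1, hwVec_e k hj, map_zero]
      rw [LinearMap.sub_apply, LinearMap.comp_apply, hk.formW_f hi,
        hR.linear _ (gen_mem_UG2 hi).2.1, (hwVec_isHighest F k).formW_f hi, sub_zero]
    · rw [LinearMap.sub_apply, LinearMap.comp_apply, hR.adjoint_hwVec, sub_self]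
  have h := eq_top_of_stable (LinearMap.ker (formW F ∘ₗ R - LinearMap.compl₂ (formW F) R))
    (fun i hi w hw => ?_) (fun k => ?_)
  · have hw := h.ge (Submodule.mem_top (x := w))
    rw [LinearMap.mem_ker, LinearMap.sub_apply, sub_eq_zero] at hw
    exact LinearMap.congr_fun hw w'
  · obtain ⟨he, hf, ht, -⟩ := gen_mem_UG2 hi
    rw [LinearMap.mem_ker, LinearMap.sub_apply, sub_eq_zero] at hw ⊢
    refine LinearMap.ext fun w' => ?_
    have hw' := fun w' => LinearMap.congr_fun hw w'
    simp only [LinearMap.comp_apply, LinearMap.compl₂_apply] at hw' ⊢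
    rw [hR.linear _ hf, formW_f, formW_f, hw', inv_one, hR.linear _ he, hR.linear _ ht]
  · rw [LinearMap.mem_ker, ← key k]
    rfl

/-- The transpose of the statement for `e_0` with parameters `y⁻¹`, `x⁻¹`, whose ratio is again
`x / y`. -/
theorem apply_f0 {x y : Fˣ} (hR : IsSpectral (x / y : F) R) (w : W F) :
    R (tensorRep x y (gen (.f 0)) w) = tensorRep y x (gen (.f 0)) (R w) := by
  have hz : (↑y⁻¹ : F) / ↑x⁻¹ = x / y := by
    rw [Units.val_inv_eq_inv_val, Units.val_inv_eq_inv_val]; field_simp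
  have hR' : IsSpectral ((↑y⁻¹ : F) / ↑x⁻¹) R := by rwa [hz]
  rw [← sub_eq_zero]
  refine formW_nondegenerate fun a b => ?_
  rw [map_sub, LinearMap.sub_apply, hR.adjoint, formW_f, formW_f, hR.adjoint, ← hR.apply_t y⁻¹,
    hR'.apply_e0, sub_self]

/-- An operator with the spectral decomposition of the `R`-matrix is an intertwiner. -/
theorem isIntertwiner {x y : Fˣ} (hR : IsSpectral (x / y : F) R) : IsIntertwiner x y R := by
  refine isIntertwiner_of_gen fun g w => ?_
  rcases g with i | i | i | i
  · by_cases hi : i = 0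
    · subst hi
      exact hR.apply_e0 w
    · exact hR.linear' x y (gen_mem_UG2 hi).1 w
  · by_cases hi : i = 0
    · subst hi
      exact hR.apply_f0 w
    · exact hR.linear' x y (gen_mem_UG2 hi).2.1 w
  · exact hR.apply_t x y i w
  · exact hR.apply_tinv x y i w

end IsSpectral

/-! ### The spectral `R`-matrix -/

theorem IsComponentProj.apply_self {k : Comp} {P : W F →ₗ[F] component F k}
    (hP : IsComponentProj k P) (w : component F k) : P w = w :=
  Subtype.ext (by rw [hP k w w.2, if_pos rfl])

theorem IsComponentProj.apply_of_ne {j k : Comp} {P : W F →ₗ[F] component F k}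
    (hP : IsComponentProj k P) (h : j ≠ k) {w : W F} (hw : w ∈ component F j) : P w = 0 :=
  Subtype.ext (by rw [hP j w hw, if_neg h]; rfl)

theorem IsComponentProj.linear {k : Comp} {P : W F →ₗ[F] component F k}
    (hP : IsComponentProj k P) {g : U} (hg : g ∈ UG2) (w : W F) :
    (P (tensorRep 1 1 g w) : W F) = tensorRep 1 1 g (P w) := by
  have hw : w ∈ ⨆ k, component F k := by rw [iSup_component]; trivial
  induction hw using Submodule.iSup_induction' with
  | mem j w hw =>
    rw [hP j w hw, hP j _ (component_stable j g hg w hw)]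
    split_ifs <;> simp
  | zero => simp
  | add a b _ _ ha hb => simp only [map_add, Submodule.coe_add, ha, hb]

theorem IsComponentProj.apply_hwVec {j k : Comp} {P : W F →ₗ[F] component F k}
    (hP : IsComponentProj k P) : (P (hwVec F j) : W F) = if j = k then hwVec F j else 0 :=
  hP j _ (hwVec_mem j)

theorem IsComponentIso.linear' {j k : Comp} {f : component F j ≃ₗ[F] component F k}
    (hf : IsComponentIso j k f) {P : W F →ₗ[F] component F j} (hP : IsComponentProj j P)
    {g : U} (hg : g ∈ UG2) (w : W F) :
    (f (P (tensorRep 1 1 g w)) : W F) = tensorRep 1 1 g (f (P w)) := by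
  have h := congrArg Subtype.val (hf.linear g hg (P w))
  rw [← show P (tensorRep 1 1 g w) = ⟨tensorRep 1 1 g (P w), component_stable j g hg _ (P w).2⟩
    from Subtype.ext (hP.linear hg w)] at h
  exact h

theorem IsComponentIso.apply_hwVec {j k : Comp} {f : component F j ≃ₗ[F] component F k}
    (hf : IsComponentIso j k f) {P : W F →ₗ[F] component F j} (hP : IsComponentProj j P) (l : Comp) :
    (f (P (hwVec F l)) : W F) = if l = j then hwVec F k else 0 := by
  split_ifs with h
  · subst h
    rw [show P (hwVec F l) = ⟨hwVec F l, hwVec_mem l⟩ from hP.apply_self ⟨_, hwVec_mem l⟩,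
      hf.map_hwVec]
  · rw [hP.apply_of_ne h (hwVec_mem l), LinearEquiv.map_zero]
    rfl

theorem isSpectral_spectralR (z : F) {P : ∀ k, W F →ₗ[F] component F k}
    {ι₁ : ∀ j i : Fin 3, component F (.lam1 i) ≃ₗ[F] component F (.lam1 j)}
    {ι₀ : ∀ j i : Fin 2, component F (.triv i) ≃ₗ[F] component F (.triv j)}
    (hP : ∀ k, IsComponentProj k (P k)) (h₁ : ∀ j i, IsComponentIso (.lam1 i) (.lam1 j) (ι₁ j i))
    (h₀ : ∀ j i, IsComponentIso (.triv i) (.triv j) (ι₀ j i)) :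
    IsSpectral z (spectralR z P ι₁ ι₀) := by
  constructor
  · intro g hg w
    simp [spectralR, (hP _).linear hg, (h₁ _ _).linear' (hP _) hg, (h₀ _ _).linear' (hP _) hg]
  · simp [spectralR, (hP _).apply_hwVec, (h₁ _ _).apply_hwVec (hP _), (h₀ _ _).apply_hwVec (hP _)]
  · simp [spectralR, (hP _).apply_hwVec, (h₁ _ _).apply_hwVec (hP _), (h₀ _ _).apply_hwVec (hP _)]
  · intro i
    simp [spectralR, (hP _).apply_hwVec, (h₁ _ _).apply_hwVec (hP _), (h₀ _ _).apply_hwVec (hP _)]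
  · intro i
    fin_cases i <;> simp [spectralR, (hP _).apply_hwVec, (h₁ _ _).apply_hwVec (hP _), (h₀ _ _).apply_hwVec (hP _)]

/-! ### Matrix coefficients -/

/-- The vectors of `V^1 ⊗ V^1` with coordinates in a subalgebra of `F`. -/
noncomputable def lattice (A : Subalgebra K F) : Submodule A (W F) :=
  Submodule.span A {w | ∃ a b, w = v a ⊗ₜ v b}

theorem v_mem_lattice (A : Subalgebra K F) (a b : Idx) : (v a ⊗ₜ v b : W F) ∈ lattice A :=
  Submodule.subset_span ⟨a, b, rfl⟩

theorem smul_mem_lattice {A : Subalgebra K F} {c : F} (hc : c ∈ A) {w : W F}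
    (hw : w ∈ lattice A) : c • w ∈ lattice A :=
  Submodule.smul_mem _ (⟨c, hc⟩ : A) hw

theorem smul_mem_lattice' {A : Subalgebra K F} (c : K) {w : W F}
    (hw : w ∈ lattice A) : c • w ∈ lattice A := by
  rw [← algebraMap_smul F c w]
  exact smul_mem_lattice (A.algebraMap_mem c) hw

theorem repr_mem_of_mem_lattice {A : Subalgebra K F} {w : W F} (hw : w ∈ lattice A) (c d : Idx) :
    ((Pi.basisFun F Idx).tensorProduct (Pi.basisFun F Idx)).repr w (c, d) ∈ A := by
  induction hw using Submodule.span_induction with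
  | zero => simp
  | add a b _ _ ha hb => rw [map_add]; exact add_mem ha hb
  | smul r a _ ha =>
    rw [show r • a = (r : F) • a from rfl, map_smul]
    exact mul_mem r.2 ha
  | mem w hw =>
    obtain ⟨a, b, rfl⟩ := hw
    rw [show (v a ⊗ₜ v b : W F) =
      ((Pi.basisFun F Idx).tensorProduct (Pi.basisFun F Idx)) (a, b) by simp [v],
      Module.Basis.repr_self, Finsupp.single_apply]
    split_ifs
    exacts [one_mem _, zero_mem _]

theorem f_mem_lattice {A : Subalgebra K F} {i : Fin 3} (hi : i ≠ 0) {w : W F}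
    (hw : w ∈ lattice A) : tensorRep 1 1 (gen (.f i)) w ∈ lattice A := by
  induction hw using Submodule.span_induction with
  | zero => rw [map_zero]; exact zero_mem _
  | add a b _ _ ha hb => rw [map_add]; exact add_mem ha hb
  | smul c a _ ha =>
    rw [show c • a = (c : F) • a from rfl, map_smul]
    exact smul_mem_lattice c.2 ha
  | mem w hw =>
    obtain ⟨a, b, rfl⟩ := hw
    rw [tensorRep_f_K hi]
    refine add_mem ?_ (smul_mem_lattice' _ ?_)
    · fin_cases i
      · exact absurd rfl hi
      all_goals
        cases a <;> simp only [fVec, TensorProduct.zero_tmul, zero_mem, ← TensorProduct.smul_tmul',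
          Fin.mk_one, Fin.reduceFinMk] <;>
        (try refine smul_mem_lattice' _ ?_) <;> exact v_mem_lattice _ _ _
    · fin_cases i
      · exact absurd rfl hi
      all_goals
        cases b <;> simp only [fVec, TensorProduct.tmul_zero, zero_mem, TensorProduct.tmul_smul,
          Fin.mk_one, Fin.reduceFinMk] <;>
        (try refine smul_mem_lattice' _ ?_) <;> exact v_mem_lattice _ _ _

theorem qF_mem (A : Subalgebra K F) : qF F ∈ A := A.algebraMap_mem q

theorem inv_n_two_mem (A : Subalgebra K F) : (qF F ^ 2 + 1)⁻¹ ∈ A := by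
  have h := A.algebraMap_mem (q ^ 2 + 1)⁻¹
  rwa [map_inv₀, map_add, map_pow, map_q, map_one] at h

theorem hwVec_mem_lattice (A : Subalgebra K F) (k : Comp) : hwVec F k ∈ lattice A := by
  have hq := qF_mem A
  have h2 := inv_n_two_mem A
  have hq2 : qF F * (qF F ^ 2 + 1) ∈ A := mul_mem hq (add_mem (pow_mem hq 2) (one_mem _))
  have hq5 : qF F ^ 4 * (qF F ^ 2 + 1) ∈ A :=
    mul_mem (pow_mem hq 4) (add_mem (pow_mem hq 2) (one_mem _))
  have hq3 : qF F ^ 5 / (qF F ^ 2 + 1) ∈ A := by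
    rw [div_eq_mul_inv]; exact mul_mem (pow_mem hq 5) h2
  have hv : ∀ a b, (v a ⊗ₜ v b : W F) ∈ lattice A := v_mem_lattice A
  obtain ⟨e1, e2, e3, e4, e5, e6, e7⟩ := hwVec_eval (F := F)
  rcases k with _ | _ | i | i
  · rw [e1]; exact hv _ _
  · rw [e2]; exact sub_mem (hv _ _) (smul_mem_lattice hq (hv _ _))
  · fin_cases i
    · exact e3 ▸ hv _ _
    · exact e4 ▸ hv _ _
    · change hwVec F (.lam1 2) ∈ _
      rw [e5]
      exact add_mem (sub_mem (sub_mem (hv _ _) (smul_mem_lattice (pow_mem hq 6) (hv _ _)))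
        (smul_mem_lattice hq2 (hv _ _))) (smul_mem_lattice hq5 (hv _ _))
  · fin_cases i
    · exact e6 ▸ hv _ _
    · change hwVec F (.triv 1) ∈ _
      rw [e7]
      exact sub_mem (add_mem (add_mem (sub_mem (sub_mem (add_mem (hv _ _)
        (smul_mem_lattice (pow_mem hq _) (hv _ _))) (smul_mem_lattice hq (hv _ _)))
        (smul_mem_lattice (pow_mem hq _) (hv _ _))) (smul_mem_lattice (pow_mem hq _) (hv _ _)))
        (smul_mem_lattice (pow_mem hq _) (hv _ _))) (smul_mem_lattice hq3 (hv _ _))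

theorem aTwo_mem {A : Subalgebra K F} {z : F} (hz : z ∈ A) : aTwo z ∈ A := by
  have hq := qF_mem A
  unfold aTwo
  repeat' first
    | with_reducible exact hq | with_reducible exact hz | apply one_mem | apply pow_mem
    | apply mul_mem | apply add_mem | apply sub_mem

theorem aLam2_mem {A : Subalgebra K F} {z : F} (hz : z ∈ A) : aLam2 z ∈ A := by
  have hq := qF_mem A
  unfold aLam2
  repeat' first
    | with_reducible exact hq | with_reducible exact hz | apply one_mem | apply pow_mem
    | apply mul_mem | apply add_mem | apply sub_mem

theorem aLam1_mem {A : Subalgebra K F} {z : F} (hz : z ∈ A) (i j : Fin 3) : aLam1 z i j ∈ A := by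
  have hq := qF_mem A
  have h2 := inv_n_two_mem A
  rw [add_comm] at h2
  fin_cases i <;> fin_cases j <;>
    simp [aLam1, div_eq_mul_inv, ← inv_pow] <;>
    repeat' first
      | with_reducible exact hq | with_reducible exact hz | with_reducible exact h2 | apply one_mem
      | apply pow_mem | apply mul_mem | apply add_mem | apply sub_mem

theorem aZero_mem {A : Subalgebra K F} {z : F} (h0 : z ≠ 0) (hz : z ∈ A) (i j : Fin 2) :
    aZero z i j ∈ A := by
  have hq := qF_mem A
  have h2 := inv_n_two_mem A
  have h4 : (1 - qF F ^ 4)⁻¹ ∈ A := by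
    have h := A.algebraMap_mem (1 - q ^ 4)⁻¹
    rwa [map_inv₀, map_sub, map_pow, map_q, map_one] at h
  have h11 : z ^ 4 * aZeroOne (1 / z) =
      ((1 + qF F ^ 2) * (qF F ^ 2 * z ^ 4 + qF F ^ 14)
        - (1 + qF F ^ 8) * z * (qF F ^ 2 * z ^ 2 + qF F ^ 8)
        + (1 - qF F ^ 4) * (1 - qF F ^ 6) * (1 + qF F ^ 8) * z ^ 2) / (1 + qF F ^ 2) := by
    have h2 := n_two F
    rw [add_comm] at h2
    simp only [aZeroOne]
    field_simp
  rw [add_comm] at h2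
  fin_cases i <;> fin_cases j <;>
    simp only [aZero, h11, Matrix.of_apply, Matrix.cons_val, Fin.zero_eta, Fin.mk_one] <;>
    try simp only [aZeroOne, div_eq_mul_inv, mul_inv]
  all_goals
    repeat' first
      | with_reducible exact hq | with_reducible exact hz | with_reducible exact h2
      | with_reducible exact h4 | apply one_mem
      | apply pow_mem | apply mul_mem | apply add_mem | apply sub_mem

/-- The matrix coefficients of `R` lie in every `ℚ(q)`-algebra that contains `z`. -/
theorem IsSpectral.hasCoeffsIn {z : F} {R : Module.End F (W F)} (hR : IsSpectral z R) (h0 : z ≠ 0)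
    {A : Subalgebra K F} (hz : z ∈ A) : HasCoeffsIn (A : Set F) R := by
  intro a b c d
  have h := v_mem_of_stable
    (((lattice A).restrictScalars K).comap (R.restrictScalars K)) (fun i hi w hw => ?_)
    (fun k => ?_) a b
  · exact repr_mem_of_mem_lattice h c d
  · change R _ ∈ lattice A
    rw [hR.linear _ (gen_mem_UG2 hi).2.1]
    exact f_mem_lattice hi hw
  · change R _ ∈ lattice A
    have hu := hwVec_mem_lattice A
    rcases k with _ | _ | i | i
    · rw [hR.two]; exact smul_mem_lattice (aTwo_mem hz) (hu _)
    · rw [hR.lam2]; exact smul_mem_lattice (aLam2_mem hz) (hu _)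
    · rw [hR.lam1]; exact sum_mem fun j _ => smul_mem_lattice (aLam1_mem hz i j) (hu _)
    · rw [hR.triv]; exact sum_mem fun j _ => smul_mem_lattice (aZero_mem h0 hz i j) (hu _)

/-! ### Cyclicity of the top vector and uniqueness -/

section cyclic

variable {x y : Fˣ} {N : Submodule F (W F)}

/-- Modulo the components of highest weight `2\barΛ_1` and `\barΛ_2`, the operator `e_0` followed by
`e_1 e_2 e_1` maps highest weight vectors of weight `\barΛ_1` to such vectors. -/
theorem combo_mem (hN : ∀ g, ∀ w ∈ N, tensorRep x y g w ∈ N) (h₁ : component F .twoLam1 ≤ N)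
    (h₂ : component F .lam2 ≤ N) {α β γ : F}
    (h : α • hwVec F (.lam1 0) + β • hwVec F (.lam1 1) + γ • hwVec F (.lam1 2) ∈ N) :
    (α * x * qF F / (qF F ^ 2 + 1) - γ * qF F ^ 6 * y) • hwVec F (.lam1 0)
      + (β * y * qF F / (qF F ^ 2 + 1) + γ * x) • hwVec F (.lam1 1)
      + ((α * y - β * x * qF F ^ 6) / ((qF F ^ 2 + 1) ^ 2 * (qF F ^ 8 + 1))
        - γ * (x + y) * qF F ^ 3 * (qF F ^ 4 - qF F ^ 2 + 1) /
          ((qF F ^ 2 + 1) * (qF F ^ 8 + 1))) • hwVec F (.lam1 2) ∈ N := by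
  have hq := qF_ne_zero (F := F)
  have h2 := n_two F
  have h8 := n_eight F
  have he : ∀ i : Fin 3, i ≠ 0 → ∀ w ∈ N, tensorRep 1 1 (gen (.e i)) w ∈ N := fun i hi w hw => by
    rw [← tensorRep_eq_one x y (gen_mem_UG2 hi).1]; exact hN _ w hw
  have hm : ∀ i : Fin 3, i ≠ 0 → ∀ k, ∀ w ∈ component F k,
      tensorRep 1 1 (gen (.e i)) w ∈ component F k := fun i hi k w hw =>
    component_stable k _ (gen_mem_UG2 hi).1 w hw
  have n := he 1 (by decide) _ (he 2 (by decide) _ (he 1 (by decide) _ (hN (gen (.e 0)) _ h)))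
  have m1 := h₁ (hm 1 (by decide) _ _ (hm 2 (by decide) _ _ (hm 1 (by decide) _ _ vecTwoC_mem)))
  have m2 := h₂ (hm 1 (by decide) _ _ (hm 2 (by decide) _ _ (hm 1 (by decide) _ _ vecLamC_mem)))
  set T1 := tensorRep 1 1 (gen (.e 1)) (tensorRep 1 1 (gen (.e 2))
    (tensorRep 1 1 (gen (.e 1)) (vecTwoC F))) with hT1
  set T2 := tensorRep 1 1 (gen (.e 1)) (tensorRep 1 1 (gen (.e 2))
    (tensorRep 1 1 (gen (.e 1)) (vecLamC F))) with hT2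
  have hc : ∀ i, tensorRep 1 1 (gen (.e 1)) (tensorRep 1 1 (gen (.e 2))
      (tensorRep 1 1 (gen (.e 1)) (copyMap F (.lam1 i) (v .b0)))) =
      ((qF F ^ 2 + 1) / qF F) • hwVec F (.lam1 i) := fun i => by
    have := copyMap_top (F := F) (k := .lam1 i) trivial
    simp only [copyTop] at this
    simp [copyMap_v, copyMap_lam1_e, eVec_one, eVec_two, ← this]
  simp only [map_add, map_smul, e0_lam1_zero, e0_lam1_one, e0_lam1_two, map_sub, ← hT1, ← hT2, hc,
    hwVec_e _ (show (1 : Fin 3) ≠ 0 by decide), map_zero] at n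
  -- modulo `N` only the copies of `V^1` survive, and `e_1 e_2 e_1 v_0 = [2] v_1` there
  rw [← N.ker_mkQ, LinearMap.mem_ker] at n m1 m2 ⊢
  simp only [map_add, map_sub, map_smul, m1, m2, smul_zero, zero_add, sub_zero,
    add_zero] at n ⊢
  have n' := congrArg ((qF F / (qF F ^ 2 + 1)) • ·) n
  simp only [smul_zero] at n'
  rw [← n']
  match_scalars <;> field_simp <;> ring

omit [Algebra K F] in
theorem mem_of_det_ne_zero {n : Type*} [Fintype n] [DecidableEq n] {X : Type*} [AddCommGroup X]
    [Module F X] {N : Submodule F X} {M : Matrix n n F} (hM : M.det ≠ 0) {u : n → X}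
    (h : ∀ i, ∑ j, M i j • u j ∈ N) (j : n) : u j ∈ N := by
  have h1 : M⁻¹ * M = 1 := Matrix.nonsing_inv_mul M (isUnit_iff_ne_zero.2 hM)
  have h2 : u j = ∑ i, M⁻¹ j i • ∑ k, M i k • u k := by
    simp only [Finset.smul_sum, smul_smul]
    rw [Finset.sum_comm]
    simp only [← Finset.sum_smul, ← Matrix.mul_apply, h1, Matrix.one_apply, ite_smul, one_smul,
      zero_smul, Finset.sum_ite_eq, Finset.mem_univ, if_true]
  rw [h2]
  exact sum_mem fun i _ => N.smul_mem _ (h i)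

/-- Away from the zeros of the leading coefficient, `u_{2Λ_1}` generates `V^1_x ⊗ V^1_y`. -/
theorem eq_top_of_top_mem (hz : aTwo (x / y : F) ≠ 0)
    (hN : ∀ g, ∀ w ∈ N, tensorRep x y g w ∈ N) (h : hwVec F .twoLam1 ∈ N) : N = ⊤ := by
  have hq := qF_ne_zero (F := F)
  have h2 := n_two F
  have h3 := n_three F
  have h8 := n_eight F
  have h7 := n_seven F
  have h12 := n_twelve F
  have hx := x.ne_zero
  have hy := y.ne_zero
  obtain ⟨⟨hz1, hz2⟩, hz3⟩ : ((y : F) - qF F ^ 2 * x ≠ 0 ∧ (y : F) - qF F ^ 6 * x ≠ 0) ∧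
      (y : F) ^ 2 + qF F ^ 4 * x * y + qF F ^ 8 * x ^ 2 ≠ 0 := by
    rw [aTwo, mul_ne_zero_iff, mul_ne_zero_iff] at hz
    refine ⟨⟨fun h => hz.1.1 ?_, fun h => hz.1.2 ?_⟩, fun h => hz.2 ?_⟩ <;> field_simp
    · rw [h, mul_zero]
    · rw [h, mul_zero]
    · linear_combination h
  have hf : ∀ i : Fin 3, i ≠ 0 → ∀ w ∈ N, tensorRep 1 1 (gen (.f i)) w ∈ N := fun i hi w hw => by
    rw [← tensorRep_eq_one x y (gen_mem_UG2 hi).2.1]; exact hN _ w hw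
  have he : ∀ i : Fin 3, i ≠ 0 → ∀ w ∈ N, tensorRep 1 1 (gen (.e i)) w ∈ N := fun i hi w hw => by
    rw [← tensorRep_eq_one x y (gen_mem_UG2 hi).1]; exact hN _ w hw
  have c2 := component_le hf h
  have n1 := hN (gen (.e 0)) _ h
  rw [e0_two, add_assoc, add_assoc, add_assoc,
    Submodule.add_mem_iff_right N (N.smul_mem _ (c2 vecTwoA_mem))] at n1
  -- `e_2 e_1` isolates the component of highest weight `\barΛ_2`
  have hl : hwVec F .lam2 ∈ N := by
    have n2 := he 2 (by decide) _ (he 1 (by decide) _ n1)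
    have e1 : tensorRep 1 1 (gen (.e 2)) (tensorRep 1 1 (gen (.e 1)) (vecLamA F)) =
        ((qF F ^ 4 + qF F ^ 2 + 1) / qF F ^ 2) • hwVec F .lam2 := by
      simp [vecLamA, hwVec_eval, tensorRep_e_v, eVec_one, eVec_two, twist_eval, qiF_eval, wt_one,
        wt_two, TensorProduct.tmul_smul, ← TensorProduct.smul_tmul', smul_smul]
      match_scalars <;> field_simp <;> ring
    simp only [map_add, map_smul, e1, hwVec_e _ (show (1 : Fin 3) ≠ 0 by decide),
      smul_zero, add_zero, smul_smul] at n2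
    refine (Submodule.smul_mem_iff N ?_).1 n2
    exact mul_ne_zero (div_ne_zero (mul_ne_zero (pow_ne_zero 2 hq) hz1) (mul_ne_zero h2 h3))
      (div_ne_zero h3 (pow_ne_zero 2 hq))
  have c1 := component_le hf hl
  rw [Submodule.add_mem_iff_right N (N.smul_mem _ (c1 vecLamA_mem))] at n1
  have n2 := he 1 (by decide) _ (hN (gen (.e 0)) _ hl)
  -- `e_1 e_0 u_{Λ_2}` is a second combination of the `u_{Λ_1}^{(i)}`, modulo `2\barΛ_1`
  have e2 : tensorRep 1 1 (gen (.e 1)) (tensorRep x y (gen (.e 0)) (hwVec F .lam2)) =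
      (qF F ^ 2 * ((x : F) - qF F ^ 2 * y) / ((qF F ^ 2 + 1) ^ 2 * (qF F ^ 8 + 1))) •
        tensorRep 1 1 (gen (.e 1)) (vecTwoB F)
      + ((-(qF F * y)) • hwVec F (.lam1 0) + (qF F * x) • hwVec F (.lam1 1)
      + ((qF F ^ 6 * x + y) / ((qF F ^ 2 + 1) * (qF F ^ 8 + 1))) • hwVec F (.lam1 2)) := by
    have hc : ∀ i, tensorRep 1 1 (gen (.e 1)) (copyMap F (.lam1 i) (v .b2)) =
        hwVec F (.lam1 i) := fun i => by
      have := copyMap_top (F := F) (k := .lam1 i) trivial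
      simp only [copyTop] at this
      rw [← this, copyMap_v, copyMap_lam1_e _ (by decide), eVec_one.2.1]
    simp only [e0_lam2, map_add, map_sub, map_smul, hc]
    module
  rw [e2, Submodule.add_mem_iff_right N (N.smul_mem _
    (c2 (component_stable _ _ (gen_mem_UG2 (by decide)).1 _ vecTwoB_mem)))] at n2
  have n3 := combo_mem hN c2 c1 n2
  have hu1 : ∀ i, hwVec F (.lam1 i) ∈ N := by
    refine mem_of_det_ne_zero (u := fun i => hwVec F (.lam1 i)) (M := !![(y : F), qF F ^ 2 * x,
        qF F * (y - qF F ^ 8 * x) / ((qF F ^ 2 + 1) * (qF F ^ 4 + qF F ^ 2 + 1) * (qF F ^ 8 + 1));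
      -(qF F * y), qF F * x, (qF F ^ 6 * x + y) / ((qF F ^ 2 + 1) * (qF F ^ 8 + 1));
      -(qF F * y) * x * qF F / (qF F ^ 2 + 1) -
          (qF F ^ 6 * x + y) / ((qF F ^ 2 + 1) * (qF F ^ 8 + 1)) * qF F ^ 6 * y,
        qF F * x * y * qF F / (qF F ^ 2 + 1) +
          (qF F ^ 6 * x + y) / ((qF F ^ 2 + 1) * (qF F ^ 8 + 1)) * x,
        (-(qF F * y) * y - qF F * x * x * qF F ^ 6) / ((qF F ^ 2 + 1) ^ 2 * (qF F ^ 8 + 1)) -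
          (qF F ^ 6 * x + y) / ((qF F ^ 2 + 1) * (qF F ^ 8 + 1)) * (x + y) * qF F ^ 3 *
            (qF F ^ 4 - qF F ^ 2 + 1) / ((qF F ^ 2 + 1) * (qF F ^ 8 + 1))]) ?_ (fun i => ?_)
    rotate_left
    · fin_cases i
      all_goals
        simp only [Fin.sum_univ_three, Matrix.of_apply, Matrix.cons_val, Fin.zero_eta, Fin.mk_one,
          Fin.reduceFinMk]
      · exact n1
      · exact n2
      · exact n3
    · -- the determinant is `-(q² + 1)² x y (y² + q⁴ x y + q⁸ x²) / ((q⁸ + 1) (q⁴ + q² + 1))`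
      have hdet := mul_ne_zero (mul_ne_zero (mul_ne_zero hx hy) hz3) (div_ne_zero
        (pow_ne_zero 2 h2) (mul_ne_zero h8 h3))
      have h3' := n_three' F
      rw [← neg_ne_zero] at hdet
      convert hdet using 1
      rw [Matrix.det_fin_three]
      simp only [Matrix.of_apply, Matrix.cons_val]
      field_simp
      ring
  have c3 := fun i => component_le hf (hu1 i)
  have c3' : ∀ i a, copyMap F (.lam1 i) (v a) ∈ N := fun i a => c3 i (copyMap_mem (k := .lam1 i) trivial a)
  have n4 := hN (gen (.e 0)) _ (hu1 2)
  have n5 := hN (gen (.e 0)) _ (hu1 0)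
  have hu2 : hwVec F (.triv 1) ∈ N := by
    rw [e0_lam1_two, Submodule.add_mem_iff_right N] at n4
    · refine (Submodule.smul_mem_iff N ?_).1 n4
      exact div_ne_zero (mul_ne_zero (mul_ne_zero hz2 h3) h8) (mul_ne_zero h7 h12)
    · exact sub_mem (add_mem (sub_mem (sub_mem (N.smul_mem _ (c2 vecTwoC_mem))
        (N.smul_mem _ (c1 vecLamC_mem))) (N.smul_mem _ (c3' _ _))) (N.smul_mem _ (c3' _ _)))
        (N.smul_mem _ (c3' _ _))
  have hu3 : hwVec F (.triv 0) ∈ N := by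
    rw [e0_lam1_zero, Submodule.add_mem_iff_left N (N.smul_mem _ hu2),
      Submodule.add_mem_iff_right N] at n5
    · exact (Submodule.smul_mem_iff N hx).1 n5
    · exact add_mem (add_mem (sub_mem (N.smul_mem _ (c2 vecTwoC_mem))
        (N.smul_mem _ (c1 vecLamC_mem))) (N.smul_mem _ (c3' _ _))) (N.smul_mem _ (c3' _ _))
  refine eq_top_of_stable N hf fun k => ?_
  rcases k with _ | _ | i | i
  · exact h
  · exact hl
  · exact hu1 i
  · fin_cases i
    · exact hu3
    · exact hu2

end cyclic

variable {x y : Fˣ}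

theorem IsIntertwiner.linear {R : Module.End F (W F)} (hR : IsIntertwiner x y R) {g : U}
    (hg : g ∈ UG2) (w : W F) : R (tensorRep 1 1 g w) = tensorRep 1 1 g (R w) := by
  rw [← tensorRep_eq_one x y hg, hR, tensorRep_eq_one y x hg, tensorRep_eq_one x y hg]

/-- The highest weight `2\barΛ_1` has multiplicity one. -/
theorem IsIntertwiner.apply_top {R : Module.End F (W F)} (hR : IsIntertwiner x y R) :
    ∃ c : F, R (hwVec F .twoLam1) = c • hwVec F .twoLam1 := by
  have hq := qF_ne_zero (F := F)
  refine ⟨formW F (R (hwVec F .twoLam1)) (hwVec F .twoLam1), ?_⟩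
  rw [← sub_eq_zero]
  refine IsHighest.eq_zero (fun i hi => ?_) (fun k => ?_)
  · rw [map_sub, ← hR.linear (gen_mem_UG2 hi).1, map_smul, hwVec_e _ hi]
    simp
  · -- the `t_1`-weight separates `u_{2Λ_1}` from the other highest weight vectors
    have h1 := formW_t 1 1 1 1 1 (R (hwVec F .twoLam1)) (hwVec F k)
    rw [← hR.linear (gen_mem_UG2 (by decide)).2.2.1, hwVec_t, hwVec_t, map_smul, map_smul, map_smul,
      LinearMap.smul_apply, smul_eq_mul, smul_eq_mul, qiF_eval.2.1] at h1
    have h2 := qF_pow_ne_one (F := F) 2 (by norm_num)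
    have h3 := qF_pow_ne_one (F := F) 1 (by norm_num)
    rw [map_sub, LinearMap.sub_apply, map_smul, LinearMap.smul_apply, formW_hwVec]
    rcases k with _ | _ | i | i
    · simp [hwNrm]
    all_goals simp only [reduceCtorEq, if_false, smul_zero, sub_zero]
    · refine (mul_eq_zero.1 ?_).resolve_left (sub_ne_zero.2 h2)
      simpa [Comp.weight, sub_mul, sub_eq_zero] using h1
    · refine (mul_eq_zero.1 ?_).resolve_left (mul_ne_zero hq (sub_ne_zero.2 h3))
      simp only [Comp.weight, Matrix.cons_val, zpow_ofNat] at h1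
      linear_combination h1
    · refine (mul_eq_zero.1 ?_).resolve_left (sub_ne_zero.2 h2)
      simpa [Comp.weight, sub_mul, sub_eq_zero] using h1

/-- Intertwiners are determined by the eigenvalue on `u_{2Λ_1}`, which generates the module. -/
theorem IsIntertwiner.eq_smul {R R' : Module.End F (W F)} (hR' : IsIntertwiner x y R')
    (hR : IsSpectral (x / y : F) R) (hz : aTwo (x / y : F) ≠ 0) : ∃ c : F, R' = c • R := by
  obtain ⟨c, hc⟩ := hR'.apply_top
  refine ⟨c / aTwo (x / y : F), ?_⟩
  rw [← sub_eq_zero, ← LinearMap.ker_eq_top]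
  refine eq_top_of_top_mem hz (fun g w hw => ?_) ?_
  · rw [LinearMap.mem_ker, LinearMap.sub_apply, LinearMap.smul_apply] at hw ⊢
    rw [hR' g, hR.isIntertwiner g, ← map_smul, ← map_sub, hw, map_zero]
  · rw [LinearMap.mem_ker, LinearMap.sub_apply, LinearMap.smul_apply, hc, hR.two, smul_smul,
      div_mul_cancel₀ _ hz, sub_self]

/-! ### Determinants -/

theorem det_aLam1 {z : F} (hz : aTwo z ≠ 0) : (aLam1 z).det =
    ((z - qF F ^ 2) ^ 2 * (z ^ 2 + qF F ^ 4 * z + qF F ^ 8)) /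
      ((1 - qF F ^ 2 * z) ^ 2 * (1 + qF F ^ 4 * z + qF F ^ 8 * z ^ 2)) * aTwo z ^ 3 := by
  have h2 := n_two F
  rw [add_comm] at h2
  unfold aTwo at hz ⊢
  obtain ⟨hz1, hz3⟩ := mul_ne_zero_iff.1 hz
  obtain ⟨hz1, hz2⟩ := mul_ne_zero_iff.1 hz1
  have e : ((z - qF F ^ 2) ^ 2 * (z ^ 2 + qF F ^ 4 * z + qF F ^ 8)) /
      ((1 - qF F ^ 2 * z) ^ 2 * (1 + qF F ^ 4 * z + qF F ^ 8 * z ^ 2)) *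
      ((1 - qF F ^ 2 * z) * (1 - qF F ^ 6 * z) * (1 + qF F ^ 4 * z + qF F ^ 8 * z ^ 2)) ^ 3 =
      ((z - qF F ^ 2) ^ 2 * (z ^ 2 + qF F ^ 4 * z + qF F ^ 8)) *
        ((1 - qF F ^ 2 * z) * (1 - qF F ^ 6 * z) ^ 3 *
          (1 + qF F ^ 4 * z + qF F ^ 8 * z ^ 2) ^ 2) := by
    rw [div_mul_eq_mul_div, div_eq_iff (mul_ne_zero (pow_ne_zero 2 hz1) hz3)]
    ring
  rw [e, Matrix.det_fin_three]
  simp only [aLam1, Matrix.of_apply, Matrix.cons_val]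
  clear e hz1 hz2 hz3 hz
  field_simp
  ring

theorem det_aZero {z : F} (h0 : z ≠ 0) (hz : aTwo z ≠ 0) : (aZero z).det =
    ((z - qF F ^ 2) * (z - qF F ^ 6) * (z ^ 2 + qF F ^ 4 * z + qF F ^ 8)) /
      ((1 - qF F ^ 2 * z) * (1 - qF F ^ 6 * z) * (1 + qF F ^ 4 * z + qF F ^ 8 * z ^ 2)) *
      aTwo z ^ 2 := by
  have h2 := n_two F
  rw [add_comm] at h2
  have h4 : 1 - qF F ^ 4 ≠ 0 := sub_ne_zero.2 (Ne.symm (qF_pow_ne_one 4 (by norm_num)))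
  rw [← aTwo, div_mul_eq_mul_div, sq (aTwo z), ← mul_assoc, mul_div_cancel_right₀ _ hz,
    Matrix.det_fin_two]
  simp only [aZero, aZeroOne, aTwo, Matrix.of_apply, Matrix.cons_val]
  clear hz
  field_simp
  ring

/-! ### Independent spectral parameters -/

theorem zPar_ne_zero : zPar ≠ 0 := div_ne_zero xPar.ne_zero yPar.ne_zero

theorem aTwo_zPar_ne_zero : aTwo zPar ≠ 0 := by
  intro h
  let X : MvPolynomial (Fin 2) K := MvPolynomial.X 0
  let Y : MvPolynomial (Fin 2) K := MvPolynomial.X 1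
  let C : MvPolynomial (Fin 2) K := MvPolynomial.C q
  have hy := yPar.ne_zero
  have hp : (Y - C ^ 2 * X) * (Y - C ^ 6 * X) * (Y ^ 2 + C ^ 4 * X * Y + C ^ 8 * X ^ 2) = 0 := by
    apply IsFractionRing.injective (MvPolynomial (Fin 2) K) Kxy
    have hX : algebraMap (MvPolynomial (Fin 2) K) Kxy X = xPar := rfl
    have hY : algebraMap (MvPolynomial (Fin 2) K) Kxy Y = yPar := rfl
    have hC : algebraMap (MvPolynomial (Fin 2) K) Kxy C = qF Kxy := rfl
    simp only [map_mul, map_sub, map_add, map_pow, hX, hY, hC, map_zero]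
    rw [aTwo, zPar] at h
    field_simp at h
    linear_combination h
  -- the value at `x = 0`, `y = 1` is `1`
  have h1 := congrArg (MvPolynomial.eval ![0, 1]) hp
  simp [X, Y, C] at h1

/-- The eigenvalue on `u_{2Λ_1}` as a matrix coefficient. -/
theorem IsSpectral.smul_coeff {z c : F} {R : Module.End F (W F)} (hR : IsSpectral z R) :
    ((Pi.basisFun F Idx).tensorProduct (Pi.basisFun F Idx)).repr
      ((c • R) (v .b1 ⊗ₜ v .b1)) (.b1, .b1) = c * aTwo z := by
  have h := hR.two
  rw [(hwVec_eval F).1] at h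
  rw [LinearMap.smul_apply, h, show (v .b1 ⊗ₜ v .b1 : W F) =
    ((Pi.basisFun F Idx).tensorProduct (Pi.basisFun F Idx)) (.b1, .b1) by simp [v]]
  simp

end D43

theorem mainTheorem6 :
    DirectSum.IsInternal (D43.component D43.Kxy) ∧
    (∀ k : D43.Comp,
      D43.IsIrredHighestWeight (D43.component D43.Kxy k) (D43.hwVec D43.Kxy k) k.weight) ∧
    (∃ (P : ∀ k, D43.W D43.Kxy →ₗ[D43.Kxy] D43.component D43.Kxy k)
      (ι₁ : ∀ j i : Fin 3,
        D43.component D43.Kxy (.lam1 i) ≃ₗ[D43.Kxy] D43.component D43.Kxy (.lam1 j))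
      (ι₀ : ∀ j i : Fin 2,
        D43.component D43.Kxy (.triv i) ≃ₗ[D43.Kxy] D43.component D43.Kxy (.triv j)),
      (∀ k, D43.IsComponentProj k (P k)) ∧
      (∀ j i, D43.IsComponentIso (.lam1 i) (.lam1 j) (ι₁ j i)) ∧
      (∀ j i, D43.IsComponentIso (.triv i) (.triv j) (ι₀ j i)) ∧
      D43.IsRMatrix D43.xPar D43.yPar (D43.spectralR D43.zPar P ι₁ ι₀) ∧
      ∀ R : Module.End D43.Kxy (D43.W D43.Kxy), D43.IsIntertwiner D43.xPar D43.yPar R →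
        ∃ c : D43.Kxy, R = c • D43.spectralR D43.zPar P ι₁ ι₀ ∧
          (D43.HasCoeffsIn (IntermediateField.adjoin D43.K {D43.zPar} : Set D43.Kxy) R →
            c ∈ IntermediateField.adjoin D43.K {D43.zPar})) ∧
    (D43.aLam1 D43.zPar).det =
      ((D43.zPar - D43.qF D43.Kxy ^ 2) ^ 2 *
          (D43.zPar ^ 2 + D43.qF D43.Kxy ^ 4 * D43.zPar + D43.qF D43.Kxy ^ 8)) /
        ((1 - D43.qF D43.Kxy ^ 2 * D43.zPar) ^ 2 *
          (1 + D43.qF D43.Kxy ^ 4 * D43.zPar + D43.qF D43.Kxy ^ 8 * D43.zPar ^ 2)) *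
        D43.aTwo D43.zPar ^ 3 ∧
    (D43.aZero D43.zPar).det =
      ((D43.zPar - D43.qF D43.Kxy ^ 2) * (D43.zPar - D43.qF D43.Kxy ^ 6) *
          (D43.zPar ^ 2 + D43.qF D43.Kxy ^ 4 * D43.zPar + D43.qF D43.Kxy ^ 8)) /
        ((1 - D43.qF D43.Kxy ^ 2 * D43.zPar) * (1 - D43.qF D43.Kxy ^ 6 * D43.zPar) *
          (1 + D43.qF D43.Kxy ^ 4 * D43.zPar + D43.qF D43.Kxy ^ 8 * D43.zPar ^ 2)) *
        D43.aTwo D43.zPar ^ 2 := by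
  refine ⟨D43.component_isInternal D43.Kxy, D43.component_isIrredHighestWeight, ?_,
    D43.det_aLam1 D43.aTwo_zPar_ne_zero, D43.det_aZero D43.zPar_ne_zero D43.aTwo_zPar_ne_zero⟩
  choose P hP using D43.exists_componentProj (F := D43.Kxy)
  choose ι₁ h₁ using D43.exists_componentIso_lam1 (F := D43.Kxy)
  choose ι₀ h₀ using D43.exists_componentIso_triv (F := D43.Kxy)
  have hR : D43.IsSpectral (D43.xPar / D43.yPar : D43.Kxy) (D43.spectralR D43.zPar P ι₁ ι₀) :=
    D43.isSpectral_spectralR D43.zPar hP h₁ h₀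
  refine ⟨P, ι₁, ι₀, hP, h₁, h₀, ⟨fun h0 => ?_, hR.isIntertwiner,
    hR.hasCoeffsIn D43.zPar_ne_zero (Algebra.subset_adjoin (Set.mem_insert _ _))⟩,
    fun R' hR' => ?_⟩
  · have h := hR.smul_coeff (c := 1)
    rw [h0, smul_zero, LinearMap.zero_apply, map_zero, one_mul] at h
    exact D43.aTwo_zPar_ne_zero h.symm
  · obtain ⟨c, rfl⟩ := hR'.eq_smul hR D43.aTwo_zPar_ne_zero
    refine ⟨c, rfl, fun hc => ?_⟩
    have h := hc .b1 .b1 .b1 .b1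
    rw [hR.smul_coeff] at h
    have hz : D43.zPar ∈ IntermediateField.adjoin D43.K {D43.zPar} :=
      IntermediateField.mem_adjoin_simple_self D43.K D43.zPar
    have ha : D43.aTwo D43.zPar ∈ IntermediateField.adjoin D43.K {D43.zPar} :=
      D43.aTwo_mem (A := (IntermediateField.adjoin D43.K {D43.zPar}).toSubalgebra) hz
    have h' := div_mem h ha
    rwa [show (D43.xPar / D43.yPar : D43.Kxy) = D43.zPar from rfl,
      mul_div_cancel_right₀ _ D43.aTwo_zPar_ne_zero] at h'
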